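/- An allowable sequence on $N$ points is a doubly infinite sequence $\Pi=\{\pi_i\}_{i\in\mathbb Z}$ of permutations of a set of $N$ points such that: there is an integer $h\ge 1$ (the length of a halfperiod) for which $\pi_{i+h}$ is the reversal of $\pi_i$ for all $i$; for every $i$, $\pi_i$ is obtained from $\pi_{i-1}$ (the $i$-th move) by reversing one or more disjoint substrings, each of at least two consecutive elements (the switches of the move); and any two distinct points participate together in a switch exactly once within a halfperiod. Let $N=2n$. A crossing switch is one that reverses a centered substring. The sequence $\Pi$ is even-near-critical if $h=2n$; it is centrally symmetric if every point $p$ has a conjugate $\overline p$ such that in every $\pi_i$ the positions of $p$ and $\overline p$ add up to $2n+1$; it is in noncentral general position if every switch that is not a crossing switch reverses exactly two points; its central signature is $(d_1,\dots,d_t)$, where the crossing switches in the moves $1,\dots,h$ are, in this order, $t$ switches reversing $2d_1,\dots,2d_t$ points. The circular sequence of a finite set $P$ of points in the plane is the doubly infinite sequence of the orders in which $P$ is projected on an oriented line that rotates about a fixed point; $\Pi$ is geometrically realizable if it is the circular sequence of a set of $N$ distinct points of the plane, suitably labelled. **Theorem 4.2.** Let $t\ge 2$ and let $d_1,\dots,d_t$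 be positive integers. There is a unique even-near-critical centrally symmetric allowable sequence $\mathrm{DC}^{cs}_{ncgen}(d_1,\dots,d_t)$ in noncentral general position with central signature $(d_1,\dots,d_t)$, with $\pi_0=(1,2,\dots,n,\overline n,\dots,\overline 2,\overline 1)$ for some $n$, and whose first move includes a crossing switch. It is geometrically realizable if and only if at least one of the following holds: 1. $d_1=d_2=\cdots=d_t=1$; 2. $t=2$; 3. $t=3$ and (at least) two of $d_1,d_2,d_3$ are equal to $1$; 4. $t=3$ and $(d_1,d_2,d_3)=(2,2,2)$. -/

import Mathlib

/-- One move. A permutation `σ : Equiv.Perm (Fin N)` is read as the function sending each of the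
`N` points to its position (positions are `0, …, N - 1`, from left to right). `IsMove σ τ S` says
that `τ` is obtained from `σ` by reversing one or more disjoint substrings; the reversed substrings
(switches) are recorded in `S`, the pair `(a, b)` with `a < b` standing for the substring in
positions `a, a + 1, …, b`. -/
structure IsMove {N : ℕ} (σ τ : Equiv.Perm (Fin N)) (S : Finset (Fin N × Fin N)) : Prop where
  nonempty : S.Nonempty
  lt : ∀ s ∈ S, s.1 < s.2
  disjoint : ∀ s ∈ S, ∀ s' ∈ S, s ≠ s' → Disjoint (Finset.Icc s.1 s.2) (Finset.Icc s'.1 s'.2)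
  reverse : ∀ s ∈ S, ∀ p, σ p ∈ Finset.Icc s.1 s.2 → (σ p : ℕ) + (τ p : ℕ) = s.1 + s.2
  fixed : ∀ p, (∀ s ∈ S, σ p ∉ Finset.Icc s.1 s.2) → τ p = σ p

/-- An allowable sequence on the set of points `Fin N`: a doubly infinite sequence of permutations,
together with its moves and the length of its halfperiod. The labelling of the points is
normalized separately, by `π₀ = id`, where it is needed. -/
@[ext]
structure AllowableSequence (N : ℕ) where
  /-- `perm i p` is the position of the point `p` in the permutation `π_i`. -/
  perm : ℤ → Equiv.Perm (Fin N)
  /-- `switches i` is the set of switches of the `i`-th move, from `π_{i-1}` to `π_i`. -/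
  switches : ℤ → Finset (Fin N × Fin N)
  /-- The length of a halfperiod. -/
  halfperiod : ℕ
  halfperiod_pos : 0 < halfperiod
  perm_add_halfperiod : ∀ i p, perm (i + halfperiod) p = (perm i p).rev
  isMove : ∀ i, IsMove (perm (i - 1)) (perm i) (switches i)
  /-- Two distinct points participate together in a switch exactly once within a halfperiod. -/
  existsUnique_switch : ∀ p q, p ≠ q → ∃! i : ℤ, 1 ≤ i ∧ i ≤ halfperiod ∧
    ∃ s ∈ switches i, perm (i - 1) p ∈ Finset.Icc s.1 s.2 ∧ perm (i - 1) q ∈ Finset.Icc s.1 s.2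

/-- The orthogonal projection of the point `x` of the plane on the oriented line through the origin
with direction `(cos φ, sin φ)`. -/
noncomputable def projAt (φ : ℝ) (x : EuclideanSpace ℝ (Fin 2)) : ℝ :=
  x 0 * Real.cos φ + x 1 * Real.sin φ

/-- `π` is the circular sequence of the labelled points `P`: rotating the line on which `P` is
projected, the critical angles (those at which two points of `P` have the same projection) are
`⋯ < θ (-1) < θ 0 < θ 1 < ⋯`, and between `θ i` and `θ (i + 1)` the points are projected in the
order given by `π i`. -/
def IsCircularSequence {N : ℕ} (P : Fin N → EuclideanSpace ℝ (Fin 2))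
    (π : ℤ → Equiv.Perm (Fin N)) : Prop :=
  ∃ θ : ℤ → ℝ, StrictMono θ ∧
    Set.range θ = {φ : ℝ | ∃ p q, p ≠ q ∧ projAt φ (P p) = projAt φ (P q)} ∧
    ∀ (i : ℤ) (φ : ℝ), θ i < φ → φ < θ (i + 1) →
      ∀ p q, π i p < π i q ↔ projAt φ (P p) < projAt φ (P q)

namespace AllowableSequence

/-- `A` is the circular sequence of a set of `N` distinct points in the plane. -/
def IsGeometricallyRealizable {N : ℕ} (A : AllowableSequence N) : Prop :=
  ∃ P : Fin N → EuclideanSpace ℝ (Fin 2), Function.Injective P ∧ IsCircularSequence P A.perm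

/-- Every point `p` has a conjugate `q`: in every permutation the (1-based) positions of `p` and `q`
add up to `N + 1`. -/
def IsCentrallySymmetric {N : ℕ} (A : AllowableSequence N) : Prop :=
  ∀ p, ∃ q, ∀ i, A.perm i q = (A.perm i p).rev

/-- An allowable sequence on an even number `2n` of points is even-near-critical if its halfperiod
has length `2n`. -/
def IsEvenNearCritical {n : ℕ} (A : AllowableSequence (2 * n)) : Prop :=
  A.halfperiod = 2 * n

/-- A crossing switch reverses a centered substring. -/
def IsCrossing {N : ℕ} (s : Fin N × Fin N) : Prop := s.2 = s.1.rev

/-- All switches, except perhaps the crossing ones, are transpositions. -/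
def InNoncentralGeneralPosition {N : ℕ} (A : AllowableSequence N) : Prop :=
  ∀ i, ∀ s ∈ A.switches i, ¬ IsCrossing s → (s.2 : ℕ) = s.1 + 1

/-- `A` has central signature `(d 0, …, d (t - 1))`: within the halfperiod that starts at `π₀`, the
moves containing a crossing switch are `m 0 < ⋯ < m (t - 1)`, and the crossing switch in move `m j`
reverses `2 * d j` points. -/
def HasCentralSignature {N t : ℕ} (A : AllowableSequence N) (d : Fin t → ℕ) : Prop :=
  ∃ m : Fin t → ℤ, StrictMono m ∧
    Set.range m = {i : ℤ | 1 ≤ i ∧ i ≤ A.halfperiod ∧ ∃ s ∈ A.switches i, IsCrossing s} ∧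
    ∀ j, ∃ s ∈ A.switches (m j), IsCrossing s ∧ (s.2 : ℕ) + 1 = s.1 + 2 * d j

/-- The properties defining the sequence `DC^cs_ncgen(d)`: an even-near-critical centrally symmetric
allowable sequence in noncentral general position with central signature `d`, with the points
labelled by their positions in `π₀` (the conjugate of `p` is then `p.rev`, so that `π₀` reads
`1, 2, …, n, n̄, …, 2̄, 1̄`), and whose first move includes a crossing switch. -/
structure IsDC {n t : ℕ} (A : AllowableSequence (2 * n)) (d : Fin t → ℕ) : Prop where
  evenNearCritical : A.IsEvenNearCritical
  centrallySymmetric : A.IsCentrallySymmetric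
  noncentralGeneralPosition : A.InNoncentralGeneralPosition
  centralSignature : A.HasCentralSignature d
  perm_zero : A.perm 0 = 1
  first_move : ∃ s ∈ A.switches 1, IsCrossing s

end AllowableSequence

/-! The points that the `a`-th crossing switch brings to the left half form class `a`; class `a + t`
is the conjugate of class `a`, so classes are indexed by integers and repeat modulo `2 * t`. For `a
< b < a + t`, each point of class `a` passes each point of class `b - t` strictly between the
crossings of `a` and `b`. Outside crossing switches a point passes at most one other point per move,
so these passing times are strictly monotone in both indices. For consecutive classes such a grid
needs `size a + size (a + 1) - 1` moves. Summed over a period, these bounds already use up all `2n`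
moves of a halfperiod, so the crossing times are forced (`CrossData.time_eq`). Induction on `b - a`
then forces every other passing time to be `swapTime` (`CrossData.passes_swapTime`). The passing
times fix the order of any two points at any time, hence the sequence (`IsLabelling.eq`).
Conversely, letting every point wait at the centre, walk outwards, wait again and walk back gives
explicit positions `PeriodicSignature.pos` that do form a sequence
(`PeriodicSignature.exists_isLabelling`).

Realizability becomes linear algebra. In a realization, the differences `V a i` of opposite points
satisfy `V (a + t) i = -V a i`, and all vectors `V c k` and sums `V a i + V b j` belonging to one
move are parallel (`exists_isConfiguration`). Conversely, vectors whose sums and differences have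
directions turning in the right order are themselves a realization
(`IsLabelling.isGeometricallyRealizable`).

Sufficiency: a regular `2n`-gon works if all sizes are 1. In the other cases the classes lie on `t`
equally spaced lines, at distances that are powers of 2 (`t = 2`), integers (two sizes equal to 1),
or powers of the golden ratio (sizes 2, 2, 2).

Necessity: suppose class `a` has two points. Coincidences between passing times force the point next
to the innermost point `C` of class `a + 2` to be a multiple of `C` (`exists_ratio`), and one more
point after it would lie on the wrong side of `C` (`size_lt_two`). If `t ≥ 4` one of these
contradictions always arises. If `t = 3` and two classes have more than one point, the constraint
travels around the three classes and makes every size 2 (`size_eq_two`). -/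

/-! ### Periodic signatures and the times they prescribe. -/

/-- A positive sequence of class sizes with period `t`, together with its partial sums; `n` is the
sum over one period. -/
structure PeriodicSignature (t n : ℕ) where
  /-- The size of a class. -/
  size : ℤ → ℕ
  /-- The sum of the sizes of the preceding classes. -/
  offset : ℤ → ℤ
  size_pos : ∀ a, 0 < size a
  offset_succ : ∀ a, offset (a + 1) = offset a + size a
  offset_add : ∀ a, offset (a + t) = offset a + n
  offset_zero : offset 0 = 0

namespace PeriodicSignature

variable {t n : ℕ} (G : PeriodicSignature t n)

/-- The move in which class `a` is reversed. -/
def crossTime (a : ℤ) : ℤ := 1 - G.size 0 + G.offset a + G.offset (a + 1)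

/-- The move in which the `i`-th point of class `a` passes the `j`-th point of class `b - t`. -/
def swapTime (a : ℤ) (i : ℕ) (b : ℤ) (j : ℕ) : ℤ :=
  1 - G.size 0 + G.offset a + i + G.offset (b + 1) - j

lemma offset_strictMono : StrictMono G.offset :=
  strictMono_int_of_lt_succ fun a => by
    have := G.size_pos a
    rw [G.offset_succ]; omega

lemma offset_add_size_le {a b : ℤ} (h : a < b) : G.offset a + G.size a ≤ G.offset b := by
  rw [← G.offset_succ]; exact G.offset_strictMono.monotone (by omega)

lemma size_add (a : ℤ) : G.size (a + t) = G.size a := by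
  have h1 := G.offset_succ (a + t)
  have h2 := G.offset_add (a + 1)
  have h3 := G.offset_succ a
  have h4 := G.offset_add a
  rw [show a + 1 + (t : ℤ) = a + t + 1 by ring] at h2
  omega

lemma size_sub (a : ℤ) : G.size (a - t) = G.size a := by
  have := G.size_add (a - t)
  rwa [sub_add_cancel, eq_comm] at this

lemma offset_add_mul (a m : ℤ) : G.offset (a + t * m) = G.offset a + n * m := by
  induction m using Int.induction_on with
  | zero => simp
  | succ k ih =>
    rw [show a + t * ((k : ℤ) + 1) = a + t * k + t by ring, G.offset_add, ih]; ring
  | pred k ih =>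
    have := G.offset_add (a + t * (-(k : ℤ) - 1))
    rw [show a + t * (-(k : ℤ) - 1) + t = a + t * -k by ring, ih] at this
    linarith

lemma size_add_mul (a m : ℤ) : G.size (a + t * m) = G.size a := by
  have h1 := G.offset_add_mul a m
  have h2 := G.offset_add_mul (a + 1) m
  rw [show a + 1 + t * m = a + t * m + 1 by ring, G.offset_succ, G.offset_succ] at h2
  omega

lemma pos_of_pos (G : PeriodicSignature t n) (ht : 0 < t) : 0 < n := by
  have := G.offset_strictMono (show (0 : ℤ) < 0 + t by omega)
  rw [G.offset_add] at this
  omega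

lemma crossTime_strictMono : StrictMono G.crossTime := fun a b h => by
  have h1 := G.offset_strictMono h
  have h2 := G.offset_strictMono (show a + 1 < b + 1 by omega)
  simp only [crossTime]; omega

lemma crossTime_add (a : ℤ) : G.crossTime (a + t) = G.crossTime a + 2 * n := by
  simp only [crossTime, G.offset_add, show a + (t : ℤ) + 1 = a + 1 + t by ring]; ring

lemma crossTime_zero : G.crossTime 0 = 1 := by
  have := G.offset_succ 0
  rw [zero_add] at this
  simp only [crossTime, zero_add, this, G.offset_zero]; ring

lemma crossTime_succ (a : ℤ) : G.crossTime (a + 1) = G.crossTime a + G.size a + G.size (a + 1) := by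
  simp only [crossTime, G.offset_succ]; ring

lemma swapTime_add (a : ℤ) (i : ℕ) (b : ℤ) (j : ℕ) :
    G.swapTime (a + t) i (b + t) j = G.swapTime a i b j + 2 * n := by
  simp only [swapTime, G.offset_add, show b + (t : ℤ) + 1 = b + 1 + t by ring]; ring

lemma crossTime_lt_swapTime {a b : ℤ} (h : a < b) {i j : ℕ} (hj : j < G.size b) :
    G.crossTime a < G.swapTime a i b j := by
  have := G.offset_add_size_le h
  simp only [crossTime, swapTime, G.offset_succ]; omega

lemma swapTime_lt_crossTime {a b : ℤ} (h : a < b) {i j : ℕ} (hi : i < G.size a) :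
    G.swapTime a i b j < G.crossTime b := by
  have := G.offset_add_size_le h
  simp only [crossTime, swapTime, G.offset_succ]; omega

/-- Every pair of different indices can be brought, by shifting the classes by multiples of `2 * t`
and exchanging the two indices, to one of three standard forms. -/
lemma pair_cases (ht : 0 < t) {motive : ℤ → ℕ → ℤ → ℕ → ℤ → Prop}
    (swap : ∀ a i b j s, motive a i b j s → motive b j a i (s + 2 * n))
    (shift : ∀ a i b j s (m : ℤ), motive a i (b + 2 * t * m) j s → motive a i b j s)
    (same : ∀ a i j, i < j → j < G.size a → motive a i a j (G.crossTime a))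
    (conj : ∀ a i j, i < G.size a → j < G.size a → motive a i (a - t) j (G.crossTime a))
    (cross : ∀ (a : ℤ) i (b : ℤ) j, a < b → b < a + t → i < G.size a → j < G.size b →
      motive a i (b - t) j (G.swapTime a i b j))
    {a : ℤ} {i : ℕ} {b : ℤ} {j : ℕ} (hi : i < G.size a) (hj : j < G.size b)
    (hne : ¬ (i = j ∧ (2 * t : ℤ) ∣ b - a)) : ∃ s, motive a i b j s := by
  -- The representative of `b` modulo `2 * t` is taken in `[a - t, a + t)`: the left end is the
  -- conjugate class, `a` itself the same class, and the two open halves give the crossing form,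
  -- directly or after exchanging the points.
  obtain ⟨m, h1, h2⟩ : ∃ m : ℤ, a - t ≤ b + 2 * t * m ∧ b + 2 * t * m < a + t := by
    refine ⟨-((b - (a - t)) / (2 * t)), ?_, ?_⟩
    · have := Int.emod_nonneg (b - (a - t)) (show (2 * t : ℤ) ≠ 0 by omega)
      have h := Int.emod_add_mul_ediv (b - (a - t)) (2 * t)
      linarith
    · have := Int.emod_lt_of_pos (b - (a - t)) (show (0 : ℤ) < 2 * t by omega)
      have h := Int.emod_add_mul_ediv (b - (a - t)) (2 * t)
      linarith
  have hj' : j < G.size (b + 2 * t * m) := by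
    rw [show b + 2 * t * m = b + t * (2 * m) by ring, G.size_add_mul]; exact hj
  suffices ∃ s, motive a i (b + 2 * t * m) j s from this.imp fun s => shift a i b j s m
  have hm : b + 2 * t * m = a → i ≠ j := fun h hij => hne ⟨hij, -m, by linarith⟩
  generalize b + 2 * t * m = c at *
  rcases lt_trichotomy c a with h | h | h
  · rcases eq_or_lt_of_le h1 with h' | h'
    · subst h'
      exact ⟨_, conj a i j hi (by rwa [G.size_sub] at hj')⟩
    · have := cross a i (c + t) j (by omega) (by omega) hi (by rwa [G.size_add])
      rw [add_sub_cancel_right] at this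
      exact ⟨_, this⟩
  · subst h
    rcases lt_or_gt_of_ne (hm rfl) with h' | h'
    · exact ⟨_, same c i j h' hj'⟩
    · exact ⟨_, swap _ _ _ _ _ (same c j i h' hi)⟩
  · have := cross c j (a + t) i (by omega) (by omega) hj' (by rwa [G.size_add])
    rw [add_sub_cancel_right] at this
    exact ⟨_, swap _ _ _ _ _ this⟩

/-! ### Models: the signature alone determines the order of any two points. -/

/-- `P s a i` behaves like the position at time `s` of the `i`-th point of class `a` in the sequence
with central signature `G`. -/
structure IsModel (P : ℤ → ℤ → ℕ → ℤ) : Prop where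
  conj : ∀ s a i, P s (a + t) i = 2 * n - 1 - P s a i
  anti : ∀ s a i, P (s + 2 * n) a i = 2 * n - 1 - P s a i
  left : ∀ s a i, i < G.size a → G.crossTime a ≤ s → s < G.crossTime (a + t) → P s a i < n
  same : ∀ s a i j, i < j → j < G.size a → G.crossTime a ≤ s → s < G.crossTime (a + t) →
    P s a i < P s a j
  cross : ∀ (s a : ℤ) i (b : ℤ) j, a < b → b < a + t → i < G.size a → j < G.size b → G.crossTime a ≤ s →
    s < G.crossTime b → P s a i ≠ P s (b - t) j ∧
      (P s a i < P s (b - t) j ↔ G.swapTime a i b j ≤ s)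

variable {G}

namespace IsModel

variable {P : ℤ → ℤ → ℕ → ℤ}

lemma conj_sub (h : G.IsModel P) (s a : ℤ) (i : ℕ) : P s (a - t) i = 2 * n - 1 - P s a i := by
  have := h.conj s (a - t) i
  rw [sub_add_cancel] at this; omega

lemma periodic (h : G.IsModel P) (s a m : ℤ) (i : ℕ) : P s (a + 2 * t * m) i = P s a i := by
  have step : ∀ b, P s (b + 2 * t) i = P s b i := fun b => by
    rw [two_mul, ← add_assoc, h.conj, h.conj]; ring
  induction m using Int.induction_on with
  | zero => simp
  | succ k ih => rw [← ih, ← step (a + 2 * t * k)]; congr 1; ring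
  | pred k ih => rw [← ih, ← step]; congr 1; ring

lemma lt_same (h : G.IsModel P) {s a : ℤ} {i j : ℕ} (hij : i < j) (hj : j < G.size a)
    (h1 : G.crossTime a ≤ s) (h2 : s < G.crossTime a + 2 * n) : P s a i < P s a j :=
  h.same s a i j hij hj h1 (by rwa [G.crossTime_add])

lemma lt_conj (h : G.IsModel P) {s a : ℤ} {i j : ℕ} (hi : i < G.size a) (hj : j < G.size a)
    (h1 : G.crossTime a ≤ s) (h2 : s < G.crossTime a + 2 * n) : P s a i < P s (a - t) j := by
  rw [← G.crossTime_add] at h2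
  have h3 := h.left s a i hi h1 h2
  have h4 := h.left s a j hj h1 h2
  rw [h.conj_sub]; omega

/-- The window of `2n` moves is covered in three stretches: up to the crossing of `b` by the field
`cross`; then, until class `a` crosses back, because the two points are in different halves; finally
by `cross` for the conjugate pair, whose own swap is `2n` moves later and has not happened yet. -/
lemma lt_cross (h : G.IsModel P) {s a b : ℤ} {i j : ℕ} (hab : a < b) (hba : b < a + t)
    (hi : i < G.size a) (hj : j < G.size b) (h1 : G.swapTime a i b j ≤ s)
    (h2 : s < G.swapTime a i b j + 2 * n) : P s a i < P s (b - t) j := by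
  have hta := G.crossTime_lt_swapTime hab (i := i) hj
  have htb := G.swapTime_lt_crossTime hab (j := j) hi
  have hT := G.crossTime_strictMono hba
  have hT' := G.crossTime_strictMono hab
  rcases lt_or_ge s (G.crossTime b) with hs | hs
  · exact (h.cross s a i b j hab hba hi hj (by omega) hs).2.2 h1
  rcases lt_or_ge s (G.crossTime (a + t)) with hs' | hs'
  · have h3 := h.left s a i hi (by omega) hs'
    have h4 := h.left s b j hj hs (by rw [G.crossTime_add] at *; omega)
    rw [h.conj_sub]; omega
  · have h3 := h.cross s (a + t) i (b + t) j (by omega) (by omega) (by rwa [G.size_add])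
      (by rwa [G.size_add]) hs' (by
        have := G.crossTime_add b; omega)
    rw [add_sub_cancel_right, G.swapTime_add, h.conj] at h3
    rw [h.conj_sub]
    omega

/-- The order of two points is the same in all models: one of them is to the left of the other one
during one halfperiod, whose starting time does not depend on the model. -/
lemma exists_lt (ht : 0 < t) {a b : ℤ} {i j : ℕ} (hi : i < G.size a) (hj : j < G.size b)
    (hne : ¬ (i = j ∧ (2 * t : ℤ) ∣ b - a)) :
    ∃ s₀ : ℤ, ∀ P, G.IsModel P → ∀ s : ℤ, s₀ ≤ s → s < s₀ + 2 * n → P s a i < P s b j := by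
  refine G.pair_cases ht (motive := fun a i b j s₀ => ∀ P, G.IsModel P → ∀ s : ℤ, s₀ ≤ s →
    s < s₀ + 2 * n → P s a i < P s b j) ?_ ?_ ?_ ?_ ?_ hi hj hne
  · intro a i b j s₀ H P hP s h1 h2
    have := H P hP (s - 2 * n) (by omega) (by omega)
    have h3 := hP.anti (s - 2 * n) a i
    have h4 := hP.anti (s - 2 * n) b j
    rw [sub_add_cancel] at h3 h4
    omega
  · intro a i b j s₀ m H P hP s h1 h2
    have := H P hP s h1 h2
    rwa [hP.periodic] at this
  · exact fun a i j hij hj P hP s h1 h2 => hP.lt_same hij hj h1 h2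
  · exact fun a i j hi hj P hP s h1 h2 => hP.lt_conj hi hj h1 h2
  · exact fun a i b j hab hba hi hj P hP s h1 h2 => hP.lt_cross hab hba hi hj h1 h2

lemma anti_mul (h : G.IsModel P) (s m : ℤ) (a : ℤ) (i : ℕ) :
    P (s + 2 * n * m) a i = if Even m then P s a i else 2 * n - 1 - P s a i := by
  induction m using Int.induction_on with
  | zero => simp
  | succ k ih =>
    rw [show s + 2 * n * ((k : ℤ) + 1) = s + 2 * n * k + 2 * n by ring, h.anti, ih]
    by_cases hk : Even (k : ℤ) <;> simp only [hk, Int.even_add_one, not_true, not_false_iff,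
      if_true, if_false]
    ring
  | pred k ih =>
    have := h.anti (s + 2 * n * (-(k : ℤ) - 1)) a i
    rw [show s + 2 * n * (-(k : ℤ) - 1) + 2 * n = s + 2 * n * -k by ring, ih] at this
    by_cases hk : Even (-(k : ℤ)) <;> simp only [hk, Int.even_sub_one, not_true, not_false_iff,
      if_true, if_false] at this ⊢ <;> omega

/-- The number of halfperiods between `s` and the window of `exists_lt` does not depend on the
model, and its parity decides the order. This both compares two sequences and shows that explicit
positions never collide. -/
lemma forall_lt_or_forall_gt (ht : 0 < t) {a b : ℤ} {i j : ℕ} (hi : i < G.size a)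
    (hj : j < G.size b) (hne : ¬ (i = j ∧ (2 * t : ℤ) ∣ b - a)) (s : ℤ) :
    (∀ P, G.IsModel P → P s a i < P s b j) ∨ (∀ P, G.IsModel P → P s b j < P s a i) := by
  obtain ⟨s₀, H⟩ := exists_lt ht hi hj hne
  have hn := G.pos_of_pos ht
  have h1 := Int.emod_nonneg (s - s₀) (show (2 * n : ℤ) ≠ 0 by omega)
  have h2 := Int.emod_lt_of_pos (s - s₀) (show (0 : ℤ) < 2 * n by omega)
  have h3 := Int.emod_add_mul_ediv (s - s₀) (2 * n)
  generalize (s - s₀) / (2 * n) = m at *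
  generalize (s - s₀) % (2 * n) = r at *
  obtain rfl : s = s₀ + r + 2 * n * m := by linarith
  by_cases hm : Even m
  · left; intro P hP
    simpa only [hP.anti_mul, hm, if_true] using H P hP _ (by omega) (by omega)
  · right; intro P hP
    have := H P hP (s₀ + r) (by omega) (by omega)
    simp only [hP.anti_mul, hm, if_false]
    omega

end IsModel

end PeriodicSignature

/-! ### A move is determined by the permutations before and after it. -/

namespace IsMove

variable {N : ℕ} {σ τ : Equiv.Perm (Fin N)} {S S' : Finset (Fin N × Fin N)}

lemma mem_Icc_iff (h : IsMove σ τ S) {s : Fin N × Fin N} (hs : s ∈ S) (p : Fin N) :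
    τ p ∈ Finset.Icc s.1 s.2 ↔ σ p ∈ Finset.Icc s.1 s.2 := by
  have key : ∀ s ∈ S, σ p ∈ Finset.Icc s.1 s.2 → τ p ∈ Finset.Icc s.1 s.2 := fun s hs hp => by
    have := h.reverse s hs p hp
    rw [Finset.mem_Icc, Fin.le_def, Fin.le_def] at *
    omega
  refine ⟨fun hp => ?_, key s hs⟩
  by_cases hq : ∃ s' ∈ S, σ p ∈ Finset.Icc s'.1 s'.2
  · obtain ⟨s', hs', hp'⟩ := hq
    by_cases he : s = s'
    · rwa [he]
    · exact absurd (key s' hs' hp') (Finset.disjoint_left.1 (h.disjoint s hs s' hs' he) hp)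
  · push Not at hq
    rwa [← h.fixed p hq]

/-- Two points participate together in a switch if and only if their order is reversed. -/
lemma together_iff (h : IsMove σ τ S) {p q : Fin N} (hpq : p ≠ q) :
    (∃ s ∈ S, σ p ∈ Finset.Icc s.1 s.2 ∧ σ q ∈ Finset.Icc s.1 s.2) ↔ (σ p < σ q ↔ τ q < τ p) := by
  have hσ : (σ p : ℕ) ≠ σ q := fun e => hpq (σ.injective (Fin.ext e))
  have hτ : (τ p : ℕ) ≠ τ q := fun e => hpq (τ.injective (Fin.ext e))
  constructor
  · rintro ⟨s, hs, h1, h2⟩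
    have h3 := h.reverse s hs p h1
    have h4 := h.reverse s hs q h2
    rw [Fin.lt_def, Fin.lt_def]; omega
  · intro hr
    by_contra hn
    push Not at hn
    by_cases hp : ∃ s ∈ S, σ p ∈ Finset.Icc s.1 s.2
    · obtain ⟨s, hs, hp⟩ := hp
      have hq := hn s hs hp
      have hp' := (h.mem_Icc_iff hs p).2 hp
      have hq' := (h.mem_Icc_iff hs q).not.2 hq
      by_cases hq2 : ∃ s ∈ S, σ q ∈ Finset.Icc s.1 s.2
      · obtain ⟨s', hs', hq2⟩ := hq2
        have hq2' := (h.mem_Icc_iff hs' q).2 hq2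
        have hl := h.lt s' hs'
        have hd := h.disjoint s hs s' hs' (by rintro rfl; exact hq hq2)
        have d := Finset.disjoint_left.1 hd
        have d1 := @d s'.1
        have d2 := @d s.1
        simp only [Finset.mem_Icc, Fin.le_def, Fin.lt_def] at *
        omega
      · push Not at hq2
        have := h.fixed q hq2
        rw [this] at hr hq'
        simp only [Finset.mem_Icc, Fin.le_def, Fin.lt_def] at *
        omega
    · push Not at hp
      have hp0 := h.fixed p hp
      rw [hp0] at hr hτ
      by_cases hq2 : ∃ s ∈ S, σ q ∈ Finset.Icc s.1 s.2
      · obtain ⟨s', hs', hq2⟩ := hq2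
        have hq2' := (h.mem_Icc_iff hs' q).2 hq2
        have hp' := hp s' hs'
        simp only [Finset.mem_Icc, Fin.le_def, Fin.lt_def] at *
        omega
      · push Not at hq2
        rw [h.fixed q hq2] at hr
        simp only [Fin.lt_def] at *
        omega

/-- The displacement of the point at the left end of a switch determines the centre of any switch
containing it. A switch of `S'` reaching further left would move its own left end, which must then
lie in another switch of `S` with the same centre; disjoint intervals cannot share a centre. -/
lemma subset (h : IsMove σ τ S) (h' : IsMove σ τ S') : S ⊆ S' := by
  intro s hs
  have hlt := h.lt s hs
  have e1 : σ (σ.symm s.1) = s.1 := σ.apply_symm_apply _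
  have r1 := h.reverse s hs (σ.symm s.1) (by rw [e1, Finset.mem_Icc]; exact ⟨le_rfl, hlt.le⟩)
  by_cases hm : ∃ s' ∈ S', σ (σ.symm s.1) ∈ Finset.Icc s'.1 s'.2
  · obtain ⟨s', hs', hm⟩ := hm
    have r2 := h'.reverse s' hs' _ hm
    rw [e1] at hm r1 r2
    suffices s'.1 = s.1 by
      have : s = s' := Prod.ext this.symm (Fin.ext (by rw [this] at r2; omega))
      rwa [this]
    by_contra hne
    have hlt' := h'.lt s' hs'
    have e2 : σ (σ.symm s'.1) = s'.1 := σ.apply_symm_apply _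
    have r3 := h'.reverse s' hs' (σ.symm s'.1)
      (by rw [e2, Finset.mem_Icc]; exact ⟨le_rfl, hlt'.le⟩)
    by_cases hk : ∃ r ∈ S, σ (σ.symm s'.1) ∈ Finset.Icc r.1 r.2
    · obtain ⟨r, hr, hk⟩ := hk
      have r4 := h.reverse r hr _ hk
      rw [e2] at hk r3 r4
      have hltr := h.lt r hr
      have hc : s ≠ r := by
        rintro rfl
        simp only [Finset.mem_Icc, Fin.le_def, Fin.lt_def, Fin.ext_iff] at *
        omega
      have hd := h.disjoint s hs r hr hc
      have d := Finset.disjoint_left.1 hd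
      have d1 := @d r.1
      have d2 := @d s.1
      simp only [Finset.mem_Icc, Fin.le_def, Fin.lt_def, Fin.ext_iff] at *
      omega
    · push Not at hk
      have := h.fixed _ hk
      rw [this, e2] at r3
      simp only [Fin.lt_def] at *
      omega
  · push Not at hm
    have := h'.fixed _ hm
    rw [this, e1] at r1
    simp only [Fin.lt_def] at *
    omega

lemma unique (h : IsMove σ τ S) (h' : IsMove σ τ S') : S = S' :=
  (h.subset h').antisymm (h'.subset h)

end IsMove

lemma Equiv.Perm.eq_of_lt_imp_lt {N : ℕ} {σ τ : Equiv.Perm (Fin N)}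
    (h : ∀ p q, σ p < σ q → τ p < τ q) : σ = τ := by
  have hm : StrictMono (τ ∘ σ.symm) := fun x y hxy => by
    apply h; simpa using hxy
  have : τ ∘ σ.symm = id := by
    have := hm.range_inj (f := τ ∘ σ.symm) (g := id) (strictMono_id) |>.1
      (by simp [Set.range_comp])
    exact this
  ext p
  have := congrFun this (σ p)
  simp at this
  rw [this]

/-! ### Labelled sequences, and uniqueness for a given signature. -/

namespace AllowableSequence

variable {n t : ℕ}

/-- A labelling of the points of `A` by classes for which `A` is modelled by the signature `G`. -/
structure IsLabelling (A : AllowableSequence (2 * n)) (G : PeriodicSignature t n)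
    (κ : ℤ → ℕ → Fin (2 * n)) : Prop where
  isModel : G.IsModel fun s a i => (A.perm s (κ a i) : ℕ)
  surj : ∀ p, ∃ a i, i < G.size a ∧ κ a i = p
  halfperiod : A.halfperiod = 2 * n
  perm_zero : A.perm 0 = 1

namespace IsLabelling

variable {A A' : AllowableSequence (2 * n)} {G : PeriodicSignature t n}
  {κ κ' : ℤ → ℕ → Fin (2 * n)}

lemma perm_add (h : A.IsLabelling G κ) (s : ℤ) (p : Fin (2 * n)) :
    A.perm (s + 2 * n) p = (A.perm s p).rev := by
  rw [← A.perm_add_halfperiod, h.halfperiod]; push_cast; rfl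

lemma perm_rev (h : A.IsLabelling G κ) (a : ℤ) (i : ℕ) :
    κ (a + t) i = (κ a i).rev := by
  have := h.isModel.conj 0 a i
  rw [h.perm_zero] at this
  simp only [Equiv.Perm.one_apply] at this
  ext; rw [Fin.val_rev]; omega

lemma injective (h : A.IsLabelling G κ) (ht : 0 < t) {a b : ℤ} {i j : ℕ} (hi : i < G.size a)
    (hj : j < G.size b) (he : κ a i = κ b j) : i = j ∧ (2 * t : ℤ) ∣ b - a := by
  by_contra hn
  obtain ⟨s₀, H⟩ := PeriodicSignature.IsModel.exists_lt ht hi hj hn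
  have := H _ h.isModel s₀ le_rfl (by have := (κ a i).2; omega)
  rw [he] at this
  exact lt_irrefl _ this

lemma lt_imp_lt (h : A.IsLabelling G κ) (h' : A'.IsLabelling G κ') (ht : 0 < t) (s : ℤ)
    {a b : ℤ} {i j : ℕ} (hi : i < G.size a) (hj : j < G.size b)
    (hlt : A.perm s (κ a i) < A.perm s (κ b j)) : A'.perm s (κ' a i) < A'.perm s (κ' b j) := by
  have hne : ¬ (i = j ∧ (2 * t : ℤ) ∣ b - a) := by
    rintro ⟨rfl, m, hm⟩
    obtain rfl : b = a + 2 * t * m := by linarith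
    have := h.isModel.periodic s a m i
    rw [Fin.lt_def] at hlt
    omega
  rcases PeriodicSignature.IsModel.forall_lt_or_forall_gt ht hi hj hne s with H | H
  · have := H _ h'.isModel
    rw [Fin.lt_def]; omega
  · have := H _ h.isModel
    rw [Fin.lt_def] at hlt; omega

/-- The central signature determines the sequence. -/
theorem eq (h : A.IsLabelling G κ) (h' : A'.IsLabelling G κ') (ht : 0 < t) : A = A' := by
  have hlab : ∀ a b i j, i < G.size a → j < G.size b → κ a i = κ b j → κ' a i = κ' b j := by
    intro a b i j hi hj he
    obtain ⟨rfl, m, hm⟩ := h.injective ht hi hj he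
    obtain rfl : b = a + 2 * t * m := by linarith
    have := h'.isModel.periodic 0 a m i
    rw [h'.perm_zero] at this
    simp only [Equiv.Perm.one_apply] at this
    ext; omega
  choose ca ci hc hκ using h.surj
  have hmono : StrictMono fun p => κ' (ca p) (ci p) := fun p q hpq => by
    have := h.lt_imp_lt h' ht 0 (hc p) (hc q) (by rw [hκ, hκ, h.perm_zero]; exact hpq)
    rwa [h'.perm_zero] at this
  -- Passing from the labels of one sequence to those of the other preserves the order in `π₀ = id`,
  -- and a strictly increasing self-map of `Fin (2 * n)` is the identity.
  have hid : ∀ p, κ' (ca p) (ci p) = p := by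
    have hb := (Finite.injective_iff_surjective.1 hmono.injective)
    have := (hmono.range_inj (g := id) strictMono_id).1 (by rw [hb.range_eq, Set.range_id])
    exact fun p => congrFun this p
  have hperm : A.perm = A'.perm := by
    funext s
    apply Equiv.Perm.eq_of_lt_imp_lt
    intro p q hpq
    have := h.lt_imp_lt h' ht s (hc p) (hc q) (by rwa [hκ, hκ])
    rwa [hid, hid] at this
  refine AllowableSequence.ext hperm ?_ (h.halfperiod.trans h'.halfperiod.symm)
  funext i
  have h1 := A.isMove i
  rw [hperm] at h1
  exact h1.unique (A'.isMove i)

end IsLabelling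

end AllowableSequence

/-! ### Passings: the times at which two points exchange their order. -/

namespace AllowableSequence

section Passes

variable {N : ℕ} (A : AllowableSequence N)

/-- In the `s`-th move the point `p` passes from the right of `q` to the left of `q`. -/
def Passes (s : ℤ) (p q : Fin N) : Prop :=
  A.perm (s - 1) q < A.perm (s - 1) p ∧ A.perm s p < A.perm s q

variable {A}

lemma Passes.ne {s : ℤ} {p q : Fin N} (h : A.Passes s p q) : p ≠ q := by
  rintro rfl; exact lt_irrefl _ h.1

lemma perm_lt_add {p q : Fin N} (s : ℤ) :
    A.perm (s + A.halfperiod) p < A.perm (s + A.halfperiod) q ↔ A.perm s q < A.perm s p := by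
  rw [A.perm_add_halfperiod, A.perm_add_halfperiod, Fin.rev_lt_rev]

lemma passes_add {s : ℤ} {p q : Fin N} :
    A.Passes (s + A.halfperiod) p q ↔ A.Passes s q p := by
  simp only [Passes, perm_lt_add, show s + (A.halfperiod : ℤ) - 1 = s - 1 + A.halfperiod by ring]

lemma together_iff_passes {s : ℤ} {p q : Fin N} (hpq : p ≠ q) :
    (∃ x ∈ A.switches s, A.perm (s - 1) p ∈ Finset.Icc x.1 x.2 ∧
      A.perm (s - 1) q ∈ Finset.Icc x.1 x.2) ↔ A.Passes s p q ∨ A.Passes s q p := by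
  rw [(A.isMove s).together_iff hpq]
  have h1 : A.perm (s - 1) p ≠ A.perm (s - 1) q := fun h => hpq ((A.perm _).injective h)
  have h2 : A.perm s p ≠ A.perm s q := fun h => hpq ((A.perm _).injective h)
  simp only [Passes]
  rcases lt_or_gt_of_ne h1 with h1 | h1 <;> rcases lt_or_gt_of_ne h2 with h2 | h2 <;>
    simp [h1, h2, h1.not_gt, h2.not_gt]

lemma lt_or_gt_perm (s : ℤ) {p q : Fin N} (hpq : p ≠ q) :
    A.perm s p < A.perm s q ∨ A.perm s q < A.perm s p :=
  lt_or_gt_of_ne fun h => hpq ((A.perm _).injective h)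

lemma existsUnique_passes {p q : Fin N} (hpq : p ≠ q) :
    ∃! s : ℤ, 1 ≤ s ∧ s ≤ A.halfperiod ∧ (A.Passes s p q ∨ A.Passes s q p) := by
  have := A.existsUnique_switch p q hpq
  simpa only [together_iff_passes hpq] using this

lemma passes_or_add_mul {s m : ℤ} {p q : Fin N} :
    (A.Passes (s + A.halfperiod * m) p q ∨ A.Passes (s + A.halfperiod * m) q p) ↔
      (A.Passes s p q ∨ A.Passes s q p) := by
  induction m using Int.induction_on with
  | zero => simp
  | succ k ih =>
    rw [show s + A.halfperiod * ((k : ℤ) + 1) = s + A.halfperiod * k + A.halfperiod by ring,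
      passes_add, passes_add, or_comm, ih]
  | pred k ih =>
    rw [← ih, show s + A.halfperiod * -(k : ℤ) =
      s + A.halfperiod * (-(k : ℤ) - 1) + A.halfperiod by ring, passes_add, passes_add, or_comm]

lemma exists_mem_window (s : ℤ) : ∃ m : ℤ, 1 ≤ s + A.halfperiod * m ∧
    s + A.halfperiod * m ≤ A.halfperiod := by
  have hp := A.halfperiod_pos
  have h1 := Int.emod_nonneg (s - 1) (show (A.halfperiod : ℤ) ≠ 0 by omega)
  have h2 := Int.emod_lt_of_pos (s - 1) (show (0 : ℤ) < A.halfperiod by omega)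
  have h3 := Int.emod_add_mul_ediv (s - 1) A.halfperiod
  exact ⟨-((s - 1) / A.halfperiod), by linarith, by linarith⟩

/-- Both times can be shifted by halfperiods into the first halfperiod, where the pair meets only
once. -/
lemma dvd_of_passes_or {s s' : ℤ} {p q : Fin N} (h : A.Passes s p q ∨ A.Passes s q p)
    (h' : A.Passes s' p q ∨ A.Passes s' q p) : (A.halfperiod : ℤ) ∣ s - s' := by
  have hpq : p ≠ q := h.elim (fun h => h.ne) fun h => h.ne.symm
  obtain ⟨m, hm⟩ := A.exists_mem_window s
  obtain ⟨m', hm'⟩ := A.exists_mem_window s'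
  have := (existsUnique_passes hpq).unique ⟨hm.1, hm.2, passes_or_add_mul.2 h⟩
    ⟨hm'.1, hm'.2, passes_or_add_mul.2 h'⟩
  exact ⟨m' - m, by linarith⟩

/-- Undoing the order would be a second passing of the same pair less than one halfperiod after the
first. -/
lemma Passes.lt {s s' : ℤ} {p q : Fin N} (h : A.Passes s p q) (h1 : s ≤ s')
    (h2 : s' < s + A.halfperiod) : A.perm s' p < A.perm s' q := by
  obtain ⟨k, rfl⟩ := Int.le.dest h1
  induction k with
  | zero => simpa using h.2
  | succ k ih =>
    have ih := ih (by omega) (by push_cast at h2 ⊢; omega)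
    refine (lt_or_gt_perm _ h.ne).resolve_right fun hgt => ?_
    have hp : A.Passes (s + (k + 1 : ℕ)) q p := by
      refine ⟨?_, hgt⟩
      rwa [show s + ((k + 1 : ℕ) : ℤ) - 1 = s + k by push_cast; ring]
    obtain ⟨m, hm⟩ := dvd_of_passes_or (Or.inr hp) (Or.inl h)
    have hpos := A.halfperiod_pos
    have hm0 : 0 < m := by
      by_contra hle
      have := mul_nonneg (show (0 : ℤ) ≤ A.halfperiod by omega) (show 0 ≤ -m by omega)
      push_cast at hm
      linarith
    have := mul_nonneg (show (0 : ℤ) ≤ A.halfperiod by omega) (show 0 ≤ m - 1 by omega)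
    push_cast at hm h2
    linarith

lemma Passes.gt {s s' : ℤ} {p q : Fin N} (h : A.Passes s p q) (h1 : s' < s)
    (h2 : s ≤ s' + A.halfperiod) : A.perm s' q < A.perm s' p :=
  (perm_lt_add s').1 (h.lt h2 (by omega))

lemma exists_passes_between {s₁ s₂ : ℤ} {p q : Fin N} (h : s₁ ≤ s₂)
    (h1 : A.perm s₁ q < A.perm s₁ p) (h2 : A.perm s₂ p < A.perm s₂ q) :
    ∃ s, s₁ < s ∧ s ≤ s₂ ∧ A.Passes s p q := by
  have hpq : p ≠ q := by rintro rfl; exact lt_irrefl _ h1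
  obtain ⟨k, rfl⟩ := Int.le.dest h
  induction k with
  | zero => simp only [Nat.cast_zero, add_zero] at h2; exact absurd h2 h1.not_gt
  | succ k ih =>
    rcases lt_or_gt_perm (s₁ + k) hpq with hk | hk
    · obtain ⟨s, h3, h4, h5⟩ := ih (by omega) hk
      exact ⟨s, h3, by push_cast; omega, h5⟩
    · exact ⟨_, by push_cast; omega, le_rfl, by
        rwa [show s₁ + ((k + 1 : ℕ) : ℤ) - 1 = s₁ + k by push_cast; ring], h2⟩

lemma exists_passes {p q : Fin N} (hpq : p ≠ q) : ∃ s, A.Passes s p q := by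
  rcases lt_or_gt_perm 0 hpq with h | h
  · obtain ⟨s, -, -, hs⟩ := exists_passes_between (A := A) (s₁ := 0 + A.halfperiod)
      (s₂ := 0 + A.halfperiod + A.halfperiod) (by omega) ((perm_lt_add 0).2 h)
      ((perm_lt_add _).2 ((perm_lt_add 0).2 h))
    exact ⟨s, hs⟩
  · obtain ⟨s, -, -, hs⟩ := exists_passes_between (A := A) (s₁ := 0)
      (s₂ := 0 + A.halfperiod) (by omega) h ((perm_lt_add _).2 h)
    exact ⟨s, hs⟩

end Passes

section NearCritical

variable {n t : ℕ} {A : AllowableSequence (2 * n)}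

lemma IsCentrallySymmetric.perm_rev (h : A.IsCentrallySymmetric) (h0 : A.perm 0 = 1) (s : ℤ)
    (p : Fin (2 * n)) : A.perm s p.rev = (A.perm s p).rev := by
  obtain ⟨q, hq⟩ := h p
  have := hq 0
  simp only [h0, Equiv.Perm.one_apply] at this
  rw [← this, hq]

/-- A point that passes two points in the same move is reversed by a crossing switch. -/
lemma passes_rev_of_passes_of_passes (h : A.IsCentrallySymmetric) (h0 : A.perm 0 = 1)
    (hg : A.InNoncentralGeneralPosition) {s : ℤ} {p q r : Fin (2 * n)} (hqr : q ≠ r)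
    (hq : A.Passes s p q ∨ A.Passes s q p) (hr : A.Passes s p r ∨ A.Passes s r p) :
    A.Passes s p p.rev ∨ A.Passes s p.rev p := by
  have hpq : p ≠ q := hq.elim (fun h => h.ne) fun h => h.ne.symm
  have hpr : p ≠ r := hr.elim (fun h => h.ne) fun h => h.ne.symm
  obtain ⟨x, hx, hx1, hx2⟩ := (together_iff_passes hpq).2 hq
  obtain ⟨y, hy, hy1, hy2⟩ := (together_iff_passes hpr).2 hr
  obtain rfl : x = y := by
    by_contra hne
    exact Finset.disjoint_left.1 ((A.isMove s).disjoint x hx y hy hne) hx1 hy1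
  have e1 : (A.perm (s - 1) p : ℕ) ≠ A.perm (s - 1) q := fun e =>
    hpq ((A.perm _).injective (Fin.ext e))
  have e2 : (A.perm (s - 1) p : ℕ) ≠ A.perm (s - 1) r := fun e =>
    hpr ((A.perm _).injective (Fin.ext e))
  have e3 : (A.perm (s - 1) q : ℕ) ≠ A.perm (s - 1) r := fun e =>
    hqr ((A.perm _).injective (Fin.ext e))
  by_cases hc : IsCrossing x
  · rw [← together_iff_passes (by intro e; have := congrArg Fin.val e; rw [Fin.val_rev] at this; omega)]
    refine ⟨x, hx, hx1, ?_⟩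
    have hc' := congrArg Fin.val hc
    rw [Fin.val_rev] at hc'
    rw [h.perm_rev h0, Finset.mem_Icc, Fin.le_def, Fin.le_def, Fin.val_rev] at *
    have := (A.perm (s-1) p).2
    omega
  -- A noncrossing switch has only two positions, but here it would hold `p`, `q` and `r`.
  · have := hg s x hx hc
    simp only [Finset.mem_Icc, Fin.le_def] at *
    omega

end NearCritical

end AllowableSequence

/-! ### The periodic signature of a finite tuple. -/

namespace PeriodicSignature

variable {t : ℕ}

lemma exists_eq_add_mul (ht : 0 < t) (a : ℤ) : ∃ (r : Fin t) (q : ℤ), a = r + t * q := by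
  have h1 := Int.emod_nonneg a (show (t : ℤ) ≠ 0 by omega)
  have h2 := Int.emod_lt_of_pos a (show (0 : ℤ) < t by omega)
  refine ⟨⟨(a % t).toNat, by omega⟩, a / t, ?_⟩
  have := Int.emod_add_mul_ediv a t
  simp only [Int.toNat_of_nonneg h1]
  linarith

/-- The sum of the first `k` values of `d`. -/
def partialSum (d : Fin t → ℕ) (k : ℕ) : ℕ :=
  ∑ j ∈ Finset.range k, if h : j < t then d ⟨j, h⟩ else 0

lemma partialSum_succ (d : Fin t → ℕ) (k : Fin t) :
    partialSum d (k + 1) = partialSum d k + d k := by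
  simp [partialSum, Finset.sum_range_succ]

lemma partialSum_top (d : Fin t → ℕ) : partialSum d t = ∑ j, d j := by
  rw [partialSum, ← Fin.sum_univ_eq_sum_range (fun j => if h : j < t then d ⟨j, h⟩ else 0)]
  simp

/-- The periodic signature with period `d`. -/
def ofFin (d : Fin t → ℕ) (ht : 0 < t) (hd : ∀ i, 0 < d i) (n : ℕ) (hn : ∑ j, d j = n) :
    PeriodicSignature t n where
  size a := d ⟨(a % t).toNat, by
    have := Int.emod_lt_of_pos a (show (0 : ℤ) < t by omega); omega⟩
  offset a := n * (a / t) + partialSum d (a % t).toNat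
  size_pos a := hd _
  offset_succ a := by
    obtain ⟨r, q, rfl⟩ := exists_eq_add_mul ht a
    have hr := r.2
    have e1 : ((r : ℤ) + t * q) % t = r := by
      rw [Int.add_mul_emod_self_left]; exact Int.emod_eq_of_lt (by omega) (by omega)
    have e2 : ((r : ℤ) + t * q) / t = q := by
      rw [Int.add_mul_ediv_left _ _ (by omega), Int.ediv_eq_zero_of_lt (by omega) (by omega)]
      ring
    simp only [e1, e2, Int.toNat_natCast]
    have hs := partialSum_succ d r
    rcases Nat.lt_or_ge (r + 1) t with h | h
    · have e3 : ((r : ℤ) + t * q + 1) % t = (r + 1 : ℕ) := by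
        rw [show (r : ℤ) + t * q + 1 = (r + 1 : ℕ) + t * q by push_cast; ring,
          Int.add_mul_emod_self_left]
        exact Int.emod_eq_of_lt (by omega) (by omega)
      have e4 : ((r : ℤ) + t * q + 1) / t = q := by
        rw [show (r : ℤ) + t * q + 1 = (r + 1 : ℕ) + t * q by push_cast; ring,
          Int.add_mul_ediv_left _ _ (by omega), Int.ediv_eq_zero_of_lt (by omega) (by omega)]
        ring
      simp only [e3, e4, Int.toNat_natCast, hs]
      push_cast; ring
    · have e0 : (r : ℕ) + 1 = t := by omega
      have e5 : (r : ℤ) + t * q + 1 = t * (q + 1) := by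
        have : (t : ℤ) = r + 1 := by omega
        linarith
      have e3 : ((r : ℤ) + t * q + 1) % t = 0 := by
        rw [e5]; exact Int.mul_emod_right _ _
      have e4 : ((r : ℤ) + t * q + 1) / t = q + 1 := by
        rw [e5]; exact Int.mul_ediv_cancel_left _ (by omega)
      rw [e0, partialSum_top, hn] at hs
      simp only [e3, e4]
      rw [hs]
      simp [partialSum]; ring
  offset_add a := by
    rw [Int.add_emod_right, Int.add_ediv_of_dvd_right (dvd_refl _), Int.ediv_self (by omega)]
    ring
  offset_zero := by simp [partialSum]

lemma ofFin_size (d : Fin t → ℕ) (ht : 0 < t) (hd : ∀ i, 0 < d i) (n : ℕ) (hn : ∑ j, d j = n)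
    (r : Fin t) : (ofFin d ht hd n hn).size r = d r := by
  have := r.2
  simp only [ofFin]
  congr 1
  ext
  simp only
  rw [Int.emod_eq_of_lt (by omega) (by omega), Int.toNat_natCast]

end PeriodicSignature

/-! ### The crossing moves of a given sequence. -/

namespace AllowableSequence

section NearCritical

variable {n t : ℕ} {A : AllowableSequence (2 * n)} {d : Fin t → ℕ}

lemma IsDC.perm_rev (h : A.IsDC d) (s : ℤ) (p : Fin (2 * n)) :
    A.perm s p.rev = (A.perm s p).rev :=
  h.centrallySymmetric.perm_rev h.perm_zero s p

lemma IsDC.halfperiod_eq (h : A.IsDC d) : (A.halfperiod : ℤ) = 2 * n := by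
  rw [h.evenNearCritical]; push_cast; rfl

lemma IsDC.perm_add (h : A.IsDC d) (s : ℤ) (p : Fin (2 * n)) :
    A.perm (s + 2 * n) p = (A.perm s p).rev := by
  rw [← A.perm_add_halfperiod, h.halfperiod_eq]

lemma IsDC.perm_add_mul (h : A.IsDC d) (s m : ℤ) (p : Fin (2 * n)) :
    A.perm (s + 2 * n * m) p = A.perm s p ∧ Even m ∨
      A.perm (s + 2 * n * m) p = (A.perm s p).rev ∧ ¬ Even m := by
  induction m using Int.induction_on with
  | zero => simp
  | succ k ih =>
    rw [show s + 2 * n * ((k : ℤ) + 1) = s + 2 * n * k + 2 * n by ring, h.perm_add,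
      Int.even_add_one]
    rcases ih with ⟨ih, h2⟩ | ⟨ih, h2⟩ <;> simp only [ih, h2, Fin.rev_rev] <;> simp
  | pred k ih =>
    have := h.perm_add (s + 2 * n * (-(k : ℤ) - 1)) p
    rw [show s + 2 * n * (-(k : ℤ) - 1) + 2 * n = s + 2 * n * -k by ring] at this
    rw [this] at ih
    rw [Int.even_sub_one]
    rcases ih with ⟨ih, h2⟩ | ⟨ih, h2⟩
    · right; rw [← ih, Fin.rev_rev]; simpa using h2
    · left; rw [← Fin.rev_inj, ih]; simpa using h2

/-- The position `x` belongs to the centered block of `2 * k` positions. -/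
def InCentralBlock (n k x : ℕ) : Prop := n ≤ x + k ∧ x < n + k

lemma ne_rev (p : Fin (2 * n)) : p ≠ p.rev := by
  intro e
  have := congrArg Fin.val e
  rw [Fin.val_rev] at this; omega

/-- Two crossing switches of one move would both contain the central positions, contradicting
disjointness; so the size given by the signature is that of every crossing switch of the move. -/
lemma crossing_eq {T : Fin t → ℤ}
    (hd : ∀ j, ∃ s ∈ A.switches (T j), IsCrossing s ∧ (s.2 : ℕ) + 1 = s.1 + 2 * d j) (j : Fin t)
    {s : Fin (2 * n) × Fin (2 * n)} (hs : s ∈ A.switches (T j)) (hc : IsCrossing s) :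
    (s.1 : ℕ) + d j = n ∧ (s.2 : ℕ) + 1 = n + d j := by
  obtain ⟨s', hs', hc', he⟩ := hd j
  obtain rfl : s = s' := by
    by_contra hne
    have hdis := Finset.disjoint_left.1 ((A.isMove _).disjoint s hs s' hs' hne)
    have h1 := congrArg Fin.val hc
    have h2 := congrArg Fin.val hc'
    have l1 := (A.isMove _).lt s hs
    have l2 := (A.isMove _).lt s' hs'
    have d1 := @hdis s.1
    have d2 := @hdis s'.1
    rw [Fin.val_rev] at h1 h2
    simp only [Finset.mem_Icc, Fin.le_def, Fin.lt_def] at *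
    omega
  have h1 := congrArg Fin.val hc
  rw [Fin.val_rev] at h1
  omega

/-- `T` extends the crossing moves of the first halfperiod by `T (r + t * q) = m r + 2 * n * q`, and
central blocks carry over because a halfperiod reverses all positions. The sum `S` of the sizes is
kept separate from `n`, since their equality is proved only later, from the resulting crossing data.
-/
lemma IsDC.exists_crossTime (h : A.IsDC d) (ht : 0 < t) {S : ℕ} (G : PeriodicSignature t S)
    (hG : ∀ r : Fin t, G.size r = d r) :
    ∃ T : ℤ → ℤ, StrictMono T ∧ T 0 = 1 ∧ (∀ a, T (a + t) = T a + 2 * n) ∧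
      (∀ a, G.size a ≤ n) ∧
      (∀ a p, InCentralBlock n (G.size a) (A.perm (T a - 1) p) →
        (A.perm (T a) p : ℕ) + A.perm (T a - 1) p + 1 = 2 * n) ∧
      (∀ a p, InCentralBlock n (G.size a) (A.perm (T a) p) →
        InCentralBlock n (G.size a) (A.perm (T a - 1) p)) ∧
      ∀ s p, A.Passes s p p.rev → ∃ a, s = T a ∧ InCentralBlock n (G.size a) (A.perm s p) := by
  obtain ⟨m, hm, hr, hd⟩ := h.centralSignature
  have hsz : ∀ (r : Fin t) (q : ℤ), G.size (r + t * q) = d r := fun r q => by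
    rw [G.size_add_mul, hG]
  have hmem : ∀ r, 1 ≤ m r ∧ m r ≤ 2 * n := fun r => by
    have : m r ∈ Set.range m := ⟨r, rfl⟩
    rw [hr] at this
    exact ⟨this.1, by rw [← h.halfperiod_eq]; exact this.2.1⟩
  have hblock : ∀ (r : Fin t) (p : Fin (2 * n)),
      (InCentralBlock n (d r) (A.perm (m r - 1) p) →
        (A.perm (m r) p : ℕ) + A.perm (m r - 1) p + 1 = 2 * n) ∧
      (InCentralBlock n (d r) (A.perm (m r) p) →
        InCentralBlock n (d r) (A.perm (m r - 1) p)) ∧ d r ≤ n := by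
    intro r p
    obtain ⟨s, hs, hc, -⟩ := hd r
    obtain ⟨e1, e2⟩ := crossing_eq hd r hs hc
    have h1 := (A.isMove _).mem_Icc_iff hs p
    have h2 := (A.isMove _).reverse s hs p
    simp only [Finset.mem_Icc, Fin.le_def, InCentralBlock] at *
    refine ⟨fun h => ?_, fun h => ?_, by omega⟩
    · have := h2 (by omega); omega
    · have := h1.1 (by omega); omega
  choose rr qq hrq using PeriodicSignature.exists_eq_add_mul ht
  have huniq : ∀ (r : Fin t) (q : ℤ), rr (r + t * q) = r ∧ qq (r + t * q) = q := by
    intro r q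
    have e := hrq (r + t * q)
    have h1 := (rr (r + t * q)).2
    have h2 := r.2
    have hq : qq (r + t * q) = q := by
      rcases lt_trichotomy (qq (r + t * q)) q with hlt | he | hlt
      · have := mul_le_mul_of_nonneg_left (show qq (r + t * q) + 1 ≤ q by omega)
          (show (0 : ℤ) ≤ t by omega)
        rw [mul_add] at this
        omega
      · exact he
      · have := mul_le_mul_of_nonneg_left (show q + 1 ≤ qq (r + t * q) by omega)
          (show (0 : ℤ) ≤ t by omega)
        rw [mul_add] at this
        omega
    exact ⟨by ext; rw [hq] at e; omega, hq⟩
  have hT : ∃ T : ℤ → ℤ, ∀ (r : Fin t) (q : ℤ), T (r + t * q) = m r + 2 * n * q :=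
    ⟨fun a => m (rr a) + 2 * n * qq a, fun r q => by simp only [huniq]⟩
  obtain ⟨T, hT⟩ := hT
  have hm0 : m ⟨0, ht⟩ = 1 := by
    have : (1 : ℤ) ∈ Set.range m := by
      rw [hr]
      exact ⟨le_rfl, by have := A.halfperiod_pos; omega, h.first_move⟩
    obtain ⟨r, hr1⟩ := this
    have := hm.monotone (show ⟨0, ht⟩ ≤ r from Nat.zero_le _)
    have := (hmem ⟨0, ht⟩).1
    omega
  refine ⟨T, strictMono_int_of_lt_succ fun a => ?_, ?_, fun a => ?_, fun a => ?_, fun a p => ?_,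
    fun a p => ?_, fun s p hs => ?_⟩
  · obtain ⟨r, q, rfl⟩ := PeriodicSignature.exists_eq_add_mul ht a
    rcases Nat.lt_or_ge (r + 1) t with hlt | hge
    · have := hT ⟨r + 1, hlt⟩ q
      rw [show (r : ℤ) + t * q + 1 = ((⟨r + 1, hlt⟩ : Fin t) : ℕ) + t * q by push_cast; ring,
        this, hT]
      have := hm (show r < ⟨r + 1, hlt⟩ from Fin.lt_def.2 (by simp))
      omega
    · have e0 : (r : ℕ) + 1 = t := by omega
      have := hT ⟨0, ht⟩ (q + 1)
      rw [show (r : ℤ) + t * q + 1 = ((⟨0, ht⟩ : Fin t) : ℕ) + t * (q + 1) by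
        rw [mul_add, mul_one]; simp only [← e0]; push_cast; ring, this, hT]
      have h1 := (hmem r).2
      have h2 := (hmem ⟨0, ht⟩).1
      rw [mul_add]
      omega
  · have := hT ⟨0, ht⟩ 0
    simpa [hm0] using this
  · obtain ⟨r, q, rfl⟩ := PeriodicSignature.exists_eq_add_mul ht a
    rw [show (r : ℤ) + t * q + t = r + t * (q + 1) by ring, hT, hT]; ring
  · obtain ⟨r, q, rfl⟩ := PeriodicSignature.exists_eq_add_mul ht a
    rw [hsz]
    have hn : 0 < 2 * n := by
      have := A.halfperiod_pos; rw [h.evenNearCritical] at this; exact this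
    exact (hblock r ⟨0, hn⟩).2.2
  · obtain ⟨r, q, rfl⟩ := PeriodicSignature.exists_eq_add_mul ht a
    rw [hsz, hT, show m r + 2 * n * q - 1 = m r - 1 + 2 * n * q by ring]
    obtain ⟨h1, h2, h3⟩ := hblock r p
    rcases h.perm_add_mul (m r) q p with ⟨e1, ev⟩ | ⟨e1, ev⟩ <;>
      rcases h.perm_add_mul (m r - 1) q p with ⟨e2, ev'⟩ | ⟨e2, ev'⟩
    · rw [e1, e2]; exact h1
    · exact absurd ev ev'
    · exact absurd ev' ev
    · rw [e1, e2]
      simp only [InCentralBlock, Fin.val_rev] at *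
      intro h4
      have := h1 (by omega)
      omega
  · obtain ⟨r, q, rfl⟩ := PeriodicSignature.exists_eq_add_mul ht a
    rw [hsz, hT, show m r + 2 * n * q - 1 = m r - 1 + 2 * n * q by ring]
    obtain ⟨h1, h2, h3⟩ := hblock r p
    rcases h.perm_add_mul (m r) q p with ⟨e1, ev⟩ | ⟨e1, ev⟩ <;>
      rcases h.perm_add_mul (m r - 1) q p with ⟨e2, ev'⟩ | ⟨e2, ev'⟩
    · rw [e1, e2]; exact h2
    · exact absurd ev ev'
    · exact absurd ev' ev
    · rw [e1, e2]
      simp only [InCentralBlock, Fin.val_rev] at *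
      intro h4
      have := h2 (by omega)
      omega
  · obtain ⟨k, hk1, hk2⟩ := A.exists_mem_window s
    have hsw := (A.together_iff_passes (ne_rev p)).2 ((passes_or_add_mul (m := k)).2 (Or.inl hs))
    obtain ⟨x, hx, hx1, hx2⟩ := hsw
    -- A transposition of a point with its conjugate acts on positions with sum `2 * n - 1`, so it
    -- is centered anyway.
    have hc : IsCrossing x := by
      by_contra hc
      have := h.noncentralGeneralPosition _ x hx hc
      apply hc
      rw [h.perm_rev] at hx2
      have hl := (A.isMove _).lt x hx
      rw [IsCrossing, Fin.ext_iff]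
      simp only [Finset.mem_Icc, Fin.le_def, Fin.val_rev] at *
      omega
    have : s + A.halfperiod * k ∈ Set.range m := by
      rw [hr]; exact ⟨hk1, hk2, x, hx, hc⟩
    obtain ⟨r, hr1⟩ := this
    rw [h.halfperiod_eq] at hr1
    refine ⟨r + t * (-k), by rw [hT, hr1]; ring, ?_⟩
    rw [hsz]
    rw [h.halfperiod_eq, ← hr1] at hx hx1
    obtain ⟨e1, e2⟩ := crossing_eq hd r hx hc
    rw [← (A.isMove _).mem_Icc_iff hx] at hx1
    rw [hr1] at hx1
    rcases h.perm_add_mul s k p with ⟨e3, -⟩ | ⟨e3, -⟩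
    · rw [e3] at hx1
      simp only [InCentralBlock, Finset.mem_Icc, Fin.le_def] at *
      omega
    · rw [e3] at hx1
      simp only [InCentralBlock, Finset.mem_Icc, Fin.le_def, Fin.val_rev] at *
      omega

end NearCritical

end AllowableSequence

/-! ### Classes of points and their passings between two crossings. -/

/-- A lower bound for a function on a grid that increases strictly in the first argument and
decreases strictly in the second one. -/
lemma grid_lower_bound {σ : ℕ → ℕ → ℤ} {M N : ℕ}
    (h1 : ∀ i i' j, i < i' → i' < M → j < N → σ i j < σ i' j)
    (h2 : ∀ i j j', j < j' → i < M → j' < N → σ i j' < σ i j) {i i' j j' : ℕ} (hi : i ≤ i')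
    (hj : j ≤ j') (hM : i' < M) (hN : j' < N) : σ i j' + (i' - i : ℤ) + (j' - j : ℤ) ≤ σ i' j := by
  have e1 : ∀ k, i + k < M → σ i j' + k ≤ σ (i + k) j' := fun k => by
    induction k with
    | zero => simp
    | succ k ih =>
      intro hk
      have := h1 (i + k) (i + (k + 1)) j' (by omega) hk hN
      have := ih (by omega)
      push_cast; omega
  have e2 : ∀ k, k ≤ j' → σ i' j' + k ≤ σ i' (j' - k) := fun k => by
    induction k with
    | zero => simp
    | succ k ih =>
      intro hk
      have := h2 i' (j' - (k + 1)) (j' - k) (by omega) hM (by omega)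
      have := ih (by omega)
      push_cast; omega
  have a1 := e1 (i' - i) (by omega)
  have a2 := e2 (j' - j) (by omega)
  rw [show i + (i' - i) = i' by omega] at a1
  rw [show j' - (j' - j) = j by omega] at a2
  omega

namespace AllowableSequence

variable {n t S : ℕ}

/-- The crossing switches of a sequence: in move `T a`, the points `κ a i` pass to the left half. -/
structure CrossData (A : AllowableSequence (2 * n)) (G : PeriodicSignature t S) (T : ℤ → ℤ)
    (κ : ℤ → ℕ → Fin (2 * n)) : Prop where
  halfperiod : (A.halfperiod : ℤ) = 2 * n
  perm_rev : ∀ s p, A.perm s p.rev = (A.perm s p).rev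
  perm_zero : A.perm 0 = 1
  strictMono : StrictMono T
  time_zero : T 0 = 1
  time_add : ∀ a, T (a + t) = T a + 2 * n
  conj : ∀ a i, κ (a + t) i = (κ a i).rev
  pos : ∀ a i, i < G.size a → (A.perm (T a) (κ a i) : ℕ) + G.size a = n + i
  pos_pred : ∀ a i, i < G.size a → (A.perm (T a - 1) (κ a i) : ℕ) + i + 1 = n + G.size a
  surj : ∀ p, ∃ a i, i < G.size a ∧ κ a i = p
  block : ∀ a p, InCentralBlock n (G.size a) (A.perm (T a) p) ∨
    InCentralBlock n (G.size a) (A.perm (T a - 1) p) →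
    A.Passes (T a) p p.rev ∨ A.Passes (T a) p.rev p
  single : ∀ s p q r, q ≠ r → A.Passes s p q ∨ A.Passes s q p → A.Passes s p r ∨ A.Passes s r p →
    A.Passes s p p.rev ∨ A.Passes s p.rev p

/-- Class `a` consists of the points on the left half of the crossing block just after move `T a`,
listed from left to right. Every point passes its conjugate at some time and then belongs to the
class of that move. -/
theorem IsDC.exists_crossData {A : AllowableSequence (2 * n)} {d : Fin t → ℕ} (h : A.IsDC d)
    (ht : 0 < t) (G : PeriodicSignature t S) (hG : ∀ r : Fin t, G.size r = d r) :
    ∃ T κ, A.CrossData G T κ := by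
  obtain ⟨T, hT, hT0, hTt, hsize, hrev, hblock, hcross⟩ := h.exists_crossTime ht G hG
  have hn : 0 < 2 * n := by have := G.size_pos 0; have := hsize 0; omega
  -- The reduction modulo `2 * n` is only a default for out-of-range indices; it lets the
  -- conjugation rule hold for all `i`.
  let κ : ℤ → ℕ → Fin (2 * n) := fun a i =>
    (A.perm (T a)).symm ⟨(n - G.size a + i) % (2 * n), Nat.mod_lt _ hn⟩
  have hpos : ∀ a i, i < G.size a → (A.perm (T a) (κ a i) : ℕ) + G.size a = n + i := by
    intro a i hi
    have := hsize a
    simp only [κ, Equiv.apply_symm_apply]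
    rw [Nat.mod_eq_of_lt (by omega)]
    omega
  have hinb : ∀ a i, i < G.size a → InCentralBlock n (G.size a) (A.perm (T a) (κ a i)) :=
    fun a i hi => by have := hpos a i hi; have := hsize a; unfold InCentralBlock; omega
  refine ⟨T, κ, h.halfperiod_eq, h.perm_rev, h.perm_zero, hT, hT0, hTt, fun a i => ?_, hpos,
    fun a i hi => ?_, fun p => ?_, fun a p hp => ?_, fun s p q r hqr hq hr =>
      passes_rev_of_passes_of_passes h.centrallySymmetric h.perm_zero h.noncentralGeneralPosition
        hqr hq hr⟩
  · apply (A.perm (T (a + t))).injective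
    have e : A.perm (T a + 2 * n) (κ a i) = (A.perm (T a) (κ a i)).rev := h.perm_add _ _
    rw [h.perm_rev, hTt, e, Fin.rev_rev]
    simp only [κ, Equiv.apply_symm_apply, hTt, G.size_add]
  · have := hrev a _ (hblock a _ (hinb a i hi))
    have := hpos a i hi
    have := hsize a
    omega
  · obtain ⟨s, hs⟩ := exists_passes (A := A) (ne_rev p)
    obtain ⟨a, rfl, hb⟩ := hcross s p hs
    have hl := hs.2
    rw [h.perm_rev, Fin.lt_def, Fin.val_rev] at hl
    have := hsize a
    unfold InCentralBlock at hb
    refine ⟨a, A.perm (T a) p + G.size a - n, by omega, ?_⟩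
    apply (A.perm (T a)).injective
    simp only [κ, Equiv.apply_symm_apply]
    ext
    simp only
    rw [Nat.mod_eq_of_lt (by omega)]
    omega
  · have hb : InCentralBlock n (G.size a) (A.perm (T a - 1) p) := hp.elim (hblock a p) id
    have := hrev a p hb
    have l1 : (A.perm (T a) p : ℕ) ≠ A.perm (T a - 1) p := by omega
    simp only [Passes, h.perm_rev, Fin.lt_def, Fin.val_rev]
    omega

namespace CrossData

variable {A : AllowableSequence (2 * n)} {G : PeriodicSignature t S} {T : ℤ → ℤ}
  {κ : ℤ → ℕ → Fin (2 * n)}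

lemma conj_sub (h : A.CrossData G T κ) (a : ℤ) (i : ℕ) : κ (a - t) i = (κ a i).rev := by
  have := h.conj (a - t) i
  rw [sub_add_cancel] at this
  rw [this, Fin.rev_rev]

lemma time_sub (h : A.CrossData G T κ) (a : ℤ) : T (a - t) = T a - 2 * n := by
  have := h.time_add (a - t)
  rw [sub_add_cancel] at this
  omega

lemma passes_conj (h : A.CrossData G T κ) {a : ℤ} {i : ℕ} (hi : i < G.size a) :
    A.Passes (T a) (κ a i) (κ a i).rev := by
  have h1 := h.pos a i hi
  have h2 := h.pos_pred a i hi
  have h3 := (A.perm (T a) (κ a i)).2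
  simp only [Passes, h.perm_rev, Fin.lt_def, Fin.val_rev]
  omega

lemma passes_same (h : A.CrossData G T κ) {a : ℤ} {i j : ℕ} (hij : i < j) (hj : j < G.size a) :
    A.Passes (T a) (κ a i) (κ a j) := by
  have h1 := h.pos a i (hij.trans hj)
  have h2 := h.pos_pred a i (hij.trans hj)
  have h3 := h.pos a j hj
  have h4 := h.pos_pred a j hj
  simp only [Passes, Fin.lt_def]
  omega

lemma left (h : A.CrossData G T κ) {a s : ℤ} {i : ℕ} (hi : i < G.size a) (h1 : T a ≤ s)
    (h2 : s < T a + 2 * n) : (A.perm s (κ a i) : ℕ) < n := by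
  have := (h.passes_conj hi).lt h1 (by rwa [h.halfperiod])
  rw [h.perm_rev, Fin.lt_def, Fin.val_rev] at this
  omega

/-- Between two consecutive crossings a point does not meet its conjugate. -/
lemma not_passes_rev (h : A.CrossData G T κ) {a s : ℤ} {i : ℕ} (hi : i < G.size a)
    (h1 : T a < s) (h2 : s < T a + 2 * n) :
    ¬ (A.Passes s (κ a i) (κ a i).rev ∨ A.Passes s (κ a i).rev (κ a i)) := by
  intro hs
  obtain ⟨m, hm⟩ := dvd_of_passes_or hs (Or.inl (h.passes_conj hi))
  rw [h.halfperiod] at hm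
  have hn : (0 : ℤ) < 2 * n := by omega
  have e1 : 0 < m := by
    by_contra hle
    have := mul_nonneg hn.le (show 0 ≤ -m by omega)
    linarith
  have := mul_nonneg hn.le (show 0 ≤ m - 1 by omega)
  linarith

/-- Just after `T a`, class `a` fills the places next to the centre, so the point of class `b - t`,
also in the left half, is further left. Just before `T b`, class `b - t` fills the places next to
the centre and the order is opposite. -/
lemma exists_passes (h : A.CrossData G T κ) {a b : ℤ} (hab : a < b) (hba : b < a + t) {i j : ℕ}
    (hi : i < G.size a) (hj : j < G.size b) :
    ∃ s, T a < s ∧ s < T b ∧ A.Passes s (κ a i) (κ (b - t) j) := by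
  have hj' : j < G.size (b - t) := by rwa [G.size_sub]
  have hT1 := h.strictMono hab
  have hT2 := h.strictMono hba
  rw [h.time_add] at hT2
  have hTb := h.time_sub b
  have l1 := h.left hj' (s := T a) (by omega) (by omega)
  have l2 := h.left hi (s := T b - 1) (by omega) (by omega)
  have p1 := h.pos a i hi
  have p2 := h.pos_pred b j hj
  have r2 := congrArg Fin.val (h.perm_rev (T b - 1) (κ b j))
  rw [← h.conj_sub, Fin.val_rev] at r2
  have g1 : (A.perm (T a) (κ (b - t) j) : ℕ) + G.size a < n := by
    by_contra hge
    exact h.not_passes_rev hj' (by omega) (by omega)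
      (h.block a _ (Or.inl ⟨by omega, by omega⟩))
  have g2 : (A.perm (T b - 1) (κ a i) : ℕ) + G.size b < n := by
    by_contra hge
    exact h.not_passes_rev hi (by omega) (by omega)
      (h.block b _ (Or.inr ⟨by omega, by omega⟩))
  obtain ⟨s, e1, e2, e3⟩ := exists_passes_between (A := A) (s₁ := T a) (s₂ := T b - 1)
    (p := κ a i) (q := κ (b - t) j) (by omega) (by rw [Fin.lt_def]; omega)
    (by rw [Fin.lt_def]; omega)
  exact ⟨s, e1, by omega, e3⟩

lemma ne_of_lt (h : A.CrossData G T κ) {a b : ℤ} (hab : a < b) (hba : b < a + t) {i j : ℕ}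
    (hi : i < G.size a) (hj : j < G.size b) : κ a i ≠ κ b j := by
  intro e
  have h1 := h.strictMono hab
  have h2 := h.strictMono hba
  rw [h.time_add] at h2
  have := h.passes_conj hj
  rw [← e] at this
  exact h.not_passes_rev hi h1 h2 (Or.inl this)

/-- After their crossing, `κ a i` stays left of `κ a i'`, so it reaches the left of `q` no later.
Simultaneous passings would put `q` in a switch with three points, hence in a crossing one, and `hq`
excludes that. -/
lemma passes_lt_of_lt_left (h : A.CrossData G T κ) {a b s s' : ℤ} (hba : b < a + t) {i i' : ℕ}
    (hii : i < i') (hi' : i' < G.size a) {q : Fin (2 * n)} (h1 : T a < s) (h2 : s < T b)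
    (h1' : T a < s') (h2' : s' < T b)
    (hs : A.Passes s (κ a i) q) (hs' : A.Passes s' (κ a i') q)
    (hq : ∀ s, T a < s → s < T b → ¬ (A.Passes s q q.rev ∨ A.Passes s q.rev q)) : s < s' := by
  have hT := h.strictMono hba
  rw [h.time_add] at hT
  have hsame := h.passes_same hii hi'
  rcases lt_trichotomy s s' with hlt | heq | hlt
  · exact hlt
  · subst heq
    exact absurd (h.single s q _ _ hsame.ne (Or.inr hs) (Or.inr hs')) (hq s h1 h2)
  · have e1 := hsame.lt (s' := s - 1) (by omega) (by rw [h.halfperiod]; omega)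
    have e2 := hs'.lt (s' := s - 1) (by omega) (by rw [h.halfperiod]; omega)
    exact absurd hs.1 (e1.trans e2).not_gt

lemma passes_lt_of_lt_right (h : A.CrossData G T κ) {a b s s' : ℤ} (hba : b < a + t)
    {j j' : ℕ} (hjj : j < j') (hj' : j' < G.size b) {p : Fin (2 * n)} (h1 : T a < s)
    (h2 : s < T b) (h2' : s' < T b) (hs : A.Passes s p (κ (b - t) j))
    (hs' : A.Passes s' p (κ (b - t) j'))
    (hp : ∀ s, T a < s → s < T b → ¬ (A.Passes s p p.rev ∨ A.Passes s p.rev p)) : s' < s := by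
  have hT := h.strictMono hba
  rw [h.time_add] at hT
  have hTb := h.time_sub b
  have hsame := h.passes_same hjj (a := b - t) (by rwa [G.size_sub])
  rcases lt_trichotomy s' s with hlt | heq | hlt
  · exact hlt
  · subst heq
    exact absurd (h.single s' p _ _ hsame.ne (Or.inl hs) (Or.inl hs')) (hp s' h1 h2)
  · have e1 := hsame.lt (s' := s' - 1) (by omega) (by rw [h.halfperiod]; omega)
    have e2 := hs.lt (s' := s' - 1) (by omega) (by rw [h.halfperiod]; omega)
    exact absurd hs'.1 (e2.trans e1).not_gt

/-- The moves in which the points of two classes pass each other. -/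
lemma exists_swapTimes (h : A.CrossData G T κ) {a b : ℤ} (hab : a < b) (hba : b < a + t) :
    ∃ σ : ℕ → ℕ → ℤ, (∀ i j, i < G.size a → j < G.size b → T a < σ i j ∧ σ i j < T b ∧
      A.Passes (σ i j) (κ a i) (κ (b - t) j)) ∧
      ∀ i i' j j', i ≤ i' → j ≤ j' → i' < G.size a → j' < G.size b →
        σ i j' + (i' - i : ℤ) + (j' - j : ℤ) ≤ σ i' j := by
  have H : ∀ i j, ∃ s, i < G.size a → j < G.size b → T a < s ∧ s < T b ∧
      A.Passes s (κ a i) (κ (b - t) j) := fun i j => by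
    by_cases hi : i < G.size a
    · by_cases hj : j < G.size b
      · obtain ⟨s, hs⟩ := h.exists_passes hab hba hi hj
        exact ⟨s, fun _ _ => hs⟩
      · exact ⟨0, fun _ h => absurd h hj⟩
    · exact ⟨0, fun h => absurd h hi⟩
  choose σ hσ using H
  have hT := h.strictMono hba
  rw [h.time_add] at hT
  have hTb := h.time_sub b
  have hp : ∀ i, i < G.size a → ∀ s, T a < s → s < T b →
      ¬ (A.Passes s (κ a i) (κ a i).rev ∨ A.Passes s (κ a i).rev (κ a i)) :=
    fun i hi s h1 h2 => h.not_passes_rev hi h1 (by omega)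
  have hq : ∀ j, j < G.size b → ∀ s, T a < s → s < T b →
      ¬ (A.Passes s (κ (b - t) j) (κ (b - t) j).rev ∨
        A.Passes s (κ (b - t) j).rev (κ (b - t) j)) :=
    fun j hj s h1 h2 => h.not_passes_rev (by rwa [G.size_sub]) (by omega) (by omega)
  refine ⟨σ, hσ, fun i i' j j' hii hjj hi' hj' => grid_lower_bound (M := G.size a) (N := G.size b)
    ?_ ?_ hii hjj hi' hj'⟩
  · intro i i' j hlt hi' hj
    obtain ⟨a1, a2, a3⟩ := hσ i j (by omega) hj
    obtain ⟨b1, b2, b3⟩ := hσ i' j hi' hj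
    exact h.passes_lt_of_lt_left hba hlt hi' a1 a2 b1 b2 a3 b3 (hq j hj)
  · intro i j j' hlt hi hj'
    obtain ⟨a1, a2, a3⟩ := hσ i j hi (by omega)
    obtain ⟨b1, b2, b3⟩ := hσ i j' hi hj'
    exact h.passes_lt_of_lt_right hba hlt hj' a1 a2 b2 a3 b3 (hp i hi)

/-- A monotone path through the grid of passings of the two classes has `size a + size (a + 1) - 1`
successive times, all strictly between the two crossings. -/
lemma le_time_succ (h : A.CrossData G T κ) (ht : 2 ≤ t) (a : ℤ) :
    T a + G.size a + G.size (a + 1) ≤ T (a + 1) := by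
  obtain ⟨σ, h1, h2⟩ := h.exists_swapTimes (a := a) (b := a + 1) (by omega) (by omega)
  have s1 := G.size_pos a
  have s2 := G.size_pos (a + 1)
  have := h2 0 (G.size a - 1) 0 (G.size (a + 1) - 1) (by omega) (by omega) (by omega) (by omega)
  have e1 := h1 0 (G.size (a + 1) - 1) (by omega) (by omega)
  have e2 := h1 (G.size a - 1) 0 (by omega) (by omega)
  omega

lemma conj_mul (h : A.CrossData G T κ) (a m : ℤ) (i : ℕ) :
    κ (a + t * m) i = κ a i ∨ κ (a + t * m) i = (κ a i).rev := by
  induction m using Int.induction_on with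
  | zero => simp
  | succ k ih =>
    rw [show a + t * ((k : ℤ) + 1) = a + t * k + t by ring, h.conj]
    rcases ih with ih | ih <;> simp [ih]
  | pred k ih =>
    rw [show a + t * (-(k : ℤ) - 1) = a + t * -k - t by ring, h.conj_sub]
    rcases ih with ih | ih <;> rw [ih] <;> simp

/-- Folding the positions at the centre identifies conjugate points. Each of the `n` resulting pairs
occurs exactly once in the `t` classes of a halfperiod, since a point meets its conjugate only once
there. -/
lemma sum_size_eq (h : A.CrossData G T κ) (ht : 0 < t) : ∑ r : Fin t, G.size r = n := by
  let fold : Fin (2 * n) → Fin n := fun p =>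
    if hp : p.1 < n then ⟨p, hp⟩ else ⟨p.rev, by rw [Fin.val_rev]; omega⟩
  have hfold : ∀ p q, fold p = fold q → p = q ∨ p = q.rev := by
    intro p q he
    simp only [fold] at he
    simp only [Fin.ext_iff, Fin.val_rev]
    split_ifs at he <;> simp only [Fin.mk.injEq, Fin.val_rev] at he <;> omega
  have hfold_rev : ∀ p, fold p.rev = fold p := by
    intro p
    simp only [fold, Fin.ext_iff, Fin.val_rev]
    split_ifs <;> dsimp only <;> omega
  let f : (Σ r : Fin t, Fin (G.size r)) → Fin n := fun x => fold (κ x.1 x.2)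
  have hf : Function.Bijective f := by
    constructor
    · rintro ⟨a, i⟩ ⟨b, j⟩ he
      have hk := hfold _ _ he
      simp only at hk
      have hai := h.passes_conj i.2
      have hbj := h.passes_conj j.2
      have hdvd : (A.halfperiod : ℤ) ∣ T a - T b := by
        refine dvd_of_passes_or (Or.inl hai) ?_
        rcases hk with hk | hk
        · rw [hk]; exact Or.inl hbj
        · rw [hk, Fin.rev_rev]; exact Or.inr hbj
      obtain ⟨m, hm⟩ := hdvd
      rw [h.halfperiod] at hm
      have t1 : T a < T b + 2 * n := by
        rw [← h.time_add]; exact h.strictMono (by omega)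
      have t2 : T b < T a + 2 * n := by
        rw [← h.time_add]; exact h.strictMono (by omega)
      have hn : (0 : ℤ) < 2 * n := by omega
      have e1 : m < 1 := by
        by_contra hle
        have := mul_nonneg hn.le (show 0 ≤ m - 1 by omega)
        linarith
      have e2 : -1 < m := by
        by_contra hle
        have := mul_nonneg hn.le (show 0 ≤ -1 - m by omega)
        linarith
      obtain rfl : m = 0 := by omega
      have hab : (a : ℤ) = b := h.strictMono.injective (by linarith)
      obtain rfl : a = b := Fin.ext (by omega)
      have p1 := h.pos a i i.2
      have p2 := h.pos a j j.2
      obtain rfl : i = j := by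
        rcases hk with hk | hk
        · rw [hk] at p1; exact Fin.ext (by omega)
        · have l1 := h.left i.2 le_rfl (by omega)
          have l2 := h.left j.2 le_rfl (by omega)
          rw [hk, h.perm_rev, Fin.val_rev] at l1
          omega
      rfl
    · intro p
      obtain ⟨a, i, hi, hp⟩ := h.surj ⟨p, by omega⟩
      obtain ⟨r, q, rfl⟩ := PeriodicSignature.exists_eq_add_mul ht a
      rw [G.size_add_mul] at hi
      refine ⟨⟨r, i, hi⟩, ?_⟩
      have hfp : fold ⟨p, by omega⟩ = p := by simp [fold]
      rcases h.conj_mul r q i with hk | hk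
      · simp only [f]; rw [← hk, hp, hfp]
      · simp only [f]; rw [← hfold_rev, ← hk, hp, hfp]
  have := Fintype.card_of_bijective hf
  simpa using this

end CrossData

end AllowableSequence

/-! ### Rigidity: all passing times are forced. -/

namespace PeriodicSignature

variable {t n : ℕ} (G : PeriodicSignature t n)

/-- Every integer lies in exactly one class; here only existence within given bounds. -/
lemma exists_offset_le_lt {a b : ℤ} (hab : a ≤ b) {y : ℤ} (h1 : G.offset a ≤ y)
    (h2 : y < G.offset b) : ∃ c, a ≤ c ∧ c < b ∧ G.offset c ≤ y ∧ y < G.offset (c + 1) := by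
  obtain ⟨k, rfl⟩ := Int.le.dest hab
  induction k with
  | zero => simp at h2; omega
  | succ k ih =>
    rcases lt_or_ge y (G.offset (a + k)) with h | h
    · obtain ⟨c, e1, e2, e3⟩ := ih (by omega) h
      exact ⟨c, e1, by push_cast; omega, e3⟩
    · exact ⟨a + k, by omega, by push_cast; omega, h, by
        rwa [show a + (k : ℤ) + 1 = a + (k + 1 : ℕ) by push_cast; ring]⟩

end PeriodicSignature

namespace AllowableSequence

variable {n t : ℕ}

namespace CrossData

variable {A : AllowableSequence (2 * n)} {G : PeriodicSignature t n} {T : ℤ → ℤ}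
  {κ : ℤ → ℕ → Fin (2 * n)}

/-- By `le_time_succ` the difference `T - crossTime` is monotone. It is also periodic, because both
functions grow by `2 * n` over `t` classes; hence it is constant, and it vanishes at 0. -/
lemma time_eq (h : A.CrossData G T κ) (ht : 2 ≤ t) : T = G.crossTime := by
  have hmono : Monotone fun a => T a - G.crossTime a := monotone_int_of_le_succ fun a => by
    have := h.le_time_succ ht a
    rw [G.crossTime_succ]; omega
  have hper : ∀ a m : ℤ, T (a + t * m) - G.crossTime (a + t * m) = T a - G.crossTime a := by
    intro a m
    induction m using Int.induction_on with
    | zero => simp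
    | succ k ih =>
      rw [show a + t * ((k : ℤ) + 1) = a + t * k + t by ring, h.time_add, G.crossTime_add]
      omega
    | pred k ih =>
      have e1 := h.time_add (a + t * (-(k : ℤ) - 1))
      have e2 := G.crossTime_add (a + t * (-(k : ℤ) - 1))
      rw [show a + t * (-(k : ℤ) - 1) + t = a + t * -k by ring] at e1 e2
      omega
  funext a
  obtain ⟨r, q, rfl⟩ := PeriodicSignature.exists_eq_add_mul (show 0 < t by omega) a
  have e1 := hmono (show (0 : ℤ) ≤ r by omega)
  have e2 := hmono (show (r : ℤ) ≤ 0 + t * 1 by omega)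
  have e3 := hper 0 1
  have e4 := hper r q
  have e5 := h.time_zero
  have e6 := G.crossTime_zero
  simp only at e1 e2
  omega

/-- The moves in which two points pass each other are determined by the central signature. -/
theorem passes_swapTime (h : A.CrossData G T κ) (ht : 2 ≤ t) (k : ℕ) :
    ∀ (a b : ℤ) (i j : ℕ), b - a = k → a < b → b < a + t → i < G.size a → j < G.size b →
      A.Passes (G.swapTime a i b j) (κ a i) (κ (b - t) j) := by
  induction k using Nat.strong_induction_on with
  | _ k ih =>
  intro a b i j hk hab hba hi hj
  have hTeq := h.time_eq ht
  obtain ⟨σ, hσ, hgrid⟩ := h.exists_swapTimes hab hba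
  have hT2 := h.strictMono hba
  rw [h.time_add] at hT2
  have hTb := h.time_sub b
  have sa := G.size_pos a
  have sb := G.size_pos b
  have hTa' : T a = 1 - G.size 0 + G.offset a + G.offset (a + 1) := by rw [hTeq]; rfl
  have hTb' : T b = 1 - G.size 0 + G.offset b + G.offset (b + 1) := by rw [hTeq]; rfl
  -- By induction, in each of the first `offset b - offset (a + 1)` moves after `T a` the point `κ a
  -- 0` passes a point of an intermediate class, so it cannot meet class `b - t` in any of these
  -- moves.
  have lower : T a + (G.offset b - G.offset (a + 1)) < σ 0 (G.size b - 1) := by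
    obtain ⟨e1, e2, e3⟩ := hσ 0 (G.size b - 1) sa (by omega)
    by_contra hle
    obtain ⟨c, c1, c2, c3, c4⟩ := G.exists_offset_le_lt (a := a + 1) (b := b) (by omega)
      (y := G.offset (a + 1) + (σ 0 (G.size b - 1) - T a) - 1) (by omega) (by omega)
    have hc := G.offset_succ c
    obtain ⟨m, hm⟩ := Int.eq_ofNat_of_zero_le (show 0 ≤ G.offset (c + 1) -
      (G.offset (a + 1) + (σ 0 (G.size b - 1) - T a)) by omega)
    have hmc : m < G.size c := by omega
    have := ih (c - a).toNat (by omega) a c 0 m (by omega) (by omega) (by omega) sa hmc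
    have he : G.swapTime a 0 c m = σ 0 (G.size b - 1) := by
      simp only [PeriodicSignature.swapTime]; push_cast; omega
    rw [he] at this
    refine h.not_passes_rev sa e1 (by omega) (h.single _ _ _ _ ?_ (Or.inl this) (Or.inl e3))
    rw [h.conj_sub, h.conj_sub, Ne, Fin.rev_inj]
    exact h.ne_of_lt c2 (by omega) hmc (by omega)
  -- Symmetrically, the moves just before `T b` are those in which `κ (b - t) 0` is busy with
  -- intermediate classes.
  have upper : σ (G.size a - 1) 0 < T b - (G.offset b - G.offset (a + 1)) := by
    obtain ⟨e1, e2, e3⟩ := hσ (G.size a - 1) 0 (by omega) sb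
    by_contra hle
    obtain ⟨c, c1, c2, c3, c4⟩ := G.exists_offset_le_lt (a := a + 1) (b := b) (by omega)
      (y := G.offset b - (T b - σ (G.size a - 1) 0)) (by omega) (by omega)
    have hc := G.offset_succ c
    obtain ⟨m, hm⟩ := Int.eq_ofNat_of_zero_le (show 0 ≤
      G.offset b - (T b - σ (G.size a - 1) 0) - G.offset c by omega)
    have hmc : m < G.size c := by omega
    have := ih (b - c).toNat (by omega) c b m 0 (by omega) (by omega) (by omega) hmc sb
    have he : G.swapTime c m b 0 = σ (G.size a - 1) 0 := by
      simp only [PeriodicSignature.swapTime]; push_cast; omega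
    rw [he] at this
    refine h.not_passes_rev (a := b - t) (i := 0) (by rwa [G.size_sub]) (by omega) (by omega)
      (h.single _ _ _ _ ?_ (Or.inr this) (Or.inr e3))
    exact (h.ne_of_lt (by omega) (by omega) (by omega) hmc).symm
  -- What remains between the two bounds is exactly `size a + size b - 1` moves, the length of a
  -- monotone path in the grid. The path through `(i, j)` has no slack, so its value there is
  -- forced.
  have g1 := hgrid 0 i j (G.size b - 1) (by omega) (by omega) hi (by omega)
  have g2 := hgrid i (G.size a - 1) 0 j (by omega) (by omega) (by omega) hj
  have ha := G.offset_succ a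
  have hb := G.offset_succ b
  have he : G.swapTime a i b j = σ i j := by
    simp only [PeriodicSignature.swapTime]; omega
  rw [he]
  exact (hσ i j hi hj).2.2

theorem isLabelling (h : A.CrossData G T κ) (ht : 2 ≤ t) : A.IsLabelling G κ where
  surj := h.surj
  halfperiod := by have := h.halfperiod; omega
  perm_zero := h.perm_zero
  isModel := by
    have hTeq := h.time_eq ht
    refine ⟨fun s a i => ?_, fun s a i => ?_, fun s a i hi h1 h2 => ?_,
      fun s a i j hij hj h1 h2 => ?_, fun s a i b j hab hba hi hj h1 h2 => ?_⟩
    · rw [h.conj, h.perm_rev, Fin.val_rev]; omega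
    · have := h.halfperiod
      rw [← this, A.perm_add_halfperiod, Fin.val_rev]; omega
    · rw [← hTeq] at h1 h2
      rw [h.time_add] at h2
      exact_mod_cast h.left hi h1 h2
    · rw [← hTeq] at h1 h2
      rw [h.time_add, ← h.halfperiod] at h2
      exact_mod_cast (h.passes_same hij hj).lt h1 h2
    · have hp := h.passes_swapTime ht (b - a).toNat a b i j (by omega) hab hba hi hj
      have l1 := G.crossTime_lt_swapTime hab (i := i) hj
      have l2 := G.swapTime_lt_crossTime hab (j := j) hi
      have l3 := G.crossTime_strictMono hba
      rw [G.crossTime_add] at l3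
      rcases lt_or_ge s (G.swapTime a i b j) with hs | hs
      · have := hp.gt hs (by rw [h.halfperiod]; omega)
        rw [Fin.lt_def] at this
        omega
      · have := hp.lt hs (by rw [h.halfperiod]; omega)
        rw [Fin.lt_def] at this
        omega

end CrossData

theorem IsDC.exists_isLabelling {A : AllowableSequence (2 * n)} {d : Fin t → ℕ} (h : A.IsDC d)
    (ht : 2 ≤ t) (hd : ∀ i, 0 < d i) : ∃ hn : ∑ j, d j = n, ∃ κ,
      A.IsLabelling (PeriodicSignature.ofFin d (by omega) hd n hn) κ := by
  have hn : ∑ j, d j = n := by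
    obtain ⟨T, κ, hc⟩ := h.exists_crossData (by omega)
      (PeriodicSignature.ofFin d (by omega) hd _ rfl) (PeriodicSignature.ofFin_size _ _ _ _ _)
    rw [← hc.sum_size_eq (by omega)]
    simp only [PeriodicSignature.ofFin_size]
  obtain ⟨T, κ, hc⟩ := h.exists_crossData (by omega)
      (PeriodicSignature.ofFin d (by omega) hd n hn) (PeriodicSignature.ofFin_size _ _ _ _ _)
  exact ⟨hn, κ, hc.isLabelling ht⟩

end AllowableSequence

/-! ### Existence: explicit positions. -/

namespace PeriodicSignature

variable {t n : ℕ} (G : PeriodicSignature t n)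

/-- The distance from the center, after `u` moves in one half, of the `i`-th point of class `a`. -/
def depth (a : ℤ) (i : ℕ) (u : ℤ) : ℤ :=
  -- A trapezoid in `u`: with `e = size a - 1 - i`, the point stays at depth `e` for `i` moves,
  -- moves out one step per move up to `e + n - size a`, stays there, and returns along the falling
  -- branch.
  max ((G.size a - 1 - i : ℕ) : ℤ) (min ((G.size a - 1 - i : ℕ) + n - G.size a)
    (min (u + 2 * (G.size a - 1 - i : ℕ) - G.size a + 1)
      (2 * n - u + 2 * (G.size a - 1 - i : ℕ) - G.size a)))

/-- The position at time `s` of the `i`-th point of class `a`. -/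
def pos (s a : ℤ) (i : ℕ) : ℤ :=
  if Even ((s - G.crossTime a) / (2 * n)) then
    n - 1 - G.depth a i ((s - G.crossTime a) % (2 * n))
  else n + G.depth a i ((s - G.crossTime a) % (2 * n))

variable {G}

lemma size_le (ht : 0 < t) (a : ℤ) : G.size a ≤ n := by
  have h1 := G.offset_add_size_le (show a < a + t by omega)
  rw [G.offset_add] at h1
  omega

lemma depth_nonneg (a : ℤ) (i : ℕ) (u : ℤ) : 0 ≤ G.depth a i u := by
  unfold depth; omega

lemma depth_lt (ht : 0 < t) (a : ℤ) (i : ℕ) (u : ℤ) : G.depth a i u < n := by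
  have := G.size_pos a
  have := G.size_le ht a
  unfold depth; omega

lemma depth_add (a : ℤ) (i : ℕ) (u : ℤ) : G.depth (a + t) i u = G.depth a i u := by
  unfold depth; rw [G.size_add]

lemma pos_nonneg (ht : 0 < t) (s a : ℤ) (i : ℕ) : 0 ≤ G.pos s a i := by
  have := G.depth_lt ht a i ((s - G.crossTime a) % (2 * n))
  have := G.depth_nonneg a i ((s - G.crossTime a) % (2 * n))
  unfold pos; split_ifs <;> omega

lemma pos_lt (ht : 0 < t) (s a : ℤ) (i : ℕ) : G.pos s a i < 2 * n := by
  have := G.depth_lt ht a i ((s - G.crossTime a) % (2 * n))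
  have := G.depth_nonneg a i ((s - G.crossTime a) % (2 * n))
  unfold pos; split_ifs <;> omega

lemma pos_of_left {s a : ℤ} (h1 : G.crossTime a ≤ s) (h2 : s < G.crossTime a + 2 * n) (i : ℕ) :
    G.pos s a i = n - 1 - G.depth a i (s - G.crossTime a) := by
  unfold pos
  rw [Int.ediv_eq_zero_of_lt (by omega) (by omega), Int.emod_eq_of_lt (by omega) (by omega)]
  simp

lemma pos_conj (ht : 0 < t) (s a : ℤ) (i : ℕ) : G.pos s (a + t) i = 2 * n - 1 - G.pos s a i := by
  have hn := G.pos_of_pos ht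
  unfold pos
  rw [G.depth_add, G.crossTime_add,
    show s - (G.crossTime a + 2 * n) = s - G.crossTime a + 2 * n * (-1) by ring,
    Int.add_mul_ediv_left _ _ (by omega), Int.add_mul_emod_self_left,
    show (s - G.crossTime a) / (2 * n) + -1 = (s - G.crossTime a) / (2 * n) - 1 by ring]
  by_cases h : Even ((s - G.crossTime a) / (2 * n)) <;>
    simp only [Int.even_sub_one, h, if_true, if_false, not_true, not_false_iff] <;> ring

lemma pos_anti (ht : 0 < t) (s a : ℤ) (i : ℕ) :
    G.pos (s + 2 * n) a i = 2 * n - 1 - G.pos s a i := by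
  have hn := G.pos_of_pos ht
  unfold pos
  rw [show s + 2 * n - G.crossTime a = s - G.crossTime a + 2 * n * 1 by ring,
    Int.add_mul_ediv_left _ _ (by omega), Int.add_mul_emod_self_left]
  by_cases h : Even ((s - G.crossTime a) / (2 * n)) <;>
    simp only [Int.even_add_one, h, if_true, if_false, not_true, not_false_iff] <;> ring

lemma isModel_pos (ht : 0 < t) : G.IsModel G.pos where
  conj := pos_conj ht
  anti := pos_anti ht
  left s a i hi h1 h2 := by
    rw [G.crossTime_add] at h2
    rw [pos_of_left h1 h2]
    have := G.depth_nonneg a i (s - G.crossTime a)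
    omega
  same s a i j hij hj h1 h2 := by
    rw [G.crossTime_add] at h2
    rw [pos_of_left h1 h2, pos_of_left h1 h2]
    unfold depth
    omega
  cross s a i b j hab hba hi hj h1 h2 := by
    have hT := G.crossTime_strictMono hba
    rw [G.crossTime_add] at hT
    have hb := G.crossTime_add (b - t)
    rw [sub_add_cancel] at hb
    rw [pos_of_left h1 (by omega), pos_of_left (by omega) (by omega)]
    have e1 := G.offset_succ a
    have e2 := G.offset_succ b
    have e3 := G.offset_add_size_le hab
    have e4 := G.offset_add_size_le hba
    rw [G.offset_add] at e4
    have ha : G.crossTime a = 1 - G.size 0 + G.offset a + G.offset (a + 1) := rfl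
    have hb' : G.crossTime b = 1 - G.size 0 + G.offset b + G.offset (b + 1) := rfl
    unfold depth swapTime
    rw [G.size_sub]
    omega

/-- Truncated subtraction makes an out-of-range index behave like the last point of its class. Hence
the rules for positions can be stated without bounds on `i`. -/
lemma pos_min (s a : ℤ) (i : ℕ) : G.pos s a (min i (G.size a - 1)) = G.pos s a i := by
  unfold pos depth
  rw [show G.size a - 1 - min i (G.size a - 1) = G.size a - 1 - i by omega]

/-- A point or its conjugate is in the left half. -/
lemma exists_left (ht : 0 < t) (s a : ℤ) : ∃ m : ℤ, G.crossTime (a + t * m) ≤ s ∧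
    s < G.crossTime (a + t * m) + 2 * n := by
  have hn := G.pos_of_pos ht
  have hT : ∀ m, G.crossTime (a + t * m) = G.crossTime a + 2 * n * m := fun m => by
    simp only [crossTime, show a + t * m + 1 = a + 1 + t * m by ring, G.offset_add_mul]; ring
  have h1 := Int.emod_nonneg (s - G.crossTime a) (show (2 * n : ℤ) ≠ 0 by omega)
  have h2 := Int.emod_lt_of_pos (s - G.crossTime a) (show (0 : ℤ) < 2 * n by omega)
  have h3 := Int.emod_add_mul_ediv (s - G.crossTime a) (2 * n)
  refine ⟨(s - G.crossTime a) / (2 * n), ?_, ?_⟩ <;> rw [hT] <;> omega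

/-- Every time lies between two consecutive crossings. -/
lemma exists_crossTime_le_lt (ht : 0 < t) (s : ℤ) :
    ∃ c, G.crossTime c ≤ s ∧ s < G.crossTime (c + 1) := by
  obtain ⟨m, h1, h2⟩ := G.exists_left ht s 0
  rw [← G.crossTime_add] at h2
  generalize (0 : ℤ) + t * m = a at *
  have : ∀ k : ℕ, s < G.crossTime (a + k) → ∃ c, G.crossTime c ≤ s ∧ s < G.crossTime (c + 1) := by
    intro k
    induction k with
    | zero => intro h; simp at h; omega
    | succ k ih =>
      intro h
      rcases lt_or_ge s (G.crossTime (a + k)) with h' | h'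
      · exact ih h'
      · exact ⟨a + k, h', by rwa [show a + (k : ℤ) + 1 = a + (k + 1 : ℕ) by push_cast; ring]⟩
  exact this t h2

/-- How a point that stays in the left half moves. -/
lemma pos_step {s a : ℤ} {i : ℕ} (hi : i < G.size a) (h1 : G.crossTime a < s)
    (h2 : s < G.crossTime a + 2 * n) :
    G.pos (s - 1) a i < n ∧ G.pos s a i < n ∧
    (G.pos s a i = G.pos (s - 1) a i ∨
      G.pos s a i = G.pos (s - 1) a i - 1 ∧ Even (G.pos (s - 1) a i + s + n + G.size 0) ∨
      G.pos s a i = G.pos (s - 1) a i + 1 ∧ ¬ Even (G.pos (s - 1) a i + s + n + G.size 0)) ∧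
    ∀ c, G.crossTime c = s → G.pos (s - 1) a i + G.size c < n := by
  have ha : G.crossTime a = 1 - G.size 0 + G.offset a + G.offset (a + 1) := rfl
  have e1 := G.offset_succ a
  refine ⟨?_, ?_, ?_, fun c hc => ?_⟩
  · rw [pos_of_left (by omega) (by omega)]; have := G.depth_nonneg a i (s - 1 - G.crossTime a)
    omega
  · rw [pos_of_left (by omega) (by omega)]; have := G.depth_nonneg a i (s - G.crossTime a)
    omega
  · rw [pos_of_left (by omega) (by omega), pos_of_left (by omega) (by omega), Int.even_iff]
    unfold depth
    omega
  · have hac : a < c := G.crossTime_strictMono.lt_iff_lt.1 (by omega)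
    have hca : c < a + t := G.crossTime_strictMono.lt_iff_lt.1 (by rw [G.crossTime_add]; omega)
    have hc' : G.crossTime c = 1 - G.size 0 + G.offset c + G.offset (c + 1) := rfl
    have e2 := G.offset_succ c
    have e3 := G.offset_add_size_le hac
    have e4 := G.offset_add_size_le hca
    rw [G.offset_add] at e4
    rw [pos_of_left (by omega) (by omega)]
    unfold depth
    omega

lemma pos_crossTime {a : ℤ} {i : ℕ} (hi : i < G.size a) (ht : 0 < t) :
    G.pos (G.crossTime a) a i + G.size a = n + i ∧
    G.pos (G.crossTime a - 1) a i + G.pos (G.crossTime a) a i + 1 = 2 * n := by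
  have hn := G.pos_of_pos ht
  have hs := G.size_le ht a
  have h1 := G.pos_anti ht (G.crossTime a - 1) a i
  rw [pos_of_left (by omega) (by omega)] at h1
  rw [pos_of_left (by omega) (by omega)]
  unfold depth at *
  omega

end PeriodicSignature

namespace PeriodicSignature

variable {t n : ℕ} {G : PeriodicSignature t n}

lemma sum_size (G : PeriodicSignature t n) : ∑ r : Fin t, G.size r = n := by
  have h : ∀ k : ℕ, ((∑ r ∈ Finset.range k, G.size r : ℕ) : ℤ) = G.offset k := fun k => by
    induction k with
    | zero => simp [G.offset_zero]
    | succ k ih => rw [Finset.sum_range_succ]; push_cast at *; rw [ih, G.offset_succ]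
  have h1 := h t
  have h2 := G.offset_add 0
  rw [G.offset_zero, zero_add, zero_add, ← h1] at h2
  rw [Fin.sum_univ_eq_sum_range (fun r => G.size r)]
  exact_mod_cast h2

/-- The positions of the model form permutations. -/
theorem exists_perm (ht : 0 < t) (G : PeriodicSignature t n) :
    ∃ (π : ℤ → Equiv.Perm (Fin (2 * n))) (κ : ℤ → ℕ → Fin (2 * n)),
      (∀ s a i, ((π s (κ a i) : ℕ) : ℤ) = G.pos s a i) ∧
      (∀ p, ∃ a i, i < G.size a ∧ κ a i = p) ∧ π 0 = 1 := by
  let cls : (Σ r : Fin t, Fin (G.size r) × Bool) → ℤ := fun x => x.1 + if x.2.2 then (t : ℤ) else 0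
  have hcls : ∀ x, x.2.1 < G.size (cls x) := by
    rintro ⟨r, i, b⟩
    cases b <;> simp [cls, G.size_add]
  let f : ℤ → ℤ → ℕ → Fin (2 * n) := fun s a i =>
    ⟨(G.pos s a i).toNat, by
      have := G.pos_nonneg ht s a i
      have := G.pos_lt ht s a i
      omega⟩
  have hf : ∀ s a i, ((f s a i : ℕ) : ℤ) = G.pos s a i := fun s a i =>
    Int.toNat_of_nonneg (G.pos_nonneg ht s a i)
  -- `cls` lists every class modulo `2 * t` once. Different labels are strictly ordered in every
  -- model, so positions do not collide, and counting turns injectivity into bijectivity.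
  have hinj : ∀ s, Function.Injective fun x => f s (cls x) x.2.1 := by
    intro s x y hxy
    have hxy' : G.pos s (cls x) x.2.1 = G.pos s (cls y) y.2.1 := by
      rw [← hf, ← hf]; exact congrArg (fun z : Fin (2 * n) => ((z : ℕ) : ℤ)) hxy
    have hne : (x.2.1 : ℕ) = y.2.1 ∧ (2 * t : ℤ) ∣ cls y - cls x := by
      by_contra hne
      rcases IsModel.forall_lt_or_forall_gt ht (hcls x) (hcls y) hne s with h | h
      · exact (h _ (isModel_pos ht)).ne hxy'
      · exact (h _ (isModel_pos ht)).ne' hxy'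
    obtain ⟨r, i, b⟩ := x
    obtain ⟨r', i', b'⟩ := y
    obtain ⟨hi, hd⟩ := hne
    have hr := r.2
    have hr' := r'.2
    have h0 : cls ⟨r', i', b'⟩ - cls ⟨r, i, b⟩ = 0 := by
      refine Int.eq_zero_of_abs_lt_dvd hd ?_
      rw [abs_lt]
      cases b <;> cases b' <;> simp only [cls, if_true, if_false, Bool.false_eq_true] <;> omega
    have hb : r = r' ∧ b = b' := by
      cases b <;> cases b' <;>
        simp only [cls, if_true, if_false, Bool.false_eq_true] at h0 <;>
        simp [Fin.ext_iff] <;> omega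
    obtain ⟨rfl, rfl⟩ := hb
    obtain rfl : i = i' := Fin.ext hi
    rfl
  have hcard : Fintype.card (Σ r : Fin t, Fin (G.size r) × Bool) = Fintype.card (Fin (2 * n)) := by
    simp only [Fintype.card_sigma, Fintype.card_prod, Fintype.card_fin, Fintype.card_bool]
    rw [← Finset.sum_mul, G.sum_size, mul_comm]
  let e : ℤ → (Σ r : Fin t, Fin (G.size r) × Bool) ≃ Fin (2 * n) := fun s =>
    Equiv.ofBijective _ ((Fintype.bijective_iff_injective_and_card _).2 ⟨hinj s, hcard⟩)
  have he : ∀ s x, e s x = f s (cls x) x.2.1 := fun s x => rfl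
  have hrep : ∀ a i, ∃ x : Σ r : Fin t, Fin (G.size r) × Bool,
      ∀ s, G.pos s a i = G.pos s (cls x) x.2.1 := by
    intro a i
    obtain ⟨r, q, rfl⟩ := exists_eq_add_mul ht a
    have hs := G.size_pos r
    have hpm : ∀ s, G.pos s (r + t * q) i = G.pos s (r + t * q) (min i (G.size r - 1)) := by
      intro s
      have := G.pos_min s (r + t * q) i
      rwa [G.size_add_mul, eq_comm] at this
    rcases Int.even_or_odd' q with ⟨m, rfl | rfl⟩
    · refine ⟨⟨r, ⟨min i (G.size r - 1), by omega⟩, false⟩, fun s => ?_⟩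
      rw [hpm, show (r : ℤ) + t * (2 * m) = r + 2 * t * m by ring, (isModel_pos ht).periodic]
      simp [cls]
    · refine ⟨⟨r, ⟨min i (G.size r - 1), by omega⟩, true⟩, fun s => ?_⟩
      rw [hpm, show (r : ℤ) + t * (2 * m + 1) = r + t + 2 * t * m by ring,
        (isModel_pos ht).periodic]
      simp [cls]
  refine ⟨fun s => (e 0).symm.trans (e s), f 0, fun s a i => ?_, fun p => ?_, ?_⟩
  · obtain ⟨x, hx⟩ := hrep a i
    have h0 : f 0 a i = e 0 x := by
      ext
      have h1 := hf 0 a i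
      have h2 := hf 0 (cls x) x.2.1
      rw [he]
      have := hx 0
      omega
    rw [h0, Equiv.trans_apply, Equiv.symm_apply_apply, he, hf, hx]
  · obtain ⟨x, rfl⟩ := (e 0).surjective p
    exact ⟨cls x, x.2.1, hcls x, rfl⟩
  · ext p; simp

end PeriodicSignature

/-! ### From positions to an allowable sequence. -/

/-- The switches of a move in which the centered block of `2 * k` positions is reversed and all other
switches reverse two points. -/
def movesSwitches {n : ℕ} (k : ℕ) (σ τ : Equiv.Perm (Fin (2 * n))) :
    Finset (Fin (2 * n) × Fin (2 * n)) :=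
  Finset.univ.filter fun x => x.1 < x.2 ∧ (((x.1 : ℕ) + k = n ∧ (x.2 : ℕ) + 1 = n + k) ∨
    ((x.2 : ℕ) = x.1 + 1 ∧ ((x.1 : ℕ) + k < n ∨ n + k ≤ x.1) ∧ ((x.2 : ℕ) + k < n ∨ n + k ≤ x.2) ∧
      τ (σ.symm x.1) = x.2 ∧ τ (σ.symm x.2) = x.1))

/-- Outside the block a point moves by at most one place, and neighbours never move in the same
direction. So the point standing where `p` goes must come to the place of `p`, and the two form a
transposition. -/
lemma isMove_movesSwitches {n k : ℕ} {σ τ : Equiv.Perm (Fin (2 * n))} (hk : k ≤ n)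
    (hne : ∃ p, σ p ≠ τ p)
    (hblock : ∀ p, n ≤ σ p + k → (σ p : ℕ) < n + k → (σ p : ℕ) + τ p + 1 = 2 * n)
    (hstep : ∀ p, ((σ p : ℕ) + k < n ∨ n + k ≤ σ p) →
      (τ p = σ p ∨ (τ p : ℕ) = σ p + 1 ∨ (τ p : ℕ) + 1 = σ p))
    (hparity : ∀ p q, (σ q : ℕ) = σ p + 1 → ((σ p : ℕ) + k < n ∨ n + k ≤ σ p) →
      ((σ q : ℕ) + k < n ∨ n + k ≤ σ q) → ((τ p : ℕ) = σ p + 1 → (τ q : ℕ) ≠ σ q + 1) ∧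
        ((τ p : ℕ) + 1 = σ p → (τ q : ℕ) + 1 ≠ σ q)) :
    IsMove σ τ (movesSwitches k σ τ) := by
  have hfixed : ∀ p, (∀ s ∈ movesSwitches k σ τ, σ p ∉ Finset.Icc s.1 s.2) → τ p = σ p := by
    intro p hp
    have hpb : (σ p : ℕ) + k < n ∨ n + k ≤ σ p := by
      by_contra hb
      refine hp (⟨n - k, by omega⟩, ⟨n + k - 1, by omega⟩) ?_ ?_
      · simp only [movesSwitches, Finset.mem_filter, Finset.mem_univ, true_and, Fin.lt_def]; omega
      · simp only [Finset.mem_Icc, Fin.le_def]; omega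
    have hpair : ∀ x y : Fin (2 * n), (y : ℕ) = x + 1 → ((x : ℕ) + k < n ∨ n + k ≤ x) →
        ((y : ℕ) + k < n ∨ n + k ≤ y) → τ (σ.symm x) = y → τ (σ.symm y) = x → σ p ≠ x ∧ σ p ≠ y := by
      intro x y hxy hb hb' h1 h2
      have := hp (x, y) (by
        simp only [movesSwitches, Finset.mem_filter, Finset.mem_univ, true_and, Fin.lt_def]
        exact ⟨by omega, Or.inr ⟨hxy, hb, hb', h1, h2⟩⟩)
      dsimp only at this
      rw [Finset.mem_Icc, Fin.le_def, Fin.le_def] at this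
      simp only [Ne, Fin.ext_iff]; omega
    have hτ : ∀ q, (τ q : ℕ) = τ p → q = p := fun q h => τ.injective (Fin.ext h)
    rcases hstep p hpb with h | h | h
    · exact h
    · exfalso
      have hlt := (τ p).2
      have eq : σ (σ.symm (τ p)) = τ p := σ.apply_symm_apply _
      have eqv : (σ (σ.symm (τ p)) : ℕ) = σ p + 1 := by rw [eq]; exact h
      obtain ⟨q, hq⟩ : ∃ q, σ.symm (τ p) = q := ⟨_, rfl⟩
      rw [hq] at eq eqv
      have hqp : q ≠ p := by rintro rfl; omega
      by_cases hqb : (σ q : ℕ) + k < n ∨ n + k ≤ σ q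
      · rcases hstep q hqb with h' | h' | h'
        · exact hqp (hτ q (by rw [h', eq]))
        · exact (hparity p q eqv hpb hqb).1 h h'
        · have := hpair (σ p) (τ p) h hpb (by rw [← eq]; exact hqb) (by simp) (by
            rw [hq]; ext; omega)
          exact this.1 rfl
      -- If `p` moved right into the block, it would land on its first place `n - k`, which the
      -- reversal already gives to the point from its last place.
      · have hr : σ (σ.symm ⟨n + k - 1, by omega⟩) = ⟨n + k - 1, by omega⟩ := σ.apply_symm_apply _
        have hr' := congrArg Fin.val hr
        simp only at hr'
        have hb := hblock (σ.symm ⟨n + k - 1, by omega⟩) (by omega) (by omega)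
        have := hτ (σ.symm ⟨n + k - 1, by omega⟩) (by omega)
        rw [this] at hr'
        omega
    · exfalso
      have hlt := (τ p).2
      have eq : σ (σ.symm (τ p)) = τ p := σ.apply_symm_apply _
      have eqv : (σ (σ.symm (τ p)) : ℕ) + 1 = σ p := by rw [eq]; exact h
      obtain ⟨q, hq⟩ : ∃ q, σ.symm (τ p) = q := ⟨_, rfl⟩
      rw [hq] at eq eqv
      have hqp : q ≠ p := by rintro rfl; omega
      by_cases hqb : (σ q : ℕ) + k < n ∨ n + k ≤ σ q
      · rcases hstep q hqb with h' | h' | h'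
        · exact hqp (hτ q (by rw [h', eq]))
        · have := hpair (τ p) (σ p) h.symm (by rw [← eq]; exact hqb) hpb (by
            rw [hq]; ext; omega) (by simp)
          exact this.2 rfl
        · exact (hparity q p eqv.symm hqb hpb).2 h' h
      · have hr : σ (σ.symm ⟨n - k, by omega⟩) = ⟨n - k, by omega⟩ := σ.apply_symm_apply _
        have hr' := congrArg Fin.val hr
        simp only at hr'
        have hb := hblock (σ.symm ⟨n - k, by omega⟩) (by omega) (by omega)
        have := hτ (σ.symm ⟨n - k, by omega⟩) (by omega)
        rw [this] at hr'
        omega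
  refine ⟨?_, fun s hs => (Finset.mem_filter.1 hs).2.1, fun s hs s' hs' hne => ?_,
    fun s hs p hp => ?_, hfixed⟩
  · by_contra hemp
    rw [Finset.not_nonempty_iff_eq_empty] at hemp
    obtain ⟨p, hp⟩ := hne
    exact hp (hfixed p (by simp [hemp])).symm
  · rw [Finset.disjoint_left]
    intro z hz hz'
    apply hne
    simp only [movesSwitches, Finset.mem_filter, Finset.mem_univ, true_and, Finset.mem_Icc,
      Fin.le_def] at *
    obtain ⟨hlt, h⟩ := hs
    obtain ⟨hlt', h'⟩ := hs'
    suffices s.1 = s'.1 ∧ s.2 = s'.2 from Prod.ext this.1 this.2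
    rcases h with h | ⟨h1, h2, h2b, h3, h4⟩ <;> rcases h' with h' | ⟨h1', h2', h2b', h3', h4'⟩
    · simp only [Fin.ext_iff]; omega
    · omega
    · omega
    · by_cases e1 : s.1 = s'.1
      · simp only [Fin.ext_iff] at *; omega
      · exfalso
        by_cases e2 : s.2 = s'.1
        · have := h4.symm.trans (e2 ▸ h3')
          simp only [Fin.ext_iff] at *; omega
        · have e3 : s'.2 = s.1 := by simp only [Fin.ext_iff] at *; omega
          have := h4'.symm.trans (e3 ▸ h3)
          simp only [Fin.ext_iff] at *; omega
  · simp only [movesSwitches, Finset.mem_filter, Finset.mem_univ, true_and, Finset.mem_Icc,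
      Fin.le_def] at *
    obtain ⟨hlt, h | ⟨h1, h2, h2b, h3, h4⟩⟩ := hs
    · have := hblock p (by omega) (by omega); omega
    · by_cases e : σ p = s.1
      · rw [← e, Equiv.symm_apply_apply] at h3
        rw [e, h3]
      · have e' : σ p = s.2 := by simp only [Fin.ext_iff] at *; omega
        rw [← e', Equiv.symm_apply_apply] at h4
        rw [e', h4, add_comm]

namespace PeriodicSignature

variable {t n : ℕ} {G : PeriodicSignature t n}

lemma IsModel.conj_mul {P : ℤ → ℤ → ℕ → ℤ} (h : G.IsModel P) (a m : ℤ) (i : ℕ) :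
    (∀ s, P s (a + t * m) i = P s a i) ∨ ∀ s, P s (a + t * m) i = 2 * n - 1 - P s a i := by
  induction m using Int.induction_on with
  | zero => simp
  | succ k ih =>
    have := fun s => h.conj s (a + t * k) i
    rw [show a + t * ((k : ℤ) + 1) = a + t * k + t by ring]
    rcases ih with ih | ih
    · right; intro s; rw [this, ih]
    · left; intro s; rw [this, ih]; ring
  | pred k ih =>
    have := fun s => h.conj_sub s (a + t * -k) i
    rw [show a + t * (-(k : ℤ) - 1) = a + t * -k - t by ring]
    rcases ih with ih | ih
    · right; intro s; rw [this, ih]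
    · left; intro s; rw [this, ih]; ring

/-- Every move strictly between two crossings contains a switch of points of these classes. -/
lemma exists_swapTime_eq {c s : ℤ} (h1 : G.crossTime c < s) (h2 : s < G.crossTime (c + 1)) :
    ∃ i j, i < G.size c ∧ j < G.size (c + 1) ∧ G.swapTime c i (c + 1) j = s := by
  rw [G.crossTime_succ] at h2
  have e1 := G.offset_succ c
  have e2 := G.offset_succ (c + 1)
  have hc : G.crossTime c = 1 - G.size 0 + G.offset c + G.offset (c + 1) := rfl
  have := G.size_pos c
  have := G.size_pos (c + 1)
  obtain ⟨x, rfl⟩ := Int.le.dest (show G.crossTime c + 1 ≤ s by omega)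
  refine ⟨min x (G.size c - 1), G.size (c + 1) - 1 - (x - min x (G.size c - 1)), by omega,
    by omega, ?_⟩
  unfold swapTime
  omega

open Classical in
/-- Half of the number of points in the crossing switch of a move, and `0` if there is none. -/
noncomputable def blockSize (G : PeriodicSignature t n) (s : ℤ) : ℕ :=
  if h : ∃ c, G.crossTime c = s then G.size h.choose else 0

lemma blockSize_crossTime (c : ℤ) : G.blockSize (G.crossTime c) = G.size c := by
  have h : ∃ c', G.crossTime c' = G.crossTime c := ⟨c, rfl⟩
  rw [blockSize, dif_pos h, G.crossTime_strictMono.injective h.choose_spec]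

lemma blockSize_eq_zero {s : ℤ} (h : ¬ ∃ c, G.crossTime c = s) : G.blockSize s = 0 :=
  dif_neg h

lemma blockSize_le (ht : 0 < t) (s : ℤ) : G.blockSize s ≤ n := by
  by_cases h : ∃ c, G.crossTime c = s
  · obtain ⟨c, rfl⟩ := h
    rw [blockSize_crossTime]; exact G.size_le ht c
  · rw [blockSize_eq_zero h]; omega

open AllowableSequence in
/-- The existence of a sequence with a given central signature. -/
theorem exists_isLabelling (ht : 2 ≤ t) (G : PeriodicSignature t n) :
    ∃ (A : AllowableSequence (2 * n)) (κ : ℤ → ℕ → Fin (2 * n)), A.IsLabelling G κ ∧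
      A.IsCentrallySymmetric ∧ A.InNoncentralGeneralPosition ∧
      (∀ s, ∀ x ∈ A.switches s, IsCrossing x → ∃ c, G.crossTime c = s) ∧
      ∀ c, ∃ x ∈ A.switches (G.crossTime c), IsCrossing x ∧
        (x.2 : ℕ) + 1 = x.1 + 2 * G.size c := by
  have ht0 : 0 < t := by omega
  have hn := G.pos_of_pos ht0
  have hM := isModel_pos (G := G) ht0
  obtain ⟨π, κ, hπ, hsurj, hπ0⟩ := exists_perm ht0 G
  have hanti : ∀ s p, π (s + 2 * n) p = (π s p).rev := by
    intro s p
    obtain ⟨a, i, hi, rfl⟩ := hsurj p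
    have h1 := hπ s a i
    have h2 := hπ (s + 2 * n) a i
    have h3 := G.pos_anti ht0 s a i
    ext
    rw [Fin.val_rev]
    omega
  have hrep : ∀ s p, ∃ a i, i < G.size a ∧ G.crossTime a ≤ s ∧ s < G.crossTime a + 2 * n ∧
      ((∀ s', ((π s' p : ℕ) : ℤ) = G.pos s' a i) ∨
        ∀ s', ((π s' p : ℕ) : ℤ) = 2 * n - 1 - G.pos s' a i) := by
    intro s p
    obtain ⟨a, i, hi, rfl⟩ := hsurj p
    obtain ⟨m, h1, h2⟩ := G.exists_left ht0 s a
    refine ⟨a + t * m, i, by rwa [G.size_add_mul], h1, h2, ?_⟩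
    rcases hM.conj_mul a m i with h | h
    · left; intro s'; rw [h, hπ]
    · right; intro s'; rw [h, hπ]; ring
  have hblock : ∀ s p, n ≤ π (s - 1) p + G.blockSize s →
      (π (s - 1) p : ℕ) < n + G.blockSize s → (π (s - 1) p : ℕ) + π s p + 1 = 2 * n := by
    intro s p h1 h2
    by_cases hc : ∃ c, G.crossTime c = s
    · obtain ⟨c, hc⟩ := hc
      have hk := blockSize_crossTime (G := G) c
      rw [hc] at hk
      obtain ⟨a, i, hi, a1, a2, ha⟩ := hrep s p
      rcases eq_or_lt_of_le a1 with rfl | a1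
      · have := (pos_crossTime hi ht0).2
        rcases ha with ha | ha <;>
        · have h3 := ha (G.crossTime a - 1)
          have h4 := ha (G.crossTime a)
          omega
      · obtain ⟨b1, b2, b3, b4⟩ := pos_step hi a1 a2
        have b4 := b4 c hc
        rcases ha with ha | ha <;>
        · have h3 := ha (s - 1)
          omega
    · rw [blockSize_eq_zero hc] at h1 h2; omega
  have hstep : ∀ s p, ((π (s - 1) p : ℕ) + G.blockSize s < n ∨ n + G.blockSize s ≤ π (s - 1) p) →
      π s p = π (s - 1) p ∨
        (π s p : ℕ) = π (s - 1) p + 1 ∧ ¬ Even (((π (s - 1) p : ℕ) : ℤ) + s + n + G.size 0) ∨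
        (π s p : ℕ) + 1 = π (s - 1) p ∧ Even (((π (s - 1) p : ℕ) : ℤ) + s + n + G.size 0) := by
    intro s p hp
    obtain ⟨a, i, hi, a1, a2, ha⟩ := hrep s p
    rcases eq_or_lt_of_le a1 with rfl | a1
    · have h1 := pos_crossTime hi ht0
      rw [blockSize_crossTime] at hp
      rcases ha with ha | ha <;>
      · have h3 := ha (G.crossTime a - 1)
        have h4 := ha (G.crossTime a)
        omega
    · obtain ⟨b1, b2, b3, b4⟩ := pos_step hi a1 a2
      simp only [Int.even_iff, Fin.ext_iff] at *
      rcases ha with ha | ha <;>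
      · have h3 := ha (s - 1)
        have h4 := ha s
        omega
  have hmove : ∀ s, IsMove (π (s - 1)) (π s) (movesSwitches (G.blockSize s) (π (s - 1)) (π s)) := by
    intro s
    refine isMove_movesSwitches (G.blockSize_le ht0 s) ?_ (hblock s) ?_ ?_
    · by_contra hall
      push Not at hall
      obtain ⟨c, c1, c2⟩ := G.exists_crossTime_le_lt ht0 s
      rcases eq_or_lt_of_le c1 with rfl | c1
      · have h1 := pos_crossTime (G.size_pos c) ht0
        have h2 := hπ (G.crossTime c) c 0
        have h3 := hπ (G.crossTime c - 1) c 0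
        rw [hall] at h3
        omega
      · obtain ⟨i, j, hi, hj, hs⟩ := G.exists_swapTime_eq c1 c2
        have h1 := (hM.cross (s - 1) c i (c + 1) j (by omega) (by omega) hi hj (by omega)
          (by omega)).2
        have h2 := (hM.cross s c i (c + 1) j (by omega) (by omega) hi hj (by omega)
          (by omega)).2
        rw [← hπ, ← hπ, hall, hall, hπ, hπ, h2] at h1
        omega
    · intro p hp
      rcases hstep s p hp with h | h | h
      · exact Or.inl h
      · exact Or.inr (Or.inl h.1)
      · exact Or.inr (Or.inr h.1)
    · intro p q hpq hp hq
      have h1 := hstep s p hp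
      have h2 := hstep s q hq
      simp only [Int.even_iff, Fin.ext_iff] at *
      omega
  -- The start of a halfperiod of constant order is shifted into `1, …, 2 * n`; an odd number of
  -- shifts exchanges the roles of `p` and `q`. That start is the unique move in which the two
  -- points meet.
  have hwindow : ∀ p q, p ≠ q → ∃ s₀ : ℤ, 1 ≤ s₀ ∧ s₀ ≤ 2 * n ∧
      ((∀ s, s₀ ≤ s → s < s₀ + 2 * n → π s p < π s q) ∨
        ∀ s, s₀ ≤ s → s < s₀ + 2 * n → π s q < π s p) := by
    intro p q hpq
    obtain ⟨a, i, hi, rfl⟩ := hsurj p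
    obtain ⟨b, j, hj, rfl⟩ := hsurj q
    have hne : ¬ (i = j ∧ (2 * t : ℤ) ∣ b - a) := by
      rintro ⟨rfl, m, hm⟩
      obtain rfl : b = a + 2 * t * m := by linarith
      apply hpq
      have h1 := hM.periodic 0 a m i
      rw [← hπ, ← hπ, hπ0] at h1
      ext
      simpa using h1.symm
    obtain ⟨s₀, H⟩ := IsModel.exists_lt ht0 hi hj hne
    have H := H _ hM
    have h1 := Int.emod_nonneg (s₀ - 1) (show (2 * n : ℤ) ≠ 0 by omega)
    have h2 := Int.emod_lt_of_pos (s₀ - 1) (show (0 : ℤ) < 2 * n by omega)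
    have h3 := Int.emod_add_mul_ediv (s₀ - 1) (2 * n)
    generalize (s₀ - 1) / (2 * n) = m at *
    refine ⟨s₀ + 2 * n * (-m), by linarith, by linarith, ?_⟩
    have key : ∀ s, s₀ + 2 * n * (-m) ≤ s → s < s₀ + 2 * n * (-m) + 2 * n →
        G.pos (s + 2 * n * m) a i < G.pos (s + 2 * n * m) b j :=
      fun s e1 e2 => H _ (by linarith) (by linarith)
    by_cases hm : Even m
    · left; intro s e1 e2
      have := key s e1 e2
      simp only [hM.anti_mul, hm, if_true, ← hπ] at this
      rw [Fin.lt_def]; omega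
    · right; intro s e1 e2
      have := key s e1 e2
      simp only [hM.anti_mul, hm, if_false, ← hπ] at this
      rw [Fin.lt_def]; omega
  have hunique : ∀ p q, p ≠ q → ∃! s : ℤ, 1 ≤ s ∧ s ≤ (2 * n : ℕ) ∧
      ∃ x ∈ movesSwitches (G.blockSize s) (π (s - 1)) (π s),
        π (s - 1) p ∈ Finset.Icc x.1 x.2 ∧ π (s - 1) q ∈ Finset.Icc x.1 x.2 := by
    intro p q hpq
    simp only [fun s => (hmove s).together_iff hpq]
    obtain ⟨s₀, h1, h2, h⟩ := hwindow p q hpq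
    have hback : ∀ s, s₀ - 2 * n ≤ s → s < s₀ → ∀ p' q', π (s + 2 * n) p' < π (s + 2 * n) q' →
        π s q' < π s p' := by
      intro s _ _ p' q' hlt
      rwa [hanti, hanti, Fin.rev_lt_rev] at hlt
    refine ⟨s₀, ⟨h1, by push_cast; exact h2, ?_⟩, ?_⟩
    · rcases h with h | h
      · have e1 := h s₀ le_rfl (by omega)
        have e2 := hback (s₀ - 1) (by omega) (by omega) _ _ (h _ (by omega) (by omega))
        exact ⟨fun e => absurd e e2.not_gt, fun e => absurd e e1.not_gt⟩
      · have e1 := h s₀ le_rfl (by omega)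
        have e2 := hback (s₀ - 1) (by omega) (by omega) _ _ (h _ (by omega) (by omega))
        exact ⟨fun _ => e1, fun _ => e2⟩
    · rintro s ⟨e1, e2, hs⟩
      push_cast at e2
      rcases lt_trichotomy s s₀ with hlt | he | hlt
      · exfalso
        rcases h with h | h
        · have f1 := hback (s - 1) (by omega) (by omega) _ _ (h _ (by omega) (by omega))
          have f2 := hback s (by omega) (by omega) _ _ (h _ (by omega) (by omega))
          exact f1.not_gt (hs.2 f2)
        · have f1 := hback (s - 1) (by omega) (by omega) _ _ (h _ (by omega) (by omega))
          have f2 := hback s (by omega) (by omega) _ _ (h _ (by omega) (by omega))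
          exact f2.not_gt (hs.1 f1)
      · exact he
      · exfalso
        rcases h with h | h
        · exact (h s (by omega) (by omega)).not_gt (hs.1 (h (s - 1) (by omega) (by omega)))
        · exact (h (s - 1) (by omega) (by omega)).not_gt (hs.2 (h s (by omega) (by omega)))
  let A : AllowableSequence (2 * n) :=
    { perm := π
      switches := fun s => movesSwitches (G.blockSize s) (π (s - 1)) (π s)
      halfperiod := 2 * n
      halfperiod_pos := by omega
      perm_add_halfperiod := fun s p => by rw [← hanti]; push_cast; rfl
      isMove := hmove
      existsUnique_switch := hunique }
  refine ⟨A, κ, ⟨?_, hsurj, rfl, hπ0⟩, fun p => ?_, fun s x hx hc => ?_, fun s x hx hc => ?_,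
    fun c => ?_⟩
  · have : (fun s a i => (((A.perm s (κ a i) : ℕ) : ℤ))) = G.pos := by
      funext s a i; exact hπ s a i
    rw [this]; exact hM
  · obtain ⟨a, i, hi, rfl⟩ := hsurj p
    refine ⟨κ (a + t) i, fun s => ?_⟩
    have h1 := hπ s a i
    have h2 := hπ s (a + t) i
    have h3 := G.pos_conj ht0 s a i
    ext
    rw [Fin.val_rev]
    change ((π s (κ (a + t) i)) : ℕ) = 2 * n - ((π s (κ a i) : ℕ) + 1)
    omega
  · obtain ⟨h1, h2 | h2⟩ := (Finset.mem_filter.1 hx).2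
    · exact absurd (Fin.ext (by rw [Fin.val_rev]; omega)) hc
    · exact h2.1
  · by_contra hno
    obtain ⟨h1, h2 | ⟨h2, -, -, h3, h4⟩⟩ := (Finset.mem_filter.1 hx).2
    · rw [blockSize_eq_zero hno] at h2
      rw [Fin.lt_def] at h1
      omega
    -- A centered transposition carries a point across the centre, whereas outside crossing times
    -- every point stays in its half by `pos_step`.
    · have hc' := congrArg Fin.val hc
      rw [Fin.val_rev] at hc'
      have e1 : π (s - 1) ((π (s - 1)).symm x.1) = x.1 := Equiv.apply_symm_apply _ _
      obtain ⟨a, i, hi, a1, a2, ha⟩ := hrep s ((π (s - 1)).symm x.1)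
      rcases eq_or_lt_of_le a1 with rfl | a1
      · exact hno ⟨a, rfl⟩
      · obtain ⟨b1, b2, -⟩ := pos_step hi a1 a2
        rcases ha with ha | ha <;>
        · have e2 := ha (s - 1)
          have e3 := ha s
          rw [e1] at e2
          rw [h3] at e3
          omega
  · have hk := blockSize_crossTime (G := G) c
    have h1 := G.size_le ht0 c
    have h2 := G.size_pos c
    refine ⟨(⟨n - G.size c, by omega⟩, ⟨n + G.size c - 1, by omega⟩), ?_, ?_, ?_⟩
    · change _ ∈ movesSwitches _ _ _
      simp only [movesSwitches, Finset.mem_filter, Finset.mem_univ, true_and, Fin.lt_def, hk]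
      omega
    · ext
      rw [Fin.val_rev]
      simp only
      omega
    · simp only
      omega

end PeriodicSignature

/-! ### Existence and uniqueness of the sequence. -/

namespace AllowableSequence

theorem existsUnique_isDC (t : ℕ) (ht : 2 ≤ t) (d : Fin t → ℕ) (hd : ∀ i, 0 < d i) :
    ∃! A : Σ n : ℕ, AllowableSequence (2 * n), A.2.IsDC d := by
  let G := PeriodicSignature.ofFin d (by omega) hd _ rfl
  obtain ⟨A, κ, hl, hc, hg, hx, hx'⟩ := PeriodicSignature.exists_isLabelling ht G
  have hG : ∀ r : Fin t, G.size r = d r := PeriodicSignature.ofFin_size _ _ _ _ _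
  refine ⟨⟨_, A⟩, ⟨hl.halfperiod, hc, hg, ⟨fun r => G.crossTime r, ?_, ?_, fun j => ?_⟩,
    hl.perm_zero, ?_⟩, ?_⟩
  · intro r r' h
    exact G.crossTime_strictMono (by exact_mod_cast Fin.lt_def.1 h)
  · have h0 := G.crossTime_zero
    have hpt := G.crossTime_add 0
    rw [h0] at hpt
    ext s
    simp only [Set.mem_range, Set.mem_ofPred_eq, hl.halfperiod]
    constructor
    · rintro ⟨r, rfl⟩
      have e1 := G.crossTime_strictMono.monotone (show (0 : ℤ) ≤ r by omega)
      have e2 := G.crossTime_strictMono (show (r : ℤ) < 0 + t by omega)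
      obtain ⟨x, hx, hc, -⟩ := hx' r
      exact ⟨by omega, by push_cast at *; omega, x, hx, hc⟩
    · rintro ⟨e1, e2, x, hxs, hc⟩
      obtain ⟨c, rfl⟩ := hx s x hxs hc
      have c1 : 0 ≤ c := G.crossTime_strictMono.le_iff_le.1 (by omega)
      have c2 : c < 0 + t := G.crossTime_strictMono.lt_iff_lt.1 (by push_cast at *; omega)
      exact ⟨⟨c.toNat, by omega⟩, by simp [Int.toNat_of_nonneg c1]⟩
  · obtain ⟨x, hx, hc, he⟩ := hx' j
    exact ⟨x, hx, hc, by rw [he, hG]⟩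
  · obtain ⟨x, hx, hc, -⟩ := hx' 0
    rw [G.crossTime_zero] at hx
    exact ⟨x, hx, hc⟩
  · rintro ⟨m, B⟩ hB
    replace hB : B.IsDC d := hB
    obtain ⟨hm, κ', hl'⟩ := hB.exists_isLabelling ht hd
    subst hm
    simp only [hl'.eq hl (by omega)]

end AllowableSequence

/-! ### From directions of sums to a geometric realization. -/

/-- The determinant of two vectors of the plane. -/
def planeDet (u v : ℝ × ℝ) : ℝ := u.1 * v.2 - u.2 * v.1

open Real in
-- In this form the projection of `u` at angle `φ` is `ρ * sin (ψ - φ)`, so it vanishes at `φ = ψ`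
-- and is negative just after: `ψ` is the critical angle.
lemma exists_polar (u : ℝ × ℝ) (hu : u ≠ 0) :
    ∃ ψ ρ : ℝ, 0 < ρ ∧ u = (ρ * sin ψ, -(ρ * cos ψ)) := by
  have hz : (⟨u.1, u.2⟩ : ℂ) ≠ 0 := by
    intro h
    apply hu
    exact Prod.ext (congrArg Complex.re h) (congrArg Complex.im h)
  refine ⟨Complex.arg ⟨u.1, u.2⟩ + π / 2, ‖(⟨u.1, u.2⟩ : ℂ)‖, norm_pos_iff.2 hz, ?_⟩
  have h0 := norm_pos_iff.2 hz
  rw [sin_add_pi_div_two, cos_add_pi_div_two, Complex.cos_arg hz, Complex.sin_arg]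
  ext
  · simp only; field_simp
  · simp only; field_simp

open Real in
-- Rotate so that the direction given by `ψ` becomes the positive real axis. A positive determinant
-- puts `v` in the upper half plane, and its argument, in `(0, π)`, is the angle to add.
lemma exists_polar_of_det_pos {v : ℝ × ℝ} {ψ ρ : ℝ} (hρ : 0 < ρ)
    (h : 0 < planeDet (ρ * sin ψ, -(ρ * cos ψ)) v) :
    ∃ ψ' ρ' : ℝ, 0 < ρ' ∧ v = (ρ' * sin ψ', -(ρ' * cos ψ')) ∧ ψ < ψ' ∧ ψ' < ψ + π := by
  have hb : 0 < sin ψ * v.2 + cos ψ * v.1 := by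
    simp only [planeDet] at h
    by_contra hle
    nlinarith
  have hz : (⟨v.1 * sin ψ - v.2 * cos ψ, sin ψ * v.2 + cos ψ * v.1⟩ : ℂ) ≠ 0 := by
    intro h
    have := congrArg Complex.im h
    simp only [Complex.zero_im] at this
    linarith
  have h0 := norm_pos_iff.2 hz
  have hcos := Complex.cos_arg hz
  have hsin := Complex.sin_arg (⟨v.1 * sin ψ - v.2 * cos ψ, sin ψ * v.2 + cos ψ * v.1⟩ : ℂ)
  have hnn : 0 ≤ Complex.arg ⟨v.1 * sin ψ - v.2 * cos ψ, sin ψ * v.2 + cos ψ * v.1⟩ :=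
    Complex.arg_nonneg_iff.2 hb.le
  have hle := Complex.arg_le_pi ⟨v.1 * sin ψ - v.2 * cos ψ, sin ψ * v.2 + cos ψ * v.1⟩
  simp only at hcos hsin
  generalize Complex.arg ⟨v.1 * sin ψ - v.2 * cos ψ, sin ψ * v.2 + cos ψ * v.1⟩ = γ at *
  generalize ‖(⟨v.1 * sin ψ - v.2 * cos ψ, sin ψ * v.2 + cos ψ * v.1⟩ : ℂ)‖ = R at *
  have hsp : 0 < sin γ := by rw [hsin]; positivity
  rw [eq_div_iff h0.ne'] at hcos hsin
  have hsq := sin_sq_add_cos_sq ψ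
  refine ⟨ψ + γ, R, h0, ?_, ?_, ?_⟩
  · rw [sin_add, cos_add]
    ext
    · simp only; linear_combination (-sin ψ) * hcos - cos ψ * hsin - v.1 * hsq
    · simp only; linear_combination (cos ψ) * hcos - sin ψ * hsin - v.2 * hsq
  · rcases hnn.eq_or_lt with h | h
    · rw [← h, sin_zero] at hsp; exact absurd hsp (lt_irrefl _)
    · linarith
  · rcases hle.eq_or_lt with h | h
    · rw [h, sin_pi] at hsp; exact absurd hsp (lt_irrefl _)
    · linarith

open Real in
/-- A cyclic sequence of directions that turns once is given by an increasing sequence of angles. -/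
lemma exists_angles {N : ℕ} (hN : 0 < N) {w : ℤ → ℝ × ℝ} (hanti : ∀ s, w (s + N) = -w s)
    (hsucc : ∀ s, 0 < planeDet (w s) (w (s + 1))) (s₀ : ℤ)
    (h₀ : ∀ s, s₀ < s → s < s₀ + N → 0 < planeDet (w s₀) (w s)) :
    ∃ θ : ℤ → ℝ, StrictMono θ ∧ (∀ s m : ℤ, θ (s + N * m) = θ s + π * m) ∧
      ∀ s, ∃ ρ : ℝ, 0 < ρ ∧ w s = (ρ * sin (θ s), -(ρ * cos (θ s))) := by
  have hw0 : w s₀ ≠ 0 := by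
    intro h
    have := hsucc s₀
    simp [h, planeDet] at this
  obtain ⟨ψ₀, ρ₀, hρ₀, hp₀⟩ := exists_polar _ hw0
  have H : ∀ r : ℤ, ∃ ψ ρ : ℝ, 0 ≤ r → r < N → 0 < ρ ∧
      w (s₀ + r) = (ρ * sin ψ, -(ρ * cos ψ)) ∧ ψ₀ ≤ ψ ∧ ψ < ψ₀ + π ∧ (r = 0 → ψ = ψ₀) := by
    intro r
    by_cases hr0 : r = 0
    · exact ⟨ψ₀, ρ₀, fun _ _ => ⟨hρ₀, by rw [hr0, add_zero, hp₀], le_rfl,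
        by linarith [pi_pos], fun _ => rfl⟩⟩
    by_cases hr : 0 ≤ r ∧ r < N
    · have h1 := h₀ (s₀ + r) (by omega) (by omega)
      rw [hp₀] at h1
      obtain ⟨ψ, ρ, e1, e2, e3, e4⟩ := exists_polar_of_det_pos hρ₀ h1
      exact ⟨ψ, ρ, fun _ _ => ⟨e1, e2, e3.le, e4, fun h => absurd h hr0⟩⟩
    · exact ⟨0, 0, fun h1 h2 => absurd ⟨h1, h2⟩ hr⟩
  choose ψ ρ H using H
  -- Angles are chosen for `N` consecutive indices from `s₀`, all within one half-turn, and
  -- continued by adding `π` every `N` steps, in accordance with `hanti`.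
  let θ : ℤ → ℝ := fun s => ψ ((s - s₀) % N) + π * ((s - s₀) / N : ℤ)
  have hθ : ∀ r q : ℤ, 0 ≤ r → r < N → θ (s₀ + r + N * q) = ψ r + π * q := by
    intro r q h1 h2
    simp only [θ]
    rw [show s₀ + r + N * q - s₀ = r + N * q by ring, Int.add_mul_emod_self_left,
      Int.add_mul_ediv_left _ _ (by omega), Int.emod_eq_of_lt h1 h2, Int.ediv_eq_zero_of_lt h1 h2,
      zero_add]
  have hrep : ∀ s : ℤ, ∃ r q : ℤ, 0 ≤ r ∧ r < N ∧ s = s₀ + r + N * q := fun s =>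
    ⟨(s - s₀) % N, (s - s₀) / N, Int.emod_nonneg _ (by omega), Int.emod_lt_of_pos _ (by omega), by
      have := Int.emod_add_mul_ediv (s - s₀) N; linarith⟩
  have hwmul : ∀ s q : ℤ, (Even q → w (s + N * q) = w s) ∧ (¬ Even q → w (s + N * q) = -w s) := by
    intro s q
    induction q using Int.induction_on with
    | zero => simp
    | succ k ih =>
      rw [show s + N * ((k : ℤ) + 1) = s + N * k + N by ring, hanti, Int.even_add_one]
      exact ⟨fun h => by rw [ih.2 h, neg_neg], fun h => by rw [ih.1 (not_not.1 h)]⟩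
    | pred k ih =>
      have := hanti (s + N * (-(k : ℤ) - 1))
      rw [show s + N * (-(k : ℤ) - 1) + N = s + N * -k by ring] at this
      rw [this] at ih
      rw [Int.even_sub_one]
      exact ⟨fun h => neg_injective (by rw [ih.2 h]), fun h => by
        rw [← ih.1 (not_not.1 h), neg_neg]⟩
  refine ⟨θ, strictMono_int_of_lt_succ fun s => ?_, fun s m => ?_, fun s => ?_⟩
  · obtain ⟨r, q, h1, h2, rfl⟩ := hrep s
    obtain ⟨a1, a2, a3, a4, a5⟩ := H r h1 h2
    rcases lt_or_ge (r + 1) N with h | h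
    · rw [show s₀ + r + N * q + 1 = s₀ + (r + 1) + N * q by ring, hθ r q h1 h2,
        hθ (r + 1) q (by omega) h]
      obtain ⟨b1, b2, b3, b4, b5⟩ := H (r + 1) (by omega) h
      have hs := hsucc (s₀ + r)
      rw [show s₀ + r + 1 = s₀ + (r + 1) by ring, a2, b2] at hs
      have hs' : 0 < ρ r * ρ (r + 1) * sin (ψ (r + 1) - ψ r) := by
        rw [sin_sub]; simp only [planeDet] at hs; linarith
      have hsin : 0 < sin (ψ (r + 1) - ψ r) := pos_of_mul_pos_right hs' (by positivity)
      by_contra hle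
      exact absurd hsin (sin_nonpos_of_nonpos_of_neg_pi_le (by linarith) (by linarith)).not_gt
    · obtain rfl : r = N - 1 := by omega
      rw [show s₀ + ((N : ℤ) - 1) + N * q + 1 = s₀ + 0 + N * (q + 1) by ring, hθ _ q h1 h2,
        hθ 0 (q + 1) le_rfl (by omega), (H 0 le_rfl (by omega)).2.2.2.2 rfl]
      push_cast
      linarith
  · obtain ⟨r, q, h1, h2, rfl⟩ := hrep s
    rw [show s₀ + r + N * q + N * m = s₀ + r + N * (q + m) by ring, hθ r _ h1 h2, hθ r _ h1 h2]
    push_cast; ring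
  · obtain ⟨r, q, h1, h2, rfl⟩ := hrep s
    obtain ⟨a1, a2, -⟩ := H r h1 h2
    refine ⟨ρ r, a1, ?_⟩
    rw [hθ r q h1 h2]
    by_cases hq : Even q
    · rw [(hwmul _ q).1 hq, a2]
      obtain ⟨k, rfl⟩ := hq
      have e : ψ r + π * ((k + k : ℤ) : ℝ) = ψ r + k * (2 * π) := by push_cast; ring
      rw [e, sin_add_int_mul_two_pi, cos_add_int_mul_two_pi]
    · rw [(hwmul _ q).2 hq, a2]
      obtain ⟨k, rfl⟩ := Int.not_even_iff_odd.1 hq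
      have e : ψ r + π * ((2 * k + 1 : ℤ) : ℝ) = ψ r + π + k * (2 * π) := by push_cast; ring
      rw [e, sin_add_int_mul_two_pi, cos_add_int_mul_two_pi, sin_add_pi, cos_add_pi]
      ext <;> simp

namespace AllowableSequence.IsLabelling

variable {n t : ℕ} {A : AllowableSequence (2 * n)} {G : PeriodicSignature t n}
  {κ : ℤ → ℕ → Fin (2 * n)}

open Real in
/-- Vectors whose sums have prescribed directions realize the sequence. -/
theorem isGeometricallyRealizable (hl : A.IsLabelling G κ) (ht : 0 < t) {V : ℤ → ℕ → ℝ × ℝ}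
    {w : ℤ → ℝ × ℝ} (hV : ∀ a i, V (a + t) i = -V a i) (hanti : ∀ s, w (s + 2 * n) = -w s)
    (hsucc : ∀ s, 0 < planeDet (w s) (w (s + 1))) (s₀ : ℤ)
    (h₀ : ∀ s, s₀ < s → s < s₀ + 2 * n → 0 < planeDet (w s₀) (w s))
    (same : ∀ a i j, i < j → j < G.size a →
      ∃ c : ℝ, 0 < c ∧ V a i - V a j = c • w (G.crossTime a))
    (conj : ∀ a i j, i < G.size a → j < G.size a →
      ∃ c : ℝ, 0 < c ∧ V a i + V a j = c • w (G.crossTime a))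
    (cross : ∀ (a : ℤ) i (b : ℤ) j, a < b → b < a + t → i < G.size a → j < G.size b →
      ∃ c : ℝ, 0 < c ∧ V a i + V b j = c • w (G.swapTime a i b j)) :
    A.IsGeometricallyRealizable := by
  have hn := G.pos_of_pos ht
  obtain ⟨θ, hθ, hθN, hθw⟩ := exists_angles (N := 2 * n) (by omega)
    (by push_cast; exact hanti) hsucc s₀ (by push_cast; exact h₀)
  push_cast at hθN
  have hVper : ∀ a m i, V (a + 2 * t * m) i = V a i := by
    intro a m i
    have step : ∀ b, V (b + 2 * t) i = V b i := fun b => by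
      rw [two_mul, ← add_assoc, hV, hV, neg_neg]
    induction m using Int.induction_on with
    | zero => simp
    | succ k ih => rw [← ih, ← step (a + 2 * t * k)]; congr 1; ring
    | pred k ih => rw [← ih, ← step]; congr 1; ring
  have hVsub : ∀ a i, V (a - t) i = -V a i := fun a i => by
    rw [← neg_neg (V (a - t) i), ← hV, sub_add_cancel]
  have hκper : ∀ a m i, κ (a + 2 * t * m) i = κ a i := fun a m i => by
    have := hl.isModel.periodic 0 a m i
    rw [hl.perm_zero] at this
    ext
    simpa using this
  choose ca ci hc hκ using hl.surj
  let v : Fin (2 * n) → ℝ × ℝ := fun p => V (ca p) (ci p)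
  have hv : ∀ a i, i < G.size a → v (κ a i) = V a i := by
    intro a i hi
    obtain ⟨h1, m, h2⟩ := hl.injective ht (hc _) hi (hκ (κ a i))
    simp only [v]
    have e : a = ca (κ a i) + 2 * t * m := by linarith
    have := hVper (ca (κ a i)) m i
    rw [← e] at this
    rw [h1, this]
  -- `Data p q s` couples the combinatorial and the geometric fact: `p` is left of `q` for a
  -- halfperiod from move `s`, and `v p - v q` has the direction of that move.
  let Data : Fin (2 * n) → Fin (2 * n) → ℤ → Prop := fun p q s =>
    (∀ s', s ≤ s' → s' < s + 2 * n → A.perm s' p < A.perm s' q) ∧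
      ∃ c : ℝ, 0 < c ∧ v p - v q = c • w s
  have hswap : ∀ p q s, Data p q s → Data q p (s + 2 * n) := by
    rintro p q s ⟨h1, c, hc, h2⟩
    refine ⟨fun s' e1 e2 => ?_, c, hc, by rw [hanti, smul_neg, ← h2, neg_sub]⟩
    have := h1 (s' - 2 * n) (by omega) (by omega)
    rwa [show s' = s' - 2 * n + 2 * n by ring, hl.perm_add, hl.perm_add, Fin.rev_lt_rev]
  have hswap' : ∀ p q s, Data p q s → Data q p (s - 2 * n) := by
    rintro p q s ⟨h1, c, hc, h2⟩
    refine ⟨fun s' e1 e2 => ?_, c, hc, ?_⟩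
    · have := h1 (s' + 2 * n) (by omega) (by omega)
      rwa [hl.perm_add, hl.perm_add, Fin.rev_lt_rev] at this
    · have := hanti (s - 2 * n)
      rw [sub_add_cancel] at this
      rw [← neg_sub, h2, this, smul_neg, neg_neg]
  have hex : ∀ p q, p ≠ q → ∃ s, Data p q s := by
    intro p q hpq
    have hne : ¬ (ci p = ci q ∧ (2 * t : ℤ) ∣ ca q - ca p) := by
      rintro ⟨h1, m, h2⟩
      apply hpq
      rw [← hκ p, ← hκ q, ← h1, show ca q = ca p + 2 * t * m by linarith, hκper]
    suffices ∃ s : ℤ, (∀ s', s ≤ s' → s' < s + 2 * n →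
        (A.perm s' (κ (ca p) (ci p)) : ℤ) < A.perm s' (κ (ca q) (ci q))) ∧
        ∃ c : ℝ, 0 < c ∧ V (ca p) (ci p) - V (ca q) (ci q) = c • w s by
      obtain ⟨s, h1, h2⟩ := this
      refine ⟨s, fun s' e1 e2 => ?_, h2⟩
      have := h1 s' e1 e2
      rw [hκ, hκ] at this
      rw [Fin.lt_def]; omega
    refine G.pair_cases ht (motive := fun a i b j s =>
      (∀ s', s ≤ s' → s' < s + 2 * n → (A.perm s' (κ a i) : ℤ) < A.perm s' (κ b j)) ∧
      ∃ c : ℝ, 0 < c ∧ V a i - V b j = c • w s) ?_ ?_ ?_ ?_ ?_ (hc p) (hc q) hne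
    · rintro a i b j s ⟨h1, c, hc, h2⟩
      refine ⟨fun s' e1 e2 => ?_, c, hc, by rw [hanti, smul_neg, ← h2, neg_sub]⟩
      have := h1 (s' - 2 * n) (by omega) (by omega)
      rw [show s' = s' - 2 * n + 2 * n by ring, hl.perm_add, hl.perm_add, Fin.val_rev, Fin.val_rev]
      omega
    · rintro a i b j s m ⟨h1, h2⟩
      rw [hVper] at h2
      exact ⟨fun s' e1 e2 => by rw [← hκper b m j]; exact h1 s' e1 e2, h2⟩
    · exact fun a i j hij hj => ⟨fun s e1 e2 => hl.isModel.lt_same hij hj e1 e2, same a i j hij hj⟩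
    · refine fun a i j hi hj => ⟨fun s e1 e2 => hl.isModel.lt_conj hi hj e1 e2, ?_⟩
      rw [hVsub, sub_neg_eq_add]; exact conj a i j hi hj
    · refine fun a i b j hab hba hi hj =>
        ⟨fun s e1 e2 => hl.isModel.lt_cross hab hba hi hj e1 e2, ?_⟩
      rw [hVsub, sub_neg_eq_add]; exact cross a i b j hab hba hi hj
  -- The difference of projections is a sine vanishing exactly at `θ s` and its translates by
  -- multiples of `π`; both the set of critical angles and the order between them are read off from
  -- it.
  have hproj : ∀ p q s, Data p q s → ∃ c : ℝ, 0 < c ∧ ∀ φ,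
      projAt φ !₂[(v p).1, (v p).2] - projAt φ !₂[(v q).1, (v q).2] = c * sin (θ s - φ) := by
    rintro p q s ⟨-, c, hc, h⟩
    obtain ⟨ρ, hρ, hw⟩ := hθw s
    refine ⟨c * ρ, by positivity, fun φ => ?_⟩
    rw [hw] at h
    have h1 := congrArg Prod.fst h
    have h2 := congrArg Prod.snd h
    simp only [Prod.fst_sub, Prod.snd_sub, Prod.smul_mk, smul_eq_mul] at h1 h2
    simp only [projAt, Matrix.cons_val_zero, Matrix.cons_val_one]
    rw [sin_sub]
    linear_combination cos φ * h1 + sin φ * h2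
  have hdata : ∀ p q, p ≠ q → ∀ s : ℤ, ∃ s₁, s₁ ≤ s ∧ s < s₁ + 2 * n ∧
      (Data p q s₁ ∨ Data q p s₁) := by
    intro p q hpq s
    obtain ⟨s₁, h⟩ := hex p q hpq
    have key : ∀ m : ℤ, Data p q (s₁ + 2 * n * m) ∨ Data q p (s₁ + 2 * n * m) := by
      intro m
      induction m using Int.induction_on with
      | zero => left; simpa using h
      | succ k ih =>
        rw [show s₁ + 2 * n * ((k : ℤ) + 1) = s₁ + 2 * n * k + 2 * n by ring]
        exact ih.symm.imp (hswap _ _ _) (hswap _ _ _)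
      | pred k ih =>
        rw [show s₁ + 2 * n * (-(k : ℤ) - 1) = s₁ + 2 * n * -k - 2 * n by ring]
        exact ih.symm.imp (hswap' _ _ _) (hswap' _ _ _)
    have h1 := Int.emod_nonneg (s - s₁) (show (2 * n : ℤ) ≠ 0 by omega)
    have h2 := Int.emod_lt_of_pos (s - s₁) (show (0 : ℤ) < 2 * n by omega)
    have h3 := Int.emod_add_mul_ediv (s - s₁) (2 * n)
    exact ⟨s₁ + 2 * n * ((s - s₁) / (2 * n)), by linarith, by linarith, key _⟩
  have hpass : ∀ p q s, Data p q s → A.Passes s p q := by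
    rintro p q s ⟨h, -⟩
    refine ⟨?_, h s le_rfl (by omega)⟩
    have := h (s - 1 + 2 * n) (by omega) (by omega)
    rwa [hl.perm_add, hl.perm_add, Fin.rev_lt_rev] at this
  have hhalf : (A.halfperiod : ℤ) = 2 * n := by rw [hl.halfperiod]; push_cast; rfl
  refine ⟨fun p => !₂[(v p).1, (v p).2], fun p q hpq => ?_, θ, hθ, ?_, ?_⟩
  · by_contra hne
    obtain ⟨s, hs⟩ := hex p q hne
    obtain ⟨c, hc, h⟩ := hproj p q s hs
    have := h (θ s - π / 2)
    simp only at hpq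
    rw [hpq, sub_self, sub_sub_cancel, sin_pi_div_two] at this
    linarith
  · ext φ
    constructor
    · rintro ⟨i, rfl⟩
      obtain ⟨x, hx⟩ := (A.isMove i).nonempty
      have hxlt := (A.isMove i).lt x hx
      have hne : (A.perm (i - 1)).symm x.1 ≠ (A.perm (i - 1)).symm x.2 := fun e =>
        hxlt.ne ((A.perm (i - 1)).symm.injective e)
      have htog := (A.together_iff_passes (s := i) hne).1 ⟨x, hx, by simp [hxlt.le], by
        simp [hxlt.le]⟩
      refine ⟨_, _, hne, ?_⟩
      obtain ⟨s, hs⟩ := hex _ _ hne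
      obtain ⟨c, hc, h⟩ := hproj _ _ s hs
      obtain ⟨m, hm⟩ := dvd_of_passes_or htog (Or.inl (hpass _ _ _ hs))
      rw [hhalf] at hm
      have hi : i = s + 2 * n * m := by linarith
      have := h (θ i)
      rw [hi, hθN, show θ s - (θ s + π * m) = ((-m : ℤ) : ℝ) * π by push_cast; ring,
        sin_int_mul_pi, mul_zero, sub_eq_zero] at this
      rw [hi, hθN]
      exact this
    · rintro ⟨p, q, hpq, he⟩
      obtain ⟨s, hs⟩ := hex p q hpq
      obtain ⟨c, hc, h⟩ := hproj p q s hs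
      have h1 := h φ
      rw [he, sub_self, eq_comm, mul_eq_zero, or_iff_right hc.ne', sin_eq_zero_iff] at h1
      obtain ⟨m, hm⟩ := h1
      refine ⟨s + 2 * n * (-m), ?_⟩
      rw [hθN]
      push_cast
      linarith
  · intro i φ h1 h2 p q
    have key : ∀ p q s, Data p q s → s ≤ i → i < s + 2 * n → A.perm i p < A.perm i q ∧
        projAt φ !₂[(v p).1, (v p).2] < projAt φ !₂[(v q).1, (v q).2] := by
      intro p q s hs e1 e2
      obtain ⟨c, hc, h⟩ := hproj p q s hs
      refine ⟨hs.1 i e1 e2, ?_⟩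
      have l1 := hθ.monotone e1
      have l2 := hθ.monotone (show i + 1 ≤ s + 2 * n * 1 by omega)
      rw [hθN] at l2
      push_cast at l2
      have hneg : sin (θ s - φ) < 0 := sin_neg_of_neg_of_neg_pi_lt (by linarith) (by linarith)
      have := h φ
      have := mul_neg_of_pos_of_neg hc hneg
      linarith
    by_cases hpq : p = q
    · subst hpq; simp
    · obtain ⟨s, e1, e2, hs | hs⟩ := hdata p q hpq i
      · have := key _ _ s hs e1 e2
        exact iff_of_true this.1 this.2
      · have := key _ _ s hs e1 e2
        exact iff_of_false this.1.not_gt this.2.not_gt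

end AllowableSequence.IsLabelling

/-! ### The realizable cases. -/

namespace AllowableSequence.IsLabelling

variable {n t : ℕ} {A : AllowableSequence (2 * n)} {G : PeriodicSignature t n}
  {κ : ℤ → ℕ → Fin (2 * n)}

open Real in
/-- The sequence with central signature `(1, …, 1)` is realized by a regular polygon. -/
theorem isGeometricallyRealizable_of_size_eq_one (hl : A.IsLabelling G κ) (ht : 0 < t)
    (h1 : ∀ a, G.size a = 1) : A.IsGeometricallyRealizable := by
  have hn := G.pos_of_pos ht
  have hoff : ∀ a, G.offset a = a := by
    intro a
    induction a using Int.induction_on with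
    | zero => exact G.offset_zero
    | succ k ih => rw [G.offset_succ, ih, h1]; simp
    | pred k ih =>
      have := G.offset_succ (-(k : ℤ) - 1)
      rw [sub_add_cancel, ih, h1] at this
      push_cast at this
      omega
  have hnt : (n : ℤ) = t := by
    have := G.offset_add 0
    rw [hoff, hoff] at this; omega
  have hnR : (0 : ℝ) < n := by exact_mod_cast hn
  let w : ℤ → ℝ × ℝ := fun s => (cos (π * s / (2 * n)), sin (π * s / (2 * n)))
  have hanti : ∀ s, w (s + 2 * n) = -w s := by
    intro s
    have : π * ((s + 2 * n : ℤ) : ℝ) / (2 * n) = π * s / (2 * n) + π := by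
      push_cast; field_simp
    simp only [w, this, cos_add_pi, sin_add_pi, Prod.neg_mk]
  have hdet : ∀ s s' : ℤ, s < s' → s' < s + 2 * n → 0 < planeDet (w s) (w s') := by
    intro s s' h1 h2
    have e : planeDet (w s) (w s') = sin (π * s' / (2 * n) - π * s / (2 * n)) := by
      rw [sin_sub]; simp only [planeDet, w]; ring
    have h1' : (s : ℝ) < s' := by exact_mod_cast h1
    have h2' : (s' : ℝ) < s + 2 * n := by exact_mod_cast h2
    rw [e, show π * s' / (2 * n) - π * s / (2 * n) = π * ((s' - s) / (2 * n)) by ring]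
    apply sin_pos_of_pos_of_lt_pi
    · have : 0 < (s' - s : ℝ) := by linarith
      positivity
    · have : (s' - s : ℝ) / (2 * n) < 1 := by rw [div_lt_one (by positivity)]; linarith
      nlinarith [pi_pos]
  refine hl.isGeometricallyRealizable ht (V := fun a _ => w (G.crossTime a)) (w := w)
    (fun a i => by simp only [G.crossTime_add, hanti]) hanti
    (fun s => hdet _ _ (by omega) (by omega)) 0 (hdet 0) ?_ ?_ ?_
  · intro a i j hij hj
    rw [h1] at hj; omega
  · intro a i j _ _
    exact ⟨2, by norm_num, (two_smul ℝ _).symm⟩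
  · intro a i b j hab hba hi hj
    rw [h1] at hi hj
    obtain rfl : i = 0 := by omega
    obtain rfl : j = 0 := by omega
    have hab' : (a : ℝ) < b := by exact_mod_cast hab
    have hba' : (b : ℝ) < a + n := by rw [← hnt] at hba; exact_mod_cast hba
    -- The sum of unit vectors at angles `μ - δ` and `μ + δ` is `2 * cos δ` times the unit vector at
    -- `μ`. Here `crossTime a = 2 * a + 1`, and the swap time is the mean of the two crossing times.
    refine ⟨2 * cos (π * ((b - a) / (2 * n))), ?_, ?_⟩
    · have e1 : (b - a : ℝ) / (2 * n) < 1 / 2 := by rw [div_lt_iff₀ (by positivity)]; linarith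
      have e2 : 0 < (b - a : ℝ) / (2 * n) := div_pos (by linarith) (by positivity)
      have : 0 < cos (π * ((b - a) / (2 * n))) :=
        cos_pos_of_mem_Ioo ⟨by nlinarith [pi_pos], by nlinarith [pi_pos]⟩
      linarith
    · have f1 : π * (G.crossTime a : ℝ) / (2 * n) =
          π * (a + b + 1) / (2 * n) - π * ((b - a) / (2 * n)) := by
        simp only [PeriodicSignature.crossTime, hoff, h1]; push_cast; field_simp; ring
      have f2 : π * (G.crossTime b : ℝ) / (2 * n) =
          π * (a + b + 1) / (2 * n) + π * ((b - a) / (2 * n)) := by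
        simp only [PeriodicSignature.crossTime, hoff, h1]; push_cast; field_simp; ring
      have f3 : π * (G.swapTime a 0 b 0 : ℝ) / (2 * n) = π * (a + b + 1) / (2 * n) := by
        simp only [PeriodicSignature.swapTime, hoff, h1]; push_cast; ring
      simp only [w, f1, f2, f3]
      ext
      · simp only [Prod.fst_add, Prod.smul_fst, smul_eq_mul, cos_add, cos_sub]; ring
      · simp only [Prod.snd_add, Prod.smul_snd, smul_eq_mul, sin_add, sin_sub]; ring

open Real in
/-- The direction of the `a`-th of `t` equally spaced lines. -/
noncomputable def fanDir (t : ℕ) (a : ℤ) : ℝ × ℝ := (cos (π * a / t), sin (π * a / t))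

open Real in
lemma fanDir_add (ht : 0 < t) (a : ℤ) : fanDir t (a + t) = -fanDir t a := by
  have ht' : (0 : ℝ) < t := by exact_mod_cast ht
  have : π * ((a + t : ℤ) : ℝ) / t = π * a / t + π := by push_cast; field_simp
  simp only [fanDir, this, cos_add_pi, sin_add_pi, Prod.neg_mk]

open Real in
lemma planeDet_fanDir (t : ℕ) (a b : ℤ) :
    planeDet (fanDir t a) (fanDir t b) = sin (π * ((b - a) / t)) := by
  rw [show π * ((b - a : ℝ) / t) = π * b / t - π * a / t by ring, sin_sub]
  simp only [planeDet, fanDir]; ring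

open Real in
lemma planeDet_fanDir_pos {a b : ℤ} (h1 : a < b) (h2 : b < a + t) :
    0 < planeDet (fanDir t a) (fanDir t b) := by
  have ht : (0 : ℝ) < t := by exact_mod_cast (show (0 : ℤ) < t by omega)
  have h1' : (a : ℝ) < b := by exact_mod_cast h1
  have h2' : (b : ℝ) < a + t := by exact_mod_cast h2
  rw [planeDet_fanDir]
  apply sin_pos_of_pos_of_lt_pi
  · have : 0 < (b - a : ℝ) := by linarith
    positivity
  · have : (b - a : ℝ) / t < 1 := by rw [div_lt_one ht]; linarith
    nlinarith [pi_pos]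

open Real in
-- This relation rewrites a sum over the classes `a` and `a + 2` in the basis used between two
-- consecutive lines, on either side of line `a + 1`.
lemma fanDir_add_two_of_three (a : ℤ) : fanDir 3 (a + 2) = fanDir 3 (a + 1) - fanDir 3 a := by
  have e1 : π * ((a + 2 : ℤ) : ℝ) / (3 : ℕ) = π * a / 3 + π / 3 + π / 3 := by push_cast; ring
  have e2 : π * ((a + 1 : ℤ) : ℝ) / (3 : ℕ) = π * a / 3 + π / 3 := by push_cast; ring
  have e3 : π * (a : ℝ) / (3 : ℕ) = π * a / 3 := by push_cast; ring
  simp only [fanDir, e1, e2, e3]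
  generalize π * a / 3 = x
  have hs : sin (π / 3) ^ 2 = 3 / 4 := by
    rw [sin_pi_div_three, div_pow, sq_sqrt (by norm_num)]; norm_num
  ext
  · simp only [Prod.fst_sub, cos_add, sin_add, cos_pi_div_three]
    linear_combination -cos x * hs
  · simp only [Prod.snd_sub, cos_add, sin_add, cos_pi_div_three]
    linear_combination -sin x * hs

/-- `v` is the direction at time `s` of the fan given by the slopes `g`. -/
def IsFanDir (G : PeriodicSignature t n) (g : ℤ → ℤ → ℝ) (s : ℤ) (v : ℝ × ℝ) : Prop :=
  (∃ c, G.crossTime c = s ∧ v = fanDir t c) ∨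
    ∃ c, G.crossTime c < s ∧ s < G.crossTime (c + 1) ∧
      v = g c (G.crossTime (c + 1) - s) • fanDir t c + fanDir t (c + 1)

lemma IsFanDir.eq {g : ℤ → ℤ → ℝ} {s : ℤ} {v v' : ℝ × ℝ} (h : IsFanDir G g s v)
    (h' : IsFanDir G g s v') : v = v' := by
  have key : ∀ c c', G.crossTime c ≤ s → s < G.crossTime (c + 1) → G.crossTime c' ≤ s →
      s < G.crossTime (c' + 1) → c = c' := by
    intro c c' h1 h2 h3 h4
    have := G.crossTime_strictMono.lt_iff_lt.1 (h1.trans_lt h4)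
    have := G.crossTime_strictMono.lt_iff_lt.1 (h3.trans_lt h2)
    omega
  have hs : ∀ c, G.crossTime c < G.crossTime (c + 1) := fun c => G.crossTime_strictMono (by omega)
  rcases h with ⟨c, h1, rfl⟩ | ⟨c, h1, h2, rfl⟩ <;>
    rcases h' with ⟨c', h1', rfl⟩ | ⟨c', h1', h2', rfl⟩
  · have := hs c; have := hs c'
    rw [key c c' (by omega) (by omega) (by omega) (by omega)]
  · have := hs c; have := hs c'
    obtain rfl := key c c' (by omega) (by omega) (by omega) (by omega)
    omega
  · have := hs c; have := hs c'
    obtain rfl := key c c' (by omega) (by omega) (by omega) (by omega)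
    omega
  · rw [key c c' (by omega) (by omega) (by omega) (by omega)]

/-- A realization with the classes on `t` equally spaced lines: `R a i` is the distance of the `i`-th
point of class `a` from the center. -/
theorem isGeometricallyRealizable_of_fan (hl : A.IsLabelling G κ) (ht : 2 ≤ t) {R : ℤ → ℕ → ℝ}
    {g : ℤ → ℤ → ℝ} (hR : ∀ a i, R (a + t) i = R a i) (hg : ∀ a, g (a + t) = g a)
    (hRpos : ∀ a i, i < G.size a → 0 < R a i)
    (hRanti : ∀ a i j, i < j → j < G.size a → R a j < R a i) (hg0 : ∀ a, 0 ≤ g a 0)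
    (hgmono : ∀ (a y y' : ℤ), 0 ≤ y → y < y' → y' < G.size a + G.size (a + 1) → g a y < g a y')
    (adj : ∀ a i j, i < G.size a → j < G.size (a + 1) →
      R a i = R (a + 1) j * g a (G.size a - i + j))
    (far : ∀ (a : ℤ) i (b : ℤ) j, a + 1 < b → b < a + t → i < G.size a → j < G.size b →
      ∃ (c : ℝ) (v : ℝ × ℝ), 0 < c ∧ IsFanDir G g (G.swapTime a i b j) v ∧
        R a i • fanDir t a + R b j • fanDir t b = c • v) :
    A.IsGeometricallyRealizable := by
  have ht0 : 0 < t := by omega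
  have hex : ∀ s, ∃ v, IsFanDir G g s v := by
    intro s
    obtain ⟨c, c1, c2⟩ := G.exists_crossTime_le_lt ht0 s
    rcases eq_or_lt_of_le c1 with c1 | c1
    · exact ⟨_, Or.inl ⟨c, c1, rfl⟩⟩
    · exact ⟨_, Or.inr ⟨c, c1, c2, rfl⟩⟩
  choose w hw using hex
  have hgpos : ∀ a y : ℤ, 0 < y → y < G.size a + G.size (a + 1) → 0 < g a y := fun a y h1 h2 =>
    (hg0 a).trans_lt (hgmono a 0 y le_rfl h1 h2)
  have hwT : ∀ c, w (G.crossTime c) = fanDir t c := fun c => (hw _).eq (Or.inl ⟨c, rfl, rfl⟩)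
  have hwG : ∀ c s, G.crossTime c < s → s < G.crossTime (c + 1) →
      w s = g c (G.crossTime (c + 1) - s) • fanDir t c + fanDir t (c + 1) :=
    fun c s h1 h2 => (hw s).eq (Or.inr ⟨c, h1, h2, rfl⟩)
  have hdet1 : ∀ c, 0 < planeDet (fanDir t c) (fanDir t (c + 1)) := fun c =>
    planeDet_fanDir_pos (by omega) (by omega)
  have hself : ∀ u : ℝ × ℝ, planeDet u u = 0 := fun u => by simp only [planeDet]; ring
  have hlin : ∀ (x : ℝ) (u v z : ℝ × ℝ), planeDet u (x • v + z) = x * planeDet u v + planeDet u z :=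
    fun x u v z => by
      simp only [planeDet, Prod.fst_add, Prod.snd_add, Prod.smul_fst, Prod.smul_snd, smul_eq_mul]
      ring
  have hlin' : ∀ (x : ℝ) (u v z : ℝ × ℝ), planeDet (x • v + z) u = x * planeDet v u + planeDet z u :=
    fun x u v z => by
      simp only [planeDet, Prod.fst_add, Prod.snd_add, Prod.smul_fst, Prod.smul_snd, smul_eq_mul]
      ring
  have hswap : ∀ u v : ℝ × ℝ, planeDet u v = -planeDet v u := fun u v => by
    simp only [planeDet]; ring
  refine hl.isGeometricallyRealizable ht0 (V := fun a i => R a i • fanDir t a) (w := w)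
    (fun a i => by rw [hR, fanDir_add ht0, smul_neg]) (fun s => ?_) (fun s => ?_) (G.crossTime 0)
    (fun s h1 h2 => ?_) ?_ ?_ ?_
  · refine (hw _).eq ?_
    rcases hw s with ⟨c, h1, h2⟩ | ⟨c, h1, h2, h3⟩
    · exact Or.inl ⟨c + t, by rw [G.crossTime_add, h1], by rw [h2, fanDir_add ht0]⟩
    · have hc := G.crossTime_add (c + 1)
      rw [show c + 1 + (t : ℤ) = c + t + 1 by ring] at hc
      refine Or.inr ⟨c + t, by rw [G.crossTime_add]; omega, by omega, ?_⟩
      rw [h3, hc, hg, fanDir_add ht0, show c + (t : ℤ) + 1 = c + 1 + t by ring, fanDir_add ht0,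
        add_sub_add_right_eq_sub, smul_neg, neg_add]
  -- The argument of `g c` counts the moves left before the next crossing. It decreases with time,
  -- so monotonicity of `g c` turns the direction from line `c` towards line `c + 1`.
  · obtain ⟨c, c1, c2⟩ := G.exists_crossTime_le_lt ht0 s
    have hc := G.crossTime_succ c
    have s1 := G.size_pos c
    have s2 := G.size_pos (c + 1)
    have hd := hdet1 c
    rcases eq_or_lt_of_le c1 with rfl | c1
    · rw [hwT, hwG c _ (by omega) (by omega), hlin, hself, mul_zero, zero_add]
      exact hd
    · rw [hwG c s c1 c2]
      rcases eq_or_lt_of_le (show s + 1 ≤ G.crossTime (c + 1) by omega) with h | h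
      · rw [h, hwT, hlin', hself, add_zero]
        exact mul_pos (hgpos _ _ (by omega) (by omega)) hd
      · rw [hwG c (s + 1) (by omega) h, hlin, hlin', hlin', hself, hself,
          hswap (fanDir t (c + 1)) (fanDir t c)]
        have := hgmono c (G.crossTime (c + 1) - (s + 1)) (G.crossTime (c + 1) - s) (by omega)
          (by omega) (by omega)
        nlinarith
  · rw [← G.crossTime_add] at h2
    obtain ⟨c, c1, c2⟩ := G.exists_crossTime_le_lt ht0 s
    have hc := G.crossTime_succ c
    have hc0 : 0 < c + 1 := G.crossTime_strictMono.lt_iff_lt.1 (by omega)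
    have hct : c < 0 + t := G.crossTime_strictMono.lt_iff_lt.1 (by omega)
    have hpos : ∀ c : ℤ, 0 < c → c < t → 0 < planeDet (fanDir t 0) (fanDir t c) := fun c h1 h2 =>
      planeDet_fanDir_pos h1 (by omega)
    rcases eq_or_lt_of_le c1 with rfl | c1
    · rw [hwT, hwT]
      exact hpos c (G.crossTime_strictMono.lt_iff_lt.1 h1) (by omega)
    · rw [hwT, hwG c s c1 c2, hlin]
      rcases eq_or_lt_of_le (show 0 ≤ c by omega) with rfl | hc'
      · rw [hself, mul_zero, zero_add]; exact hdet1 0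
      · have e1 := mul_pos (hgpos c (G.crossTime (c + 1) - s) (by omega) (by omega))
          (hpos c hc' (by omega))
        rcases eq_or_lt_of_le (show c + 1 ≤ t by omega) with h | h
        · have := fanDir_add (t := t) ht0 0
          rw [zero_add] at this
          rw [h] at e1
          rw [h, this]
          have : planeDet (fanDir t 0) (-fanDir t 0) = 0 := by simp [planeDet]; ring
          linarith
        · have := hpos (c + 1) (by omega) h
          linarith
  · intro a i j hij hj
    exact ⟨R a i - R a j, sub_pos.2 (hRanti a i j hij hj), by rw [hwT, sub_smul]⟩
  · intro a i j hi hj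
    exact ⟨R a i + R a j, add_pos (hRpos a i hi) (hRpos a j hj), by rw [hwT, add_smul]⟩
  · intro a i b j hab hba hi hj
    rcases eq_or_lt_of_le (show a + 1 ≤ b by omega) with rfl | hab'
    · refine ⟨R (a + 1) j, hRpos _ _ hj, ?_⟩
      rw [hwG a _ (G.crossTime_lt_swapTime hab hj) (G.swapTime_lt_crossTime hab hi),
        show G.crossTime (a + 1) - G.swapTime a i (a + 1) j = G.size a - i + j by
          unfold PeriodicSignature.crossTime PeriodicSignature.swapTime
          rw [G.offset_succ a]; ring, adj a i j hi hj, smul_add, smul_smul]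
    · obtain ⟨c, v, h1, h2, h3⟩ := far a i b j hab' hba hi hj
      exact ⟨c, h1, by rw [h3, (hw _).eq h2]⟩

end AllowableSequence.IsLabelling

namespace AllowableSequence.IsLabelling

variable {n t : ℕ} {A : AllowableSequence (2 * n)} {G : PeriodicSignature t n}
  {κ : ℤ → ℕ → Fin (2 * n)}

/-- A realization with two classes, on orthogonal lines. -/
theorem isGeometricallyRealizable_of_eq_two {G : PeriodicSignature 2 n} (hl : A.IsLabelling G κ) :
    A.IsGeometricallyRealizable := by
  -- With a geometric progression the ratio of two distances depends only on the difference of the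
  -- exponents, hence only on the swap time; two classes leave no further condition.
  refine hl.isGeometricallyRealizable_of_fan le_rfl (R := fun a i => (2 : ℝ) ^ ((G.size a : ℤ) - i))
    (g := fun a y => (2 : ℝ) ^ (y - G.size (a + 1))) ?_ ?_ ?_ ?_ ?_ ?_ ?_ ?_
  · intro a i; simp only [G.size_add]
  · intro a
    simp only [show a + ((2 : ℕ) : ℤ) + 1 = a + 1 + (2 : ℕ) by ring, G.size_add]
  · intro a i _; positivity
  · intro a i j hij _
    exact zpow_lt_zpow_right₀ (by norm_num) (by omega)
  · intro a; positivity
  · intro a y y' _ h _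
    exact zpow_lt_zpow_right₀ (by norm_num) (by omega)
  · intro a i j _ _
    rw [← zpow_add₀ (by norm_num)]
    congr 1; ring
  · intro a i b j h1 h2 _ _
    push_cast at h2; omega

/-- A realization with three classes, on lines that form equal angles. -/
theorem isGeometricallyRealizable_of_fan_three {G : PeriodicSignature 3 n} (hl : A.IsLabelling G κ)
    {R : ℤ → ℕ → ℝ} {g : ℤ → ℤ → ℝ} (hR : ∀ a i, R (a + 3) i = R a i) (hg : ∀ a, g (a + 3) = g a)
    (hRpos : ∀ a i, i < G.size a → 0 < R a i)
    (hRanti : ∀ a i j, i < j → j < G.size a → R a j < R a i) (hg0 : ∀ a, 0 ≤ g a 0)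
    (hgmono : ∀ (a y y' : ℤ), 0 ≤ y → y < y' → y' < G.size a + G.size (a + 1) → g a y < g a y')
    (adj : ∀ a i j, i < G.size a → j < G.size (a + 1) →
      R a i = R (a + 1) j * g a (G.size a - i + j))
    (far : ∀ a i j (y : ℤ), i < G.size a → j < G.size (a + 2) →
      y = (G.size a - i) - (G.size (a + 2) - j) →
      (0 < y → R a i = R (a + 2) j * (g a y + 1)) ∧ (y = 0 → R a i = R (a + 2) j) ∧
      (y < 0 → R a i < R (a + 2) j ∧
        R a i = (R (a + 2) j - R a i) * g (a + 1) (y + G.size (a + 1) + G.size (a + 2)))) :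
    A.IsGeometricallyRealizable := by
  refine hl.isGeometricallyRealizable_of_fan (by norm_num) hR hg hRpos hRanti hg0 hgmono adj ?_
  intro a i b j h1 h2 hi hj
  obtain rfl : b = a + 2 := by push_cast at h2; omega
  obtain ⟨y, hy⟩ : ∃ y : ℤ, y = (G.size a - i) - (G.size (a + 2) - j) := ⟨_, rfl⟩
  obtain ⟨f1, f2, f3⟩ := far a i j y hi hj hy
  have hs1 := G.crossTime_lt_swapTime (a := a) (b := a + 2) (i := i) (by omega) hj
  have hs2 := G.swapTime_lt_crossTime (a := a) (b := a + 2) (j := j) (by omega) hi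
  have hc := G.crossTime_succ (a + 1)
  have hf := fanDir_add_two_of_three a
  rw [show a + 1 + 1 = a + 2 by ring] at hc
  have hT : G.crossTime (a + 1) - G.swapTime a i (a + 2) j = y := by
    have e1 := G.offset_succ a
    have e2 := G.offset_succ (a + 2)
    rw [hy]
    unfold PeriodicSignature.crossTime PeriodicSignature.swapTime
    rw [show a + 1 + 1 = a + 2 by ring]
    linarith
  rcases lt_trichotomy y 0 with h | h | h
  · obtain ⟨f3, f4⟩ := f3 h
    refine ⟨R (a + 2) j - R a i, _, sub_pos.2 f3, Or.inr ⟨a + 1, by omega, ?_, rfl⟩, ?_⟩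
    · rw [show a + 1 + 1 = a + 2 by ring]; exact hs2
    · rw [show a + 1 + 1 = a + 2 by ring, show G.crossTime (a + 2) - G.swapTime a i (a + 2) j =
        y + G.size (a + 1) + G.size (a + 2) by omega, smul_add, smul_smul, ← f4, sub_smul,
        show fanDir 3 a = fanDir 3 (a + 1) - fanDir 3 (a + 2) by rw [hf]; abel, smul_sub]
      abel
  · refine ⟨R a i, fanDir 3 (a + 1), hRpos a i hi, Or.inl ⟨a + 1, by omega, rfl⟩, ?_⟩
    rw [← f2 h, hf, smul_sub]; abel
  · refine ⟨R (a + 2) j, _, hRpos _ j hj, Or.inr ⟨a, hs1, by omega, rfl⟩, ?_⟩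
    rw [hT, f1 h, hf, smul_add, smul_smul, mul_add, add_smul, mul_one, smul_sub]
    abel

/-- The points of each class are placed at distances `1, 2, …, size a`. Of two consecutive classes
one is a single point at distance 1, so a slope is an integer or the reciprocal of one, and the far
pairs compare the same integers. -/
theorem isGeometricallyRealizable_of_two_size_eq_one {G : PeriodicSignature 3 n}
    (hl : A.IsLabelling G κ)
    (h1 : ∀ a, (G.size a = 1 ∨ G.size (a + 1) = 1) ∧ (G.size a = 1 ∨ G.size (a + 2) = 1)) :
    A.IsGeometricallyRealizable := by
  have hper : ∀ a, G.size (a + 3) = G.size a := G.size_add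
  refine hl.isGeometricallyRealizable_of_fan_three (R := fun a i => (G.size a : ℝ) - i)
    (g := fun a y => if G.size (a + 1) = 1 then (y : ℝ) else 1 / (G.size (a + 1) + 1 - y))
    ?_ ?_ ?_ ?_ ?_ ?_ ?_ ?_
  · intro a i; rw [hper]
  · intro a; rw [show a + 3 + 1 = a + 1 + 3 by ring, hper]
  · intro a i hi
    exact sub_pos.2 (by exact_mod_cast hi)
  · intro a i j hij _
    have : (i : ℝ) < j := by exact_mod_cast hij
    linarith
  · intro a
    split_ifs
    · simp
    · have : (0 : ℝ) ≤ G.size (a + 1) := Nat.cast_nonneg _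
      simp only [Int.cast_zero, sub_zero]
      positivity
  · intro a y y' _ hy hy'
    have hyR : (y : ℝ) < y' := by exact_mod_cast hy
    split_ifs with h
    · exact hyR
    · rw [(h1 a).1.resolve_right h] at hy'
      have : (y' : ℝ) < 1 + G.size (a + 1) := by exact_mod_cast hy'
      exact one_div_lt_one_div_of_lt (by linarith) (by linarith)
  · intro a i j hi hj
    split_ifs with h
    · obtain rfl : j = 0 := by omega
      rw [h]; push_cast; ring
    · have ha := (h1 a).1.resolve_right h
      obtain rfl : i = 0 := by omega
      have : (0 : ℝ) < G.size (a + 1) - j := sub_pos.2 (by exact_mod_cast hj)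
      rw [ha]; push_cast
      rw [show (G.size (a + 1) : ℝ) + 1 - (1 + j) = G.size (a + 1) - j by ring]
      field_simp; ring
  · intro a i j y hi hj hy
    have e1 := (h1 a).1
    have e2 := (h1 a).2
    have e3 := (h1 (a + 1)).1
    rw [show a + 1 + 1 = a + 2 by ring] at e3 ⊢
    have hyR : (y : ℝ) = (G.size a - i) - (G.size (a + 2) - j) := by rw [hy]; push_cast; rfl
    refine ⟨fun h => ?_, fun h => ?_, fun h => ⟨?_, ?_⟩⟩
    · have ha1 : G.size (a + 1) = 1 := by omega
      have ha2 : G.size (a + 2) = 1 := by omega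
      obtain rfl : j = 0 := by omega
      rw [if_pos ha1, hyR, ha2]; push_cast; ring
    · rw [h] at hyR; push_cast at hyR; linarith
    · have : (y : ℝ) < 0 := by exact_mod_cast h
      linarith
    · have hlt : (y : ℝ) < 0 := by exact_mod_cast h
      have ha1 : G.size (a + 1) = 1 := by omega
      have ha : G.size a = 1 := by omega
      have ha2 : G.size (a + 2) ≠ 1 := by omega
      obtain rfl : i = 0 := by omega
      rw [if_neg ha2, ha, ha1]
      rw [ha] at hyR
      push_cast at hyR ⊢
      rw [show (G.size (a + 2) : ℝ) + 1 - (y + 1 + G.size (a + 2)) = -y by ring,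
        show (G.size (a + 2) : ℝ) - j - (1 - 0) = -y by linarith,
        mul_one_div_cancel (by linarith)]
      norm_num

open Real in
-- Adjacent classes are handled by a geometric progression with ratio `x`. The far pairs ask for `x
-- = x⁻¹ + 1` and `1 = (x - 1) * x`, both of which say that `x` is the golden ratio.
theorem isGeometricallyRealizable_of_size_eq_two {G : PeriodicSignature 3 n}
    (hl : A.IsLabelling G κ) (h2 : ∀ a, G.size a = 2) : A.IsGeometricallyRealizable := by
  have hφ := goldenRatio_pos
  have hsq := goldenRatio_sq
  refine hl.isGeometricallyRealizable_of_fan_three (R := fun _ i => goldenRatio ^ (1 - i : ℤ))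
    (g := fun _ y => goldenRatio ^ (y - 2)) (fun _ _ => rfl) (fun _ => rfl) ?_ ?_ ?_ ?_ ?_ ?_
  · intro a i _; positivity
  · intro a i j hij _
    exact zpow_lt_zpow_right₀ one_lt_goldenRatio (by omega)
  · intro a; positivity
  · intro a y y' _ h _
    exact zpow_lt_zpow_right₀ one_lt_goldenRatio (by omega)
  · intro a i j _ _
    rw [← zpow_add₀ hφ.ne', h2]
    congr 1; push_cast; ring
  · intro a i j y hi hj hy
    rw [h2] at hi hj
    simp only [h2] at hy ⊢
    refine ⟨fun h => ?_, fun h => ?_, fun h => ?_⟩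
    · obtain ⟨rfl, rfl⟩ : i = 0 ∧ j = 1 := by omega
      rw [hy]
      norm_num only
      rw [zpow_one, zpow_neg_one, zpow_zero, one_mul, inv_goldenRatio]
      linarith [goldenRatio_add_goldenConj]
    · obtain rfl : i = j := by omega
      rfl
    · obtain ⟨rfl, rfl⟩ : i = 1 ∧ j = 0 := by omega
      rw [hy]
      norm_num
      refine ⟨one_lt_goldenRatio, ?_⟩
      linarith

end AllowableSequence.IsLabelling

/-! ### From a realization to parallel vectors. -/

/-- Vectors `V a i` that behave like the differences of the opposite points of a centrally symmetric
allowable sequence modelled by `G`, in a realization of this sequence. -/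
structure PeriodicSignature.IsConfiguration {t n : ℕ} (G : PeriodicSignature t n)
    (V : ℤ → ℕ → ℝ × ℝ) : Prop where
  anti : ∀ a i, V (a + t) i = -V a i
  same : ∀ a i j, i < j → j < G.size a → ∃ r : ℝ, 1 < r ∧ V a i = r • V a j
  pos : ∀ (a b : ℤ) i j, a < b → b < a + t → i < G.size a → j < G.size b →
    0 < planeDet (V a i) (V b j)
  cross : ∀ (c : ℤ) k (a : ℤ) i (b : ℤ) j, k < G.size c → a < b → b < a + t → i < G.size a →
    j < G.size b → G.crossTime c = G.swapTime a i b j → planeDet (V c k) (V a i + V b j) = 0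
  swap : ∀ (a : ℤ) i (b : ℤ) j (a' : ℤ) i' (b' : ℤ) j', a < b → b < a + t → i < G.size a →
    j < G.size b → a' < b' → b' < a' + t → i' < G.size a' → j' < G.size b' →
    G.swapTime a i b j = G.swapTime a' i' b' j' →
    planeDet (V a i + V b j) (V a' i' + V b' j') = 0

namespace AllowableSequence

/-- The projection of the vector `v` on the line with direction `(cos φ, sin φ)`. -/
noncomputable def vecProj (φ : ℝ) (v : ℝ × ℝ) : ℝ := v.1 * Real.cos φ + v.2 * Real.sin φ

lemma vecProj_add (φ : ℝ) (u v : ℝ × ℝ) : vecProj φ (u + v) = vecProj φ u + vecProj φ v := by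
  simp only [vecProj, Prod.fst_add, Prod.snd_add]; ring

lemma planeDet_eq_zero_of_vecProj {φ : ℝ} {u v : ℝ × ℝ} (hu : vecProj φ u = 0)
    (hv : vecProj φ v = 0) : planeDet u v = 0 := by
  simp only [vecProj] at hu hv
  have h := Real.sin_sq_add_cos_sq φ
  simp only [planeDet]
  linear_combination (v.2 * Real.cos φ - v.1 * Real.sin φ) * hu +
    (u.1 * Real.sin φ - u.2 * Real.cos φ) * hv - (u.1 * v.2 - u.2 * v.1) * h

/-- For small `ε` this transfers the sign of a projection from both sides of a critical angle to the
angle itself, keeping the inequality strict. -/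
lemma vecProj_add_add_vecProj_sub (φ ε : ℝ) (v : ℝ × ℝ) :
    vecProj (φ + ε) v + vecProj (φ - ε) v = 2 * Real.cos ε * vecProj φ v := by
  simp only [vecProj, Real.cos_add, Real.cos_sub, Real.sin_add, Real.sin_sub]; ring

/-- A vector whose projection vanishes at `φ` and is negative right after `φ`. -/
lemma eq_smul_of_vecProj {φ ε : ℝ} (hε : 0 < ε) (hε' : ε < Real.pi) {v : ℝ × ℝ}
    (h : vecProj φ v = 0) (h' : vecProj (φ + ε) v < 0) :
    ∃ ρ : ℝ, 0 < ρ ∧ v = ρ • (Real.sin φ, -Real.cos φ) := by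
  have hs := Real.sin_pos_of_pos_of_lt_pi hε hε'
  have hsq := Real.sin_sq_add_cos_sq φ
  refine ⟨v.1 * Real.sin φ - v.2 * Real.cos φ, ?_, ?_⟩
  · have e : vecProj (φ + ε) v = vecProj φ v * Real.cos ε -
        (v.1 * Real.sin φ - v.2 * Real.cos φ) * Real.sin ε := by
      simp only [vecProj, Real.cos_add, Real.sin_add]; ring
    rw [e, h, zero_mul, zero_sub, neg_lt_zero] at h'
    exact (pos_iff_pos_of_mul_pos h').2 hs
  · simp only [vecProj] at h
    ext
    · simp only [Prod.smul_fst, smul_eq_mul]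
      linear_combination Real.cos φ * h - v.1 * hsq
    · simp only [Prod.smul_snd, smul_eq_mul]
      linear_combination Real.sin φ * h - v.2 * hsq

/-- The vector from the point `y` to the point `x`. -/
def pointDiff (x y : EuclideanSpace ℝ (Fin 2)) : ℝ × ℝ := (x 0 - y 0, x 1 - y 1)

lemma vecProj_pointDiff (φ : ℝ) (x y : EuclideanSpace ℝ (Fin 2)) :
    vecProj φ (pointDiff x y) = projAt φ x - projAt φ y := by
  simp only [vecProj, pointDiff, projAt]; ring

lemma continuous_projAt (x : EuclideanSpace ℝ (Fin 2)) : Continuous fun φ => projAt φ x := by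
  unfold projAt; fun_prop

namespace IsLabelling

variable {n t : ℕ} {A : AllowableSequence (2 * n)} {G : PeriodicSignature t n}
  {κ : ℤ → ℕ → Fin (2 * n)}

lemma passes_of_lt (hl : A.IsLabelling G κ) (hn : 0 < n) {s : ℤ} {p q : Fin (2 * n)}
    (h : ∀ s', s ≤ s' → s' < s + 2 * n → A.perm s' p < A.perm s' q) : A.Passes s p q := by
  refine ⟨?_, h s le_rfl (by omega)⟩
  have h1 := h (s - 1 + 2 * n) (by omega) (by omega)
  rwa [hl.perm_add, hl.perm_add, Fin.rev_lt_rev] at h1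

lemma passes_rev (hl : A.IsLabelling G κ) {s a b : ℤ} {i j : ℕ}
    (h : A.Passes s (κ a i) (κ b j)) : A.Passes s (κ (b + t) j) (κ (a + t) i) := by
  obtain ⟨h1, h2⟩ := h
  have c1 := hl.isModel.conj (s - 1) a i
  have c2 := hl.isModel.conj (s - 1) b j
  have c3 := hl.isModel.conj s a i
  have c4 := hl.isModel.conj s b j
  constructor <;> rw [Fin.lt_def] at * <;> omega

lemma add_two_mul (hl : A.IsLabelling G κ) (a : ℤ) (i : ℕ) : κ (a + t + t) i = κ a i := by
  rw [hl.perm_rev, hl.perm_rev, Fin.rev_rev]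

/-- The differences of opposite points in a realization form a configuration. -/
theorem exists_isConfiguration (hl : A.IsLabelling G κ) (ht : 0 < t)
    (h : A.IsGeometricallyRealizable) : ∃ V, G.IsConfiguration V := by
  obtain ⟨P, -, θ, hθ, -, hord⟩ := h
  have hn := G.pos_of_pos ht
  -- The points are in opposite orders on the two sides of `θ s`, so by continuity their projections
  -- agree there.
  have hproj : ∀ s p q, A.Passes s p q → projAt (θ s) (P p) = projAt (θ s) (P q) := by
    intro s p q ⟨h1, h2⟩
    have hcont : ∀ x, Continuous fun φ => projAt φ (P x) := fun x => continuous_projAt _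
    apply le_antisymm
    · refine ContinuousWithinAt.closure_le (s := Set.Ioo (θ s) (θ (s + 1)))
        (f := fun φ => projAt φ (P p)) (g := fun φ => projAt φ (P q)) ?_
        (hcont p).continuousWithinAt (hcont q).continuousWithinAt
        fun φ hφ => ((hord s φ hφ.1 hφ.2 p q).1 h2).le
      rw [closure_Ioo (hθ (by omega)).ne]
      exact Set.left_mem_Icc.2 (hθ (by omega)).le
    · refine ContinuousWithinAt.closure_le (s := Set.Ioo (θ (s - 1)) (θ s))
        (f := fun φ => projAt φ (P q)) (g := fun φ => projAt φ (P p)) ?_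
        (hcont q).continuousWithinAt (hcont p).continuousWithinAt
        fun φ hφ => ((hord (s - 1) φ hφ.1 (by rw [sub_add_cancel]; exact hφ.2) q p).1 h1).le
      rw [closure_Ioo (hθ (by omega)).ne]
      exact Set.right_mem_Icc.2 (hθ (by omega)).le
  have hε : ∀ s, ∃ ε, 0 < ε ∧ ε < Real.pi / 2 ∧ θ s + ε < θ (s + 1) ∧ θ (s - 1) < θ s - ε := by
    intro s
    have h1 := hθ (show s < s + 1 by omega)
    have h2 := hθ (show s - 1 < s by omega)
    obtain ⟨ε, e1, e2⟩ := exists_between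
      (lt_min (lt_min (sub_pos.2 h1) (sub_pos.2 h2)) (half_pos Real.pi_pos))
    rw [lt_min_iff, lt_min_iff] at e2
    exact ⟨ε, e1, e2.2, by linarith [e2.1.1], by linarith [e2.1.2]⟩
  -- The realization itself need not be centrally symmetric; differences of opposite points
  -- symmetrize it.
  set V : ℤ → ℕ → ℝ × ℝ := fun a i => pointDiff (P (κ a i)) (P (κ (a + t) i)) with hV
  have hconj : ∀ a, a - t + t + t = a + (t : ℤ) := fun a => by ring
  have hκ : ∀ a j, κ (a - t) j = κ (a + t) j := fun a j => by
    rw [← hconj, hl.add_two_mul]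
  -- the projections of the vectors
  have hneg : ∀ (a : ℤ) i s φ, i < G.size a → G.crossTime a ≤ s → s < G.crossTime a + 2 * n →
      θ s < φ → φ < θ (s + 1) → vecProj φ (V a i) < 0 := by
    intro a i s φ hi h1 h2 h3 h4
    rw [hV, vecProj_pointDiff, sub_neg]
    have := hl.isModel.lt_conj hi hi h1 h2
    rw [hκ] at this
    exact (hord s φ h3 h4 _ _).1 (by rw [Fin.lt_def]; exact_mod_cast this)
  have hpolar : ∀ (a : ℤ) i, i < G.size a → ∃ ρ : ℝ, 0 < ρ ∧
      V a i = ρ • (Real.sin (θ (G.crossTime a)), -Real.cos (θ (G.crossTime a))) := by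
    intro a i hi
    obtain ⟨ε, e1, e2, e3, -⟩ := hε (G.crossTime a)
    refine eq_smul_of_vecProj e1 (by linarith [Real.pi_pos]) ?_
      (hneg a i _ _ hi le_rfl (by omega) (by linarith) e3)
    rw [hV, vecProj_pointDiff, sub_eq_zero]
    refine hproj _ _ _ (hl.passes_of_lt hn fun s h1 h2 => ?_)
    have := hl.isModel.lt_conj hi hi h1 h2
    rw [hκ] at this
    rw [Fin.lt_def]; exact_mod_cast this
  have hself : ∀ (a : ℤ) i, i < G.size a → vecProj (θ (G.crossTime a)) (V a i) = 0 := by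
    intro a i hi
    obtain ⟨ρ, -, e⟩ := hpolar a i hi
    rw [e]; simp only [vecProj, Prod.smul_fst, Prod.smul_snd, smul_eq_mul]; ring
  have hneg' : ∀ (a : ℤ) i s, i < G.size a → G.crossTime a < s → s < G.crossTime a + 2 * n →
      vecProj (θ s) (V a i) < 0 := by
    intro a i s hi h1 h2
    obtain ⟨ε, e1, e2, e3, e4⟩ := hε s
    have k1 := hneg a i s (θ s + ε) hi h1.le h2 (by linarith) e3
    have k2 := hneg a i (s - 1) (θ s - ε) hi (by omega) (by omega) e4
      (by rw [sub_add_cancel]; linarith)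
    have k3 := vecProj_add_add_vecProj_sub (θ s) ε (V a i)
    have k4 : 0 < Real.cos ε := Real.cos_pos_of_mem_Ioo ⟨by linarith, e2⟩
    by_contra hle
    have := mul_nonneg k4.le (not_lt.1 hle)
    linarith
  have hcross : ∀ (a : ℤ) i (b : ℤ) j, a < b → b < a + t → i < G.size a → j < G.size b →
      vecProj (θ (G.swapTime a i b j)) (V a i + V b j) = 0 := by
    intro a i b j hab hba hi hj
    have p1 : A.Passes (G.swapTime a i b j) (κ a i) (κ (b - t) j) :=
      hl.passes_of_lt hn fun s h1 h2 => by
        have := hl.isModel.lt_cross hab hba hi hj h1 h2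
        rw [Fin.lt_def]; exact_mod_cast this
    have p2 := hl.passes_rev p1
    rw [sub_add_cancel] at p2
    rw [hκ] at p1
    have q1 := hproj _ _ _ p1
    have q2 := hproj _ _ _ p2
    -- Regrouped, `V a i + V b j` is the sum of the differences of the pairs in `p1` and `p2`. These
    -- pairs are conjugate and pass in the same move, so both contributions vanish.
    rw [vecProj_add, hV, vecProj_pointDiff, vecProj_pointDiff]
    linarith
  refine ⟨V, ?_, ?_, ?_, ?_, ?_⟩
  · intro a i
    simp only [hV, hl.add_two_mul, pointDiff, Prod.neg_mk, neg_sub]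
  · intro a i j hij hj
    obtain ⟨ρ, r1, r2⟩ := hpolar a i (by omega)
    obtain ⟨ρ', r1', r2'⟩ := hpolar a j hj
    refine ⟨ρ / ρ', ?_, ?_⟩
    · rw [one_lt_div r1']
      obtain ⟨ε, e1, e2, e3, -⟩ := hε (G.crossTime a)
      have hs := Real.sin_pos_of_pos_of_lt_pi e1 (by linarith [Real.pi_pos])
      have m1 := hl.isModel.lt_same hij hj (le_refl (G.crossTime a)) (by omega)
      have m2 := hl.isModel.conj (G.crossTime a) a i
      have m3 := hl.isModel.conj (G.crossTime a) a j
      have o := hord (G.crossTime a) (θ (G.crossTime a) + ε) (by linarith) e3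
      have k1 := (o (κ a i) (κ a j)).1 (by rw [Fin.lt_def]; exact_mod_cast m1)
      have k2 := (o (κ (a + t) j) (κ (a + t) i)).1 (by rw [Fin.lt_def]; omega)
      have k3 : vecProj (θ (G.crossTime a) + ε) (V a i) <
          vecProj (θ (G.crossTime a) + ε) (V a j) := by
        rw [hV, vecProj_pointDiff, vecProj_pointDiff]; linarith
      have key : ∀ ρ : ℝ, vecProj (θ (G.crossTime a) + ε)
          (ρ • (Real.sin (θ (G.crossTime a)), -Real.cos (θ (G.crossTime a)))) =
          -(ρ * Real.sin ε) := by
        intro ρ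
        simp only [vecProj, Real.cos_add, Real.sin_add, Prod.smul_fst, Prod.smul_snd, smul_eq_mul]
        linear_combination (-ρ * Real.sin ε) * Real.sin_sq_add_cos_sq (θ (G.crossTime a))
      rw [r2, r2', key, key, neg_lt_neg_iff] at k3
      exact lt_of_mul_lt_mul_right k3 hs.le
    · rw [r2, r2', smul_smul, div_mul_cancel₀ _ r1'.ne']
  · intro a b i j hab hba hi hj
    obtain ⟨ρ, r1, r2⟩ := hpolar b j hj
    have h1 := G.crossTime_strictMono hab
    have h2 := G.crossTime_strictMono hba
    rw [G.crossTime_add] at h2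
    have := mul_pos r1 (neg_pos.2 (hneg' a i _ hi h1 h2))
    have e : planeDet (V a i) (V b j) = ρ * -vecProj (θ (G.crossTime b)) (V a i) := by
      rw [r2]; simp only [planeDet, vecProj, Prod.smul_fst, Prod.smul_snd, smul_eq_mul]; ring
    rw [e]; exact this
  · intro c k a i b j hk hab hba hi hj he
    exact planeDet_eq_zero_of_vecProj (hself c k hk) (he ▸ hcross a i b j hab hba hi hj)
  · intro a i b j a' i' b' j' hab hba hi hj hab' hba' hi' hj' he
    exact planeDet_eq_zero_of_vecProj (hcross a i b j hab hba hi hj)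
      (he ▸ hcross a' i' b' j' hab' hba' hi' hj')

end IsLabelling

end AllowableSequence

/-! ### Consequences of coinciding times. -/

lemma exists_eq_add_smul_of_planeDet_ne_zero {u v : ℝ × ℝ} (h : planeDet u v ≠ 0) (w : ℝ × ℝ) :
    ∃ x y : ℝ, w = x • u + y • v := by
  refine ⟨planeDet w v / planeDet u v, planeDet u w / planeDet u v, ?_⟩
  ext <;> simp only [Prod.fst_add, Prod.snd_add, Prod.smul_fst, Prod.smul_snd, smul_eq_mul] <;>
    field_simp <;> simp only [planeDet] <;> ring

lemma planeDet_add_smul (u v : ℝ × ℝ) (x y z w : ℝ) :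
    planeDet (x • u + y • v) (z • u + w • v) = (x * w - y * z) * planeDet u v := by
  simp only [planeDet, Prod.fst_add, Prod.snd_add, Prod.smul_fst, Prod.smul_snd, smul_eq_mul]; ring

lemma eq_of_planeDet_add_smul {u v : ℝ × ℝ} (h : planeDet u v ≠ 0) {x y z w : ℝ}
    {p q : ℝ × ℝ} (hpq : planeDet p q = 0) (hp : p = x • u + y • v) (hq : q = z • u + w • v) :
    x * w = y * z := by
  rw [hp, hq, planeDet_add_smul] at hpq
  exact sub_eq_zero.1 ((mul_eq_zero.1 hpq).resolve_right h)

namespace PeriodicSignature.IsConfiguration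

variable {t n : ℕ} {G : PeriodicSignature t n} {V : ℤ → ℕ → ℝ × ℝ}

lemma offsets (G : PeriodicSignature t n) (a : ℤ) :
    G.offset (a + 1) = G.offset a + G.size a ∧
    G.offset (a + 1 + 1) = G.offset a + G.size a + G.size (a + 1) ∧
    G.offset (a + 2) = G.offset a + G.size a + G.size (a + 1) ∧
    G.offset (a + 2 + 1) = G.offset a + G.size a + G.size (a + 1) + G.size (a + 2) ∧
    G.offset (a + 3) = G.offset a + G.size a + G.size (a + 1) + G.size (a + 2) ∧
    G.offset (a + 3 + 1) =
      G.offset a + G.size a + G.size (a + 1) + G.size (a + 2) + G.size (a + 3) := by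
  have h1 := G.offset_succ a
  have h2 := G.offset_succ (a + 1)
  have h3 := G.offset_succ (a + 2)
  have h4 := G.offset_succ (a + 3)
  rw [show a + 2 + 1 = a + 3 by ring] at *
  rw [show a + 1 + 1 = a + 2 by ring] at *
  omega

/-- Let `P₀`, `P₁` be the two innermost points of class `a`, let `C` be the innermost point of
class `a + 2`, and let `X`, described by `b` and `j`, be the point next to `C` (outward in class
`a + 2`, or else the innermost one of class `a + 3`). Then `X = r • C`, where `P₁ = r • P₀`. -/
lemma exists_ratio (h : G.IsConfiguration V) {a : ℤ} (ha : 2 ≤ G.size a) {b : ℤ}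
    {j : ℕ} (hab : a + 2 ≤ b) (hba : b < a + t) (hj : j < G.size b)
    (hb : G.offset (b + 1) - j = G.offset (a + 2) + 2) :
    ∃ β r : ℝ, 0 < β ∧ 1 < r ∧ β * r = 1 + β ∧ V a (G.size a - 2) = r • V a (G.size a - 1) ∧
      V (a + 1) 0 = β • V a (G.size a - 1) + β • V (a + 2) (G.size (a + 2) - 1) ∧
      V b j = r • V (a + 2) (G.size (a + 2) - 1) := by
  obtain ⟨o1, o2, o3, o4, -, -⟩ := offsets G a
  have s1 := G.size_pos (a + 1)
  have s2 := G.size_pos (a + 2)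
  obtain ⟨r, hr, hP⟩ := h.same a (G.size a - 2) (G.size a - 1) (by omega) (by omega)
  have hD := h.pos a (a + 2) (G.size a - 1) (G.size (a + 2) - 1) (by omega) (by omega) (by omega)
    (by omega)
  have hB := h.pos a (a + 1) (G.size a - 1) 0 (by omega) (by omega) (by omega) (by omega)
  -- With `B = V (a + 1) 0`, the four coincidences are `P₀ + C ∥ B`, `P₀ + B ∥ P₁ + C`, `P₁ + X ∥ B`
  -- and `P₀ + X ∥ B + C`; they are solved in the basis `P₀`, `C`.
  have h1 := h.cross (a + 1) 0 a (G.size a - 1) (a + 2) (G.size (a + 2) - 1) (by omega) (by omega)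
    (by omega) (by omega) (by omega) (by simp only [crossTime, swapTime]; omega)
  have h2 := h.swap a (G.size a - 1) (a + 1) 0 a (G.size a - 2) (a + 2) (G.size (a + 2) - 1)
    (by omega) (by omega) (by omega) (by omega) (by omega) (by omega) (by omega) (by omega)
    (by simp only [swapTime]; omega)
  have h3 := h.cross (a + 1) 0 a (G.size a - 2) b j (by omega) (by omega)
    (by omega) (by omega) (by omega) (by simp only [crossTime, swapTime]; omega)
  have h4 := h.swap a (G.size a - 1) b j (a + 1) 0 (a + 2) (G.size (a + 2) - 1)
    (by omega) (by omega) (by omega) (by omega) (by omega) (by omega) (by omega) (by omega)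
    (by simp only [swapTime]; omega)
  obtain ⟨β, β', eB⟩ := exists_eq_add_smul_of_planeDet_ne_zero hD.ne' (V (a + 1) 0)
  obtain ⟨x, y, eX⟩ := exists_eq_add_smul_of_planeDet_ne_zero hD.ne' (V b j)
  generalize V a (G.size a - 2) = P₁ at *
  generalize V a (G.size a - 1) = P₀ at *
  generalize V (a + 2) (G.size (a + 2) - 1) = C at *
  generalize V (a + 1) 0 = B at *
  generalize V b j = X at *
  subst eB eX hP
  have k1 : β * 1 = β' * 1 := eq_of_planeDet_add_smul hD.ne' h1 rfl (by module)
  obtain rfl : β = β' := by linarith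
  have hβ : 0 < β := by
    have e : planeDet P₀ (β • P₀ + β • C) = β * planeDet P₀ C := by
      simp only [planeDet, Prod.fst_add, Prod.snd_add, Prod.smul_fst, Prod.smul_snd, smul_eq_mul]
      ring
    rw [e] at hB
    exact (pos_iff_pos_of_mul_pos hB).2 hD
  have k2 : (1 + β) * 1 = β * r :=
    eq_of_planeDet_add_smul hD.ne' h2 (by module) (by module)
  have k3 : β * y = β * (r + x) := eq_of_planeDet_add_smul hD.ne' h3 rfl (by module)
  have k4 : (1 + x) * (β + 1) = y * β :=
    eq_of_planeDet_add_smul hD.ne' h4 (by module) (by module)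
  have hx : x = 0 := by linear_combination k4 + k3 - k2
  have hy : y = r := by
    have := mul_left_cancel₀ hβ.ne' k3
    rw [this, hx, add_zero]
  refine ⟨β, r, hβ, hr, by linarith, rfl, rfl, ?_⟩
  rw [hx, hy, zero_smul, zero_add]

lemma planeDet_smul_self (r : ℝ) (u : ℝ × ℝ) : planeDet u (r • u) = 0 := by
  simp only [planeDet, Prod.smul_fst, Prod.smul_snd, smul_eq_mul]; ring

/-- If the class `a + 2` has two points and is followed by another point, described by `b` and `j`,
then the class `a` has only one point. -/
lemma size_lt_two (h : G.IsConfiguration V) {a : ℤ} (ha2 : 2 ≤ G.size (a + 2)) {b : ℤ}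
    {j : ℕ} (hab : a + 2 ≤ b) (hba : b < a + t) (hj : j < G.size b)
    (hb : G.offset (b + 1) - j = G.offset (a + 2) + 3) : G.size a < 2 := by
  by_contra! ha
  obtain ⟨o1, o2, o3, o4, -, -⟩ := offsets G a
  have s1 := G.size_pos (a + 1)
  obtain ⟨β, r, hβ, hr, hβr, e1, e2, e3⟩ := h.exists_ratio ha le_rfl (by omega)
    (j := G.size (a + 2) - 2) (by omega) (by omega)
  have hD := h.pos a (a + 2) (G.size a - 1) (G.size (a + 2) - 1) (by omega) (by omega) (by omega)
    (by omega)
  have hY : 0 ≤ planeDet (V (a + 2) (G.size (a + 2) - 1)) (V b j) := by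
    rcases hab.eq_or_lt with rfl | hab
    · obtain ⟨x, -, hx⟩ := h.same (a + 2) j (G.size (a + 2) - 1) (by omega) (by omega)
      rw [hx, planeDet_smul_self]
    · exact (h.pos _ _ _ _ hab (by omega) (by omega) hj).le
  -- With `X = V (a + 2) (size (a + 2) - 2)` and `Y = V b j`, these say `P₁ + Y ∥ P₀ + X` and `P₀ +
  -- Y ∥ B + X`.
  have h1 := h.swap a (G.size a - 2) b j a (G.size a - 1) (a + 2) (G.size (a + 2) - 2)
    (by omega) (by omega) (by omega) (by omega) (by omega) (by omega) (by omega) (by omega)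
    (by simp only [swapTime]; omega)
  have h2 := h.swap a (G.size a - 1) b j (a + 1) 0 (a + 2) (G.size (a + 2) - 2)
    (by omega) (by omega) (by omega) (by omega) (by omega) (by omega) (by omega) (by omega)
    (by simp only [swapTime]; omega)
  obtain ⟨z, w, eY⟩ := exists_eq_add_smul_of_planeDet_ne_zero hD.ne' (V b j)
  rw [e1, e3, eY] at h1
  rw [e2, e3, eY] at h2
  rw [eY] at hY
  generalize V a (G.size a - 1) = P₀ at *
  generalize V (a + 2) (G.size (a + 2) - 1) = C at *
  have k1 : (r + z) * r = w * 1 := eq_of_planeDet_add_smul hD.ne' h1 (by module) (by module)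
  have k2 : (1 + z) * (β + r) = w * β := eq_of_planeDet_add_smul hD.ne' h2 (by module) (by module)
  -- So the coefficient `z` of `P₀` in `Y` is positive, which puts `Y` on the side of `C` towards
  -- class `a`, against `hY`.
  have hz : z * (r - 1) = 1 := by linear_combination k2 - β * k1 + (r + z + 1) * hβr
  have hz0 : 0 < z := (pos_iff_pos_of_mul_pos (hz ▸ one_pos)).2 (by linarith)
  have e : planeDet C (z • P₀ + w • C) = -(z * planeDet P₀ C) := by
    simp only [planeDet, Prod.fst_add, Prod.snd_add, Prod.smul_fst, Prod.smul_snd, smul_eq_mul]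
    ring
  have := mul_pos hz0 hD
  linarith

/-- With a fourth class, the points of `a + 2` are always followed by one of `a + 3`. If class `a +
2` is a single point, `exists_ratio` makes points of different classes parallel; otherwise a third
point exists, in class `a + 2` or `a + 3`, and `size_lt_two` applies. -/
theorem size_eq_one_of_four_le (h : G.IsConfiguration V) (ht : 4 ≤ t) (a : ℤ) : G.size a = 1 := by
  have s0 := G.size_pos a
  have s2 := G.size_pos (a + 2)
  have s3 := G.size_pos (a + 3)
  obtain ⟨-, -, o3, o4, -, o6⟩ := offsets G a
  by_contra hne
  rcases lt_trichotomy (G.size (a + 2)) 2 with hs | hs | hs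
  · obtain ⟨-, r, -, -, -, -, -, e⟩ := h.exists_ratio (a := a) (by omega)
      (show a + 2 ≤ a + 3 by omega) (by omega) (j := G.size (a + 3) - 1) (by omega) (by omega)
    have := h.pos (a + 2) (a + 3) (G.size (a + 2) - 1) (G.size (a + 3) - 1) (by omega) (by omega)
      (by omega) (by omega)
    rw [e, planeDet_smul_self] at this
    exact lt_irrefl _ this
  · have := h.size_lt_two (a := a) (by omega) (show a + 2 ≤ a + 3 by omega) (by omega)
      (j := G.size (a + 3) - 1) (by omega) (by omega)
    omega
  · have := h.size_lt_two (a := a) (by omega) le_rfl (by omega)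
      (j := G.size (a + 2) - 3) (by omega) (by omega)
    omega

lemma size_le_two {G : PeriodicSignature 3 n} (h : G.IsConfiguration V) {a : ℤ}
    (ha : 2 ≤ G.size a) : G.size (a + 2) ≤ 2 := by
  by_contra! hs
  obtain ⟨-, -, o3, o4, -, -⟩ := offsets G a
  have := h.size_lt_two (a := a) (by omega) le_rfl (by omega)
      (j := G.size (a + 2) - 3) (by omega) (by omega)
  omega

/-- If class `a + 1` were the single point `B`, then, as `V (a + 3) = -V a`, two further
coincidences `C ∥ B - P₀` and `X - P₀ ∥ B - P₁` would arise. The first gives `β = 1` and `r = 2`,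
which violates the second. -/
lemma size_ne_one {G : PeriodicSignature 3 n} (h : G.IsConfiguration V) {a : ℤ}
    (ha : 2 ≤ G.size a) (ha2 : G.size (a + 2) = 2) : G.size (a + 1) ≠ 1 := by
  intro ha1
  obtain ⟨o1, o2, o3, o4, o5, o6⟩ := offsets G a
  obtain ⟨β, r, hβ, hr, hβr, e1, e2, e3⟩ := h.exists_ratio ha le_rfl (by omega)
    (j := 0) (by omega) (by omega)
  have hD := h.pos a (a + 2) (G.size a - 1) (G.size (a + 2) - 1) (by omega) (by omega) (by omega)
    (by omega)
  have hs : G.size (a + 3) = G.size a := G.size_add a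
  have hanti : ∀ i, V (a + 3) i = -V a i := h.anti a
  have h1 := h.cross (a + 2) (G.size (a + 2) - 1) (a + 1) 0 (a + 3) (G.size a - 1) (by omega)
    (by omega) (by push_cast; omega) (by omega) (by omega)
    (by simp only [crossTime, swapTime]; omega)
  have h2 := h.swap (a + 2) 0 (a + 3) (G.size a - 1) (a + 1) 0 (a + 3) (G.size a - 2)
    (by omega) (by push_cast; omega) (by omega) (by omega) (by omega) (by push_cast; omega)
    (by omega) (by omega) (by simp only [swapTime]; omega)
  rw [hanti, e2] at h1
  rw [hanti, hanti, e1, e2, e3] at h2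
  generalize V a (G.size a - 1) = P₀ at *
  generalize V (a + 2) (G.size (a + 2) - 1) = C at *
  have k1 : 0 * β = 1 * (β - 1) := eq_of_planeDet_add_smul hD.ne' h1 (by module) (by module)
  have k2 : (-1) * β = r * (β - r) := eq_of_planeDet_add_smul hD.ne' h2 (by module) (by module)
  obtain rfl : β = 1 := by linarith
  obtain rfl : r = 2 := by linarith
  norm_num at k2

/-- The bound for class `a + 2` makes its size exactly 2, `size_ne_one` then makes class `a + 1`
nontrivial, and the same bound, started from classes `a + 1` and `a + 2`, caps the sizes of `a` and
`a + 1`. -/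
theorem size_eq_two {G : PeriodicSignature 3 n} (h : G.IsConfiguration V) {a : ℤ}
    (ha : 2 ≤ G.size a) (ha2 : 2 ≤ G.size (a + 2)) (b : ℤ) : G.size b = 2 := by
  have hper : ∀ a, G.size (a + 3) = G.size a := G.size_add
  have l := h.size_le_two ha
  have m := h.size_ne_one ha (by omega)
  have s1 := G.size_pos (a + 1)
  have l1 := h.size_le_two (a := a + 1) (by omega)
  have l2 := h.size_le_two (a := a + 2) (by omega)
  rw [show a + 1 + 2 = a + 3 by ring, hper] at l1
  rw [show a + 2 + 2 = a + 1 + 3 by ring, hper] at l2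
  obtain ⟨m, hm⟩ : ∃ m : ℤ, b = a + (3 : ℕ) * m ∨ b = a + 1 + (3 : ℕ) * m ∨
      b = a + 2 + (3 : ℕ) * m := ⟨(b - a) / 3, by push_cast; omega⟩
  rcases hm with rfl | rfl | rfl <;> rw [G.size_add_mul] <;> omega

end PeriodicSignature.IsConfiguration

/-! ### The theorem. -/

theorem theorem4p2 (t : ℕ) (ht : 2 ≤ t) (d : Fin t → ℕ) (hd : ∀ i, 0 < d i) :
    (∃! A : Σ n : ℕ, AllowableSequence (2 * n), A.2.IsDC d) ∧
    ∀ (n : ℕ) (A : AllowableSequence (2 * n)), A.IsDC d →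
      (A.IsGeometricallyRealizable ↔
        ((∀ i, d i = 1) ∨
          t = 2 ∨
          (t = 3 ∧ ∃ i j, i ≠ j ∧ d i = 1 ∧ d j = 1) ∨
          (t = 3 ∧ ∀ i, d i = 2))) := by
  refine ⟨AllowableSequence.existsUnique_isDC t ht d hd, fun n A hA => ?_⟩
  obtain ⟨hn, κ, hl⟩ := hA.exists_isLabelling ht hd
  have ht0 : 0 < t := by omega
  have hsize : ∀ (i : Fin t) (q : ℤ),
      (PeriodicSignature.ofFin d ht0 hd n hn).size ((i : ℕ) + t * q) = d i := fun i q => by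
    rw [PeriodicSignature.size_add_mul, PeriodicSignature.ofFin_size]
  generalize PeriodicSignature.ofFin d ht0 hd n hn = G at *
  have hsize0 : ∀ i : Fin t, G.size (i : ℕ) = d i := fun i => by simpa using hsize i 0
  have hall : ∀ x, (∀ i, d i = x) → ∀ a, G.size a = x := by
    intro x h a
    obtain ⟨r, q, rfl⟩ := PeriodicSignature.exists_eq_add_mul ht0 a
    rw [hsize, h]
  constructor
  · intro hr
    obtain ⟨V, hV⟩ := hl.exists_isConfiguration ht0 hr
    rcases lt_or_ge 3 t with h4 | h3
    · exact Or.inl fun i => by rw [← hsize0, hV.size_eq_one_of_four_le h4]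
    · obtain rfl | rfl : t = 2 ∨ t = 3 := by omega
      · exact Or.inr (Or.inl rfl)
      · refine Or.inr (Or.inr ?_)
        have h0 : G.size 0 = d 0 := hsize0 0
        have h1 : G.size 1 = d 1 := hsize0 1
        have h2 : G.size 2 = d 2 := hsize0 2
        have p0 := hd 0
        have p1 := hd 1
        have p2 := hd 2
        by_cases c0 : d 0 = 1 ∧ d 1 = 1
        · exact Or.inl ⟨rfl, 0, 1, by decide, c0⟩
        by_cases c1 : d 1 = 1 ∧ d 2 = 1
        · exact Or.inl ⟨rfl, 1, 2, by decide, c1⟩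
        by_cases c2 : d 0 = 1 ∧ d 2 = 1
        · exact Or.inl ⟨rfl, 0, 2, by decide, c2⟩
        -- At least two of the three sizes now exceed 1. Modulo 3, any two classes have the form
        -- `a`, `a + 2`, so `size_eq_two` applies with `a` equal to 0, 1 or 2.
        have h3 : G.size (1 + 2) = d 0 := (G.size_add 0).trans h0
        have h4 : G.size (2 + 2) = d 1 := (G.size_add 1).trans h1
        refine Or.inr ⟨rfl, fun i => ?_⟩
        rw [← hsize0]
        by_cases e0 : 2 ≤ d 0
        · by_cases e2 : 2 ≤ d 2
          · exact hV.size_eq_two (a := 0) (by omega) (by rw [zero_add]; omega) _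
          · exact hV.size_eq_two (a := 1) (by omega) (by omega) _
        · exact hV.size_eq_two (a := 2) (by omega) (by omega) _
  · rintro (h | rfl | ⟨rfl, i, j, hij, hi, hj⟩ | ⟨rfl, h⟩)
    · exact hl.isGeometricallyRealizable_of_size_eq_one ht0 (hall 1 h)
    · exact hl.isGeometricallyRealizable_of_eq_two
    -- Only one residue modulo 3 can carry a size other than 1, so neither two consecutive classes
    -- nor two classes at distance 2 can both be nontrivial.
    · have key : ∀ a b, G.size a ≠ 1 → G.size b ≠ 1 → (3 : ℤ) ∣ b - a := by
        intro a b ha hb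
        obtain ⟨r, q, rfl⟩ := PeriodicSignature.exists_eq_add_mul ht0 a
        obtain ⟨r', q', rfl⟩ := PeriodicSignature.exists_eq_add_mul ht0 b
        rw [hsize] at ha hb
        have h1 : r ≠ i := fun h => ha (h ▸ hi)
        have h2 : r ≠ j := fun h => ha (h ▸ hj)
        have h3 : r' ≠ i := fun h => hb (h ▸ hi)
        have h4 : r' ≠ j := fun h => hb (h ▸ hj)
        obtain rfl : r = r' := by omega
        exact ⟨q' - q, by push_cast; ring⟩
      refine hl.isGeometricallyRealizable_of_two_size_eq_one fun a => ⟨?_, ?_⟩ <;>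
        by_contra! h
      · have := key _ _ h.1 h.2; omega
      · have := key _ _ h.1 h.2; omega
    · exact hl.isGeometricallyRealizable_of_size_eq_two (hall 2 h)
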